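/- **Conventions.** For $f:\mathbb R\to\mathbb R$, $\mathbf H(f)(x)=\frac1\pi\,\mathrm{p.v.}\!\int_{\mathbb R}\frac{f(y)}{x-y}\,dy$ is the Hilbert transform. Elements of $H^1(\mathbb R)$ are identified with their continuous representatives. A solution on $[0,T)$ of the Constantin–Lax–Majda (CLM) equation $\omega_t=\omega\,\mathbf H(\omega)$ with initial value $\omega_0$ is a function $\omega\in C([0,T);H^1(\mathbb R))$ with $\omega(\cdot,0)=\omega_0$ that satisfies the equation at every $(x,t)\in\mathbb R\times[0,T)$ (with the one-sided time derivative at $t=0$). **Theorem (Two-scale blowup: general case).** Let $\omega_0\in H^1(\mathbb R)$ be real-valued and such that 1. $\omega_0$ is odd; 2. $x=0$ is the unique zero of $\omega_0$, and $\operatorname{sgn}(\omega_0(x))=-\operatorname{sgn}(x)$ for all $x$; 3. for some integer $n\ge 1$ and some $\delta>0$, $\omega_0\in C^{2n+3}(-\delta,\delta)$, $\omega_0^{(k)}(0)=0$ for $k=0,1,\dots,2n$, and $\omega_0^{(2n+1)}(0)<0$. Then $\mathbf H(\omega_0)$ is defined at every point of $\mathbb R$, it is $C^2$ near $0$, and $\mathbf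 H(\omega_0)(0)>0$, $\mathbf H(\omega_0)''(0)>0$. Let $a,b,c>0$ be given by $$\mathbf H(\omega_0)(0)=2a,\qquad \mathbf H(\omega_0)''(0)=4b,\qquad \omega_0^{(2n+1)}(0)=-4c\,(2n+1)!,$$ and let $$T=\frac1a,\qquad \Omega_{2,n}(z)=-\frac{a^{2n+1}b^{(2n+1)/2}c}{a^{4n}c^2+b^{2n+2}z^2}.$$ Then the Hilbert transform of $\Omega_{2,n}$ is $$\mathbf H(\Omega_{2,n})(z)=-\frac{a\,b^{(4n+3)/2}z}{a^{4n}c^2+b^{2n+2}z^2}.$$ The CLM equation with initial value $\omega_0$ has a solution on $[0,T)$, and every such solution $\omega$ blows up at time $T$: $\|\omega(\cdot,t)\|_{L^\infty(\mathbb R)}\to\infty$ as $t\to T^-$. Moreover, there are $t_0\in(0,T)$ and a function $r\in C^1([t_0,T])$ with $$r(T)=\frac{a}{b^{1/2}}$$ such that for every such solution $\omega$, as $t\to T^-$, for $x=r(t)(T-t)^{1/2}+O((T-t)^n)$, $$\omega(x,t)=\frac1{(T-t)^{(2n+1)/2}}\left(\Omega_{2,n}\!\left(\frac{x-r(t)(T-t)^{1/2}}{(T-t)^n}\right)+O\big((T-t)^{1/2}\big)\right),$$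 $$\mathbf H(\omega)(x,t)=\frac1{(T-t)^{(2n+1)/2}}\left(\mathbf H(\Omega_{2,n})\!\left(\frac{x-r(t)(T-t)^{1/2}}{(T-t)^n}\right)+O\big((T-t)^{1/2}\big)\right).$$ That is, for every $K$ there are $C$ and $t_1\in[t_0,T)$ such that, for all $t\in[t_1,T)$ and all $x$ with $|x-r(t)(T-t)^{1/2}|\le K(T-t)^n$, both error terms written $O((T-t)^{1/2})$ are bounded by $C(T-t)^{1/2}$ in absolute value. -/

import Mathlib

open Set Filter Topology MeasureTheory

namespace CLM

/-- The Hilbert transform of `f` exists at `x` and equals `h`: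
`h = (1/π) p.v. ∫ f(y) / (x - y) dy`, the principal value being the limit as `ε → 0⁺` of the
(absolutely convergent) integrals over `|x - y| > ε`. -/
def HasHilbertTransformAt (f : ℝ → ℝ) (x h : ℝ) : Prop :=
  (∀ ε : ℝ, 0 < ε → IntegrableOn (fun y => f y / (x - y)) {y | ε < |x - y|}) ∧
  Tendsto (fun ε : ℝ => (1 / Real.pi) * ∫ y in {y | ε < |x - y|}, f y / (x - y))
    (𝓝[>] 0) (𝓝 h)

/-- The Hilbert transform `H(f)(x) = (1/π) p.v. ∫ f(y) / (x - y) dy`, as a function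
(meaningful at the points where `HasHilbertTransformAt` holds for some value). -/
noncomputable def hilbertTransform (f : ℝ → ℝ) (x : ℝ) : ℝ :=
  limUnder (𝓝[>] (0 : ℝ))
    (fun ε : ℝ => (1 / Real.pi) * ∫ y in {y | ε < |x - y|}, f y / (x - y))

theorem HasHilbertTransformAt.hilbertTransform_eq {f : ℝ → ℝ} {x h : ℝ}
    (hf : HasHilbertTransformAt f x h) : hilbertTransform f x = h :=
  hf.2.limUnder_eq

/-- `g` is the weak (distributional) derivative of `f` on `ℝ`. Only used for `f`, `g` in `L²`. -/
def HasWeakDeriv (f g : ℝ → ℝ) : Prop :=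
  ∀ φ : ℝ → ℝ, ContDiff ℝ (⊤ : ℕ∞) φ → HasCompactSupport φ →
    ∫ x, f x * deriv φ x = -∫ x, g x * φ x

/-- `f` belongs to `H¹(ℝ)`: it is in `L²` and has a weak derivative in `L²`. As usual an element of
`H¹(ℝ)`, whose values at points are spoken of, is identified with its continuous representative. -/
def MemH1 (f : ℝ → ℝ) : Prop :=
  Continuous f ∧ MemLp f 2 volume ∧ ∃ g : ℝ → ℝ, MemLp g 2 volume ∧ HasWeakDeriv f g

/-- `t ↦ ω t` belongs to `C(I; H¹(ℝ))`; `ω' t` is the weak derivative of `ω t` in space. -/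
def ContinuousIntoH1 (I : Set ℝ) (ω : ℝ → ℝ → ℝ) : Prop :=
  (∀ t ∈ I, MemH1 (ω t)) ∧
  ∃ ω' : ℝ → ℝ → ℝ, (∀ t ∈ I, MemLp (ω' t) 2 volume ∧ HasWeakDeriv (ω t) (ω' t)) ∧
    ∀ t ∈ I, Tendsto
      (fun s => eLpNorm (ω s - ω t) 2 volume + eLpNorm (ω' s - ω' t) 2 volume)
      (𝓝[I] t) (𝓝 0)

/-- `ω` (written `ω t x`) is the strong `H¹` solution on `[0, T)` of the Constantin–Lax–Majda
equation `∂ₜ ω = ω H(ω)` with initial value `ω₀`: it lies in `C([0, T); H¹(ℝ))` and satisfies the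
equation at every point (with the one-sided time derivative at `t = 0`). -/
structure IsSolution (ω₀ : ℝ → ℝ) (T : ℝ) (ω : ℝ → ℝ → ℝ) : Prop where
  initial : ω 0 = ω₀
  continuousInto : ContinuousIntoH1 (Ico 0 T) ω
  equation : ∀ t ∈ Ico 0 T, ∀ x : ℝ, ∃ h : ℝ, HasHilbertTransformAt (ω t) x h ∧
    HasDerivWithinAt (fun s => ω s x) (ω t x * h) (Ico 0 T) t

/-- The profile `Ω_{2,n}`. -/
noncomputable def profile (n : ℕ) (a b c z : ℝ) : ℝ :=
  -(a ^ (2 * n + 1) * b ^ ((2 * (n : ℝ) + 1) / 2) * c) /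
    (a ^ (4 * n) * c ^ 2 + b ^ (2 * n + 2) * z ^ 2)

/-- The explicit function that is claimed to be the Hilbert transform of `Ω_{2,n}`. -/
noncomputable def profileH (n : ℕ) (a b c z : ℝ) : ℝ :=
  -(a * b ^ ((4 * (n : ℝ) + 3) / 2) * z) /
    (a ^ (4 * n) * c ^ 2 + b ^ (2 * n + 2) * z ^ 2)

end CLM

/-! Complexification linearises the problem. Let `F(z) = (1/π) ∫ ω(y)/(z - y) dy` for `Im z > 0`; it
is holomorphic there with boundary values `H(ω) - iω`. Tricomi's identity
(`H1Pair.cauchy_mul_hilbert`) says that the Cauchy integral of `ω H(ω)` is `F²/2`, so the equation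
becomes the family of scalar equations `F_t = F²/2`, solved by `F = F₀/(1 - tF₀/2)`. On the real
line this reads `ω = 4ω₀/D` with `D = (2 - t H(ω₀))² + t² ω₀²`. `IsSolution.cauchy_mul` shows that
every solution obeys the formula, and `H1Pair.isSolution` that the formula gives a solution as long
as `1 - tF₀/2` stays away from zero on the closed half-plane.

The analytic input is a uniqueness principle (`eq_zero_of_im_boundary`): a bounded holomorphic
function on the half-plane that vanishes at `i∞` and has zero imaginary part on the boundary is
zero. It identifies a bounded holomorphic function with the Cauchy integral of its boundary values,
and gives Tricomi's identity, the Hilbert transform of the explicit solution and that of the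
Lorentzian profile. Existence also needs `H` to map `H¹` to itself (`H1Pair.exists_hilbert`), which
comes from an `L²` bound for Cauchy integrals on horizontal lines.

For odd data negative on the right half-line, `F₀` is real only on the imaginary axis, where it is
at most `H(ω₀)(0) = 2a`. Hence `tF₀ = 2` is impossible before `T = 1/a` (`nonvanishing_of_odd`).

Near the origin, `H(ω₀) = 2a + 2bx² + γx⁴ + o(x⁴)` and `ω₀ = -4c x^(2n+1) + O(x^(2n+2))`. The
positivity of `b` comes from a cutoff (`hilbert_regular`): the near part contributes a positive
multiple of `-∫ f/u³`, and the far part has a Hilbert transform with a minimum at `0`. With `s = √(T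
- t)`, the equation `t H(ω₀) = 2` has a root `X = r(t) s` with `r` of class `C¹` up to `T`
(`exists_radius`). On this curve `ω = 4/(t² ω₀)`, which is unbounded because `ω₀` vanishes at the
origin. For `x - X = z s^(2n)`, both `2 - t H(ω₀)(x)` and `ω₀(x)` have size at most `s^(2n+1)`;
divided by it they converge to an affine function of `z` and to a nonzero constant, with error
`O(s)`. Substituting in the formula gives the profiles (`rescaled_isBigO`). -/

namespace CLM

/-! ### `L²` inequalities and `H¹` functions as primitives. -/

/-- The `L²` norm of a real function, as a real number. -/
noncomputable def l2 (f : ℝ → ℝ) : ℝ := √(∫ x, f x ^ 2)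

theorem l2_nonneg (f : ℝ → ℝ) : 0 ≤ l2 f := Real.sqrt_nonneg _

theorem integral_abs_mul_le {α : Type*} [MeasurableSpace α] {μ : Measure α} {f g : α → ℝ}
    (hf : MemLp f 2 μ) (hg : MemLp g 2 μ) :
    ∫ x, |f x * g x| ∂μ ≤ √(∫ x, f x ^ 2 ∂μ) * √(∫ x, g x ^ 2 ∂μ) := by
  have h := integral_mul_le_Lp_mul_Lq_of_nonneg (μ := μ) (p := 2) (q := 2)
    (f := fun x => |f x|) (g := fun x => |g x|) Real.HolderConjugate.two_two
    (Eventually.of_forall fun _ => abs_nonneg _) (Eventually.of_forall fun _ => abs_nonneg _)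
    (by simpa using hf.norm) (by simpa using hg.norm)
  simpa [abs_mul, Real.sqrt_eq_rpow] using h

theorem l2_eq_eLpNorm {f : ℝ → ℝ} (hf : MemLp f 2) : l2 f = (eLpNorm f 2 volume).toReal := by
  rw [hf.eLpNorm_eq_integral_rpow_norm (by norm_num) (by norm_num), l2, Real.sqrt_eq_rpow,
    ENNReal.toReal_ofReal (by positivity)]
  simp

theorem MemLp.locallyIntegrable_two {f : ℝ → ℝ} (hf : MemLp f 2) : LocallyIntegrable f :=
  hf.locallyIntegrable (by norm_num)

theorem MemLp.intervalIntegrable_two {f : ℝ → ℝ} (hf : MemLp f 2) (a b : ℝ) :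
    IntervalIntegrable f volume a b :=
  intervalIntegrable_iff.mpr
    (((MemLp.locallyIntegrable_two hf).integrableOn_isCompact isCompact_uIcc).mono_set
      uIoc_subset_uIcc)

theorem exists_eq_zero_of_hasCompactSupport {φ : ℝ → ℝ} (hc : HasCompactSupport φ) :
    ∃ R, ∀ x, x ∉ Icc (-R) R → φ x = 0 := by
  obtain ⟨R, hR⟩ := hc.isCompact.isBounded.subset_closedBall 0
  refine ⟨R, fun x hx => ?_⟩
  by_contra hne
  apply hx
  have := hR (subset_tsupport _ hne)
  rw [mem_closedBall_zero_iff, Real.norm_eq_abs, abs_le] at this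
  exact this

/-- `f` belongs to `H¹(ℝ)`, with derivative `g`. -/
structure H1Pair (f g : ℝ → ℝ) : Prop where
  memLp : MemLp f 2
  memLp_deriv : MemLp g 2
  sub_eq : ∀ x y, f y - f x = ∫ t in x..y, g t

namespace H1Pair

variable {f g f₁ g₁ f₂ g₂ : ℝ → ℝ}

/-- Cauchy–Schwarz applied to the primitive. The exponent `1/2` is what makes the folded Hilbert
integral converge at the origin and fixes the rate `√η` of convergence to boundary values. -/
theorem holder (h : H1Pair f g) (x y : ℝ) : |f x - f y| ≤ l2 g * √|x - y| := by
  wlog hxy : x ≤ y generalizing x y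
  · rw [abs_sub_comm, abs_sub_comm x y]
    exact this y x (le_of_not_ge hxy)
  rw [abs_sub_comm, h.sub_eq, intervalIntegral.integral_of_le hxy]
  have h1 : MemLp g 2 (volume.restrict (Ioc x y)) := h.memLp_deriv.restrict _
  have h2 : MemLp (fun _ : ℝ => (1 : ℝ)) 2 (volume.restrict (Ioc x y)) := memLp_const 1
  have h3 := integral_abs_mul_le h1 h2
  have h4 : ∫ t in Ioc x y, g t ^ 2 ≤ ∫ t, g t ^ 2 :=
    setIntegral_le_integral (h.memLp_deriv.integrable_sq)
      (Eventually.of_forall fun _ => sq_nonneg _)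
  calc |∫ t in Ioc x y, g t| ≤ ∫ t in Ioc x y, |g t * 1| := by
        simpa using abs_integral_le_integral_abs (f := g) (μ := volume.restrict (Ioc x y))
    _ ≤ _ := h3
    _ ≤ l2 g * √|x - y| := by
        refine mul_le_mul (Real.sqrt_le_sqrt h4) (Real.sqrt_le_sqrt ?_) (Real.sqrt_nonneg _)
          (l2_nonneg _)
        simp [abs_sub_comm x y, abs_of_nonneg (sub_nonneg.2 hxy), hxy]

theorem continuous (h : H1Pair f g) : Continuous f := by
  have : f = fun y => f 0 + ∫ t in (0 : ℝ)..y, g t := by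
    funext y; rw [← h.sub_eq]; ring
  rw [this]
  exact continuous_const.add
    (intervalIntegral.continuous_primitive (fun a b => MemLp.intervalIntegrable_two h.memLp_deriv a b) 0)

theorem ac (h : H1Pair f g) (a b : ℝ) : AbsolutelyContinuousOnInterval f a b := by
  have h1 := (MemLp.intervalIntegrable_two h.memLp_deriv a b).absolutelyContinuousOnInterval_intervalIntegral
    (c := a) left_mem_uIcc
  have : f = fun y => (∫ t in a..y, g t) + f a := by
    funext y; rw [← h.sub_eq]; ring
  rw [this]
  exact h1.fun_add ((LipschitzWith.const (f a)).lipschitzOnWith.absolutelyContinuousOnInterval)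

theorem ae_hasDerivAt (h : H1Pair f g) : ∀ᵐ x, HasDerivAt f (g x) x := by
  filter_upwards [LocallyIntegrable.ae_hasDerivAt_integral
    (MemLp.locallyIntegrable_two h.memLp_deriv)] with x hx
  have : f = fun y => (∫ t in (0 : ℝ)..y, g t) + f 0 := by
    funext y; rw [← h.sub_eq]; ring
  rw [this]
  exact (hx 0).add_const _

/-- A function of two elements of `H¹` satisfies the fundamental theorem of calculus. -/
theorem chain (h₁ : H1Pair f₁ g₁) (h₂ : H1Pair f₂ g₂) {h h' : ℝ → ℝ} {C : ℝ}
    (hlip : ∀ x y, |h x - h y| ≤ C * (|f₁ x - f₁ y| + |f₂ x - f₂ y|))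
    (hd : ∀ x, HasDerivAt f₁ (g₁ x) x → HasDerivAt f₂ (g₂ x) x → HasDerivAt h (h' x) x)
    (x y : ℝ) : h y - h x = ∫ t in x..y, h' t := by
  -- Absolute continuity passes from `f₁`, `f₂` to `h` because the sums of increments of `h` are
  -- dominated by those of `f₁` and `f₂`.
  have hac : AbsolutelyContinuousOnInterval h x y := by
    have a1 := h₁.ac x y
    have a2 := h₂.ac x y
    unfold AbsolutelyContinuousOnInterval at a1 a2 ⊢
    have a3 := (a1.add a2).const_mul C
    simp only [add_zero, mul_zero] at a3
    refine squeeze_zero (fun _ => Finset.sum_nonneg fun _ _ => dist_nonneg) (fun E => ?_) a3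
    rw [← Finset.sum_add_distrib, Finset.mul_sum]
    exact Finset.sum_le_sum fun i _ => hlip _ _
  rw [← hac.integral_deriv_eq_sub]
  refine intervalIntegral.integral_congr_ae ?_
  filter_upwards [h₁.ae_hasDerivAt, h₂.ae_hasDerivAt] with t ht1 ht2 _
  exact (hd t ht1 ht2).deriv

theorem of_contDiff {φ : ℝ → ℝ} (hφ : ContDiff ℝ 1 φ) (hc : HasCompactSupport φ) :
    H1Pair φ (deriv φ) where
  memLp := hφ.continuous.memLp_of_hasCompactSupport hc
  memLp_deriv := (hφ.continuous_deriv le_rfl).memLp_of_hasCompactSupport hc.deriv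
  sub_eq x y := by
    rw [intervalIntegral.integral_deriv_eq_sub]
    · exact fun t _ => (hφ.differentiable one_ne_zero) t
    · exact (hφ.continuous_deriv le_rfl).intervalIntegrable _ _

theorem sub (h₁ : H1Pair f₁ g₁) (h₂ : H1Pair f₂ g₂) :
    H1Pair (fun x => f₁ x - f₂ x) (fun x => g₁ x - g₂ x) where
  memLp := h₁.memLp.sub h₂.memLp
  memLp_deriv := h₁.memLp_deriv.sub h₂.memLp_deriv
  sub_eq x y := by
    rw [intervalIntegral.integral_sub (MemLp.intervalIntegrable_two h₁.memLp_deriv _ _)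
      (MemLp.intervalIntegrable_two h₂.memLp_deriv _ _), ← h₁.sub_eq, ← h₂.sub_eq]
    ring

theorem mul_sub_eq (h₁ : H1Pair f₁ g₁) (h₂ : H1Pair f₂ g₂) {M : ℝ}
    (hb₁ : ∀ x, |f₁ x| ≤ M) (hb₂ : ∀ x, |f₂ x| ≤ M) (x y : ℝ) :
    f₁ y * f₂ y - f₁ x * f₂ x = ∫ t in x..y, (g₁ t * f₂ t + f₁ t * g₂ t) := by
  refine chain h₁ h₂ (h := fun x => f₁ x * f₂ x) (C := M) (fun x y => ?_)
    (fun x hx1 hx2 => hx1.mul hx2) x y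
  have : f₁ x * f₂ x - f₁ y * f₂ y = (f₁ x - f₁ y) * f₂ x + f₁ y * (f₂ x - f₂ y) := by ring
  rw [this]
  refine (abs_add_le _ _).trans ?_
  rw [abs_mul, abs_mul, mul_add]
  nlinarith [hb₁ y, hb₂ x, abs_nonneg (f₁ x - f₁ y), abs_nonneg (f₂ x - f₂ y)]

theorem memLp_mul_bdd {u v : ℝ → ℝ} (hu : MemLp u 2) (hv : Continuous v) {M : ℝ}
    (hb : ∀ x, |v x| ≤ M) : MemLp (fun x => u x * v x) 2 := by
  refine (hu.const_mul M).of_le (hu.1.mul hv.aestronglyMeasurable) (Eventually.of_forall fun x => ?_)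
  have hM : 0 ≤ M := (abs_nonneg _).trans (hb 0)
  simp only [norm_mul, Real.norm_eq_abs, abs_of_nonneg hM]
  nlinarith [hb x, abs_nonneg (u x)]

theorem mul (h₁ : H1Pair f₁ g₁) (h₂ : H1Pair f₂ g₂) {M : ℝ}
    (hb₁ : ∀ x, |f₁ x| ≤ M) (hb₂ : ∀ x, |f₂ x| ≤ M) :
    H1Pair (fun x => f₁ x * f₂ x) (fun x => g₁ x * f₂ x + f₁ x * g₂ x) where
  memLp := memLp_mul_bdd h₁.memLp h₂.continuous hb₂
  memLp_deriv := by
    refine (memLp_mul_bdd h₁.memLp_deriv h₂.continuous hb₂).add ?_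
    simp_rw [mul_comm (f₁ _)]
    exact memLp_mul_bdd h₂.memLp_deriv h₁.continuous hb₁
  sub_eq := mul_sub_eq h₁ h₂ hb₁ hb₂

theorem const_mul (h : H1Pair f g) (c : ℝ) : H1Pair (fun x => c * f x) (fun x => c * g x) where
  memLp := h.memLp.const_mul c
  memLp_deriv := h.memLp_deriv.const_mul c
  sub_eq x y := by rw [intervalIntegral.integral_const_mul, ← h.sub_eq]; ring

/-- `H¹` functions are bounded. -/
theorem abs_le (h : H1Pair f g) (x : ℝ) : |f x| ≤ l2 f + l2 g := by
  -- On an interval of length one `f` varies by at most `l2 g`; averaging over the interval then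
  -- compares `|f x|` with the `L²` norm.
  have h1 : ∀ y ∈ Ioc x (x + 1), |f x| - l2 g ≤ |f y| := by
    intro y hy
    have h2 := h.holder x y
    have h3 : √|x - y| ≤ 1 := by
      rw [Real.sqrt_le_one, _root_.abs_le]
      constructor <;> linarith [hy.1, hy.2]
    have h4 : |f x| - |f y| ≤ |f x - f y| := abs_sub_abs_le_abs_sub _ _
    nlinarith [l2_nonneg g]
  have h5 : |f x| - l2 g ≤ ∫ y in Ioc x (x + 1), |f y| := by
    have : ∫ y in Ioc x (x + 1), (|f x| - l2 g) = |f x| - l2 g := by simp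
    rw [← this]
    refine setIntegral_mono_on (by simp) ?_ measurableSet_Ioc h1
    exact (h.continuous.abs.integrableOn_Icc).mono_set Ioc_subset_Icc_self
  have h6 := integral_abs_mul_le (h.memLp.restrict (Ioc x (x + 1)))
    (memLp_const (1 : ℝ) : MemLp (fun _ : ℝ => (1 : ℝ)) 2 (volume.restrict (Ioc x (x + 1))))
  have h7 : ∫ t in Ioc x (x + 1), f t ^ 2 ≤ ∫ t, f t ^ 2 :=
    setIntegral_le_integral (h.memLp.integrable_sq)
      (Eventually.of_forall fun _ => sq_nonneg _)
  have h8 := Real.sqrt_le_sqrt h7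
  simp at h6
  unfold l2 at *
  linarith

/-- The product rule is integrated over `[-r, r]` with `r` so large that the test function vanishes
at the endpoints; then `r → ∞`. -/
theorem hasWeakDeriv (h : H1Pair f g) : HasWeakDeriv f g := by
  intro φ hφ hc
  have hp := of_contDiff (hφ.of_le (by simp)) hc
  set M := l2 f + l2 g + (l2 φ + l2 (deriv φ)) with hM
  have hb1 : ∀ x, |f x| ≤ M := fun x => (h.abs_le x).trans (by
    have := l2_nonneg φ; have := l2_nonneg (deriv φ); linarith)
  have hb2 : ∀ x, |φ x| ≤ M := fun x => (hp.abs_le x).trans (by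
    have := l2_nonneg f; have := l2_nonneg g; linarith)
  have hm := mul_sub_eq h hp hb1 hb2
  have i1 : Integrable (fun x => g x * φ x) := h.memLp_deriv.integrable_mul hp.memLp
  have i2 : Integrable (fun x => f x * deriv φ x) := h.memLp.integrable_mul hp.memLp_deriv
  obtain ⟨R, hR'⟩ := exists_eq_zero_of_hasCompactSupport hc
  have key : ∀ r > R, ∫ t in (-r)..r, (g t * φ t + f t * deriv φ t) = 0 := by
    intro r hr
    rw [← hm, hR' r (fun h => by linarith [h.2]), hR' (-r) (fun h => by linarith [h.1])]
    simp
  have lim := intervalIntegral_tendsto_integral (i1.add i2) tendsto_neg_atTop_atBot tendsto_id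
  have : ∫ t, (g t * φ t + f t * deriv φ t) = 0 := by
    refine tendsto_nhds_unique lim ?_
    refine tendsto_const_nhds.congr' ?_
    filter_upwards [eventually_gt_atTop R] with r hr
    exact (key r hr).symm
  rw [integral_add i1 i2] at this
  linarith

theorem memH1 (h : H1Pair f g) : MemH1 f :=
  ⟨h.continuous, h.memLp, g, h.memLp_deriv, h.hasWeakDeriv⟩

end H1Pair

/-! ### From weak derivatives to primitives. -/

/-- A continuous function whose distributional derivative vanishes is constant. -/
theorem const_of_weakDeriv_zero {h : ℝ → ℝ} (hc : Continuous h)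
    (h0 : ∀ φ : ℝ → ℝ, ContDiff ℝ (⊤ : ℕ∞) φ → HasCompactSupport φ → ∫ x, h x * deriv φ x = 0) :
    ∃ c, ∀ x, h x = c := by
  let b : ContDiffBump (0 : ℝ) := ⟨1, 2, by norm_num, by norm_num⟩
  set ρ : ℝ → ℝ := b.normed volume with hρ
  have hρs : ContDiff ℝ (⊤ : ℕ∞) ρ := b.contDiff_normed
  have hρc : HasCompactSupport ρ := b.hasCompactSupport_normed
  have hρi : ∫ x, ρ x = 1 := b.integral_normed
  set c := ∫ x, h x * ρ x with hcdef
  have key : ∀ ψ : ℝ → ℝ, ContDiff ℝ (⊤ : ℕ∞) ψ → HasCompactSupport ψ →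
      ∫ x, ψ x • (h x - c) = 0 := by
    intro ψ hψ hψc
    set s := ∫ x, ψ x with hs
    -- Subtracting `s ρ` makes the integral zero, so that the primitive of `θ` is again compactly
    -- supported and may serve as a test function.
    set θ : ℝ → ℝ := fun x => ψ x - s * ρ x with hθ
    have hθs : ContDiff ℝ (⊤ : ℕ∞) θ := hψ.sub (contDiff_const.mul hρs)
    have hθc : HasCompactSupport θ := by
      have := hψc.sub (hρc.mul_left (f := fun _ => s))
      exact this
    have hθi : ∫ x, θ x = 0 := by
      rw [hθ, integral_sub (hψ.continuous.integrable_of_hasCompactSupport hψc)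
        ((hρs.continuous.integrable_of_hasCompactSupport hρc).const_mul s), integral_const_mul, hρi]
      simp [hs]
    obtain ⟨R, hR'⟩ := exists_eq_zero_of_hasCompactSupport hθc
    set φ : ℝ → ℝ := fun x => ∫ t in (-R)..x, θ t with hφ
    have hder : ∀ x, HasDerivAt φ (θ x) x := fun x =>
      intervalIntegral.integral_hasDerivAt_right (hθs.continuous.intervalIntegrable _ _)
        (hθs.continuous.stronglyMeasurableAtFilter _ _) hθs.continuous.continuousAt
    have hφd : deriv φ = θ := funext fun x => (hder x).deriv
    have hφs : ContDiff ℝ (⊤ : ℕ∞) φ := by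
      rw [contDiff_infty_iff_deriv]
      exact ⟨fun x => (hder x).differentiableAt, hφd ▸ hθs⟩
    have hφc : HasCompactSupport φ := by
      refine HasCompactSupport.of_support_subset_isCompact (isCompact_Icc (a := -R) (b := R)) ?_
      intro x hx
      by_contra hne
      apply hx
      simp only [mem_Icc, not_and_or, not_le] at hne
      rcases hne with hlt | hlt
      · simp only [hφ]
        rw [intervalIntegral.integral_of_ge hlt.le]
        rw [setIntegral_eq_zero_of_forall_eq_zero, neg_zero]
        intro t ht
        rcases eq_or_lt_of_le ht.2 with h1 | h1
        · have hcl : θ (-R) = 0 := by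
            have : Tendsto θ (𝓝[<] (-R)) (𝓝 (θ (-R))) :=
              hθs.continuous.continuousAt.tendsto.mono_left nhdsWithin_le_nhds
            refine tendsto_nhds_unique this (tendsto_const_nhds.congr' ?_)
            filter_upwards [self_mem_nhdsWithin] with y hy
            exact (hR' y fun h => by have := h.1; have : y < -R := hy; linarith).symm
          rw [h1, hcl]
        · exact hR' t fun h => by linarith [h.1]
      · simp only [hφ]
        have e : ∫ t in (-R)..x, θ t = ∫ t, θ t := by
          by_cases hRx : -R ≤ x
          · rw [intervalIntegral.integral_of_le hRx,
              ← integral_indicator measurableSet_Ioc]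
            refine integral_congr_ae ?_
            have : ∀ᵐ t : ℝ, t ≠ -R := by simp [ae_iff, measure_singleton]
            filter_upwards [this] with t ht
            by_cases h' : t ∈ Ioc (-R) x
            · simp [indicator_of_mem h']
            · rw [indicator_of_notMem h', hR' t]
              intro h''
              exact h' ⟨lt_of_le_of_ne h''.1 (Ne.symm ht), h''.2.trans hlt.le⟩
          · have hz : ∀ t, θ t = 0 := fun t => hR' t fun h => by linarith [h.1, h.2]
            simp [hz]
        rw [e, hθi]
    have h1 := h0 φ hφs hφc
    rw [hφd] at h1
    have i1 : Integrable (fun x => h x * ψ x) :=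
      (hc.mul hψ.continuous).integrable_of_hasCompactSupport hψc.mul_left
    have i2 : Integrable (fun x => h x * ρ x) :=
      (hc.mul hρs.continuous).integrable_of_hasCompactSupport hρc.mul_left
    have h2 : ∫ x, h x * θ x = (∫ x, h x * ψ x) - s * c := by
      rw [hcdef, ← integral_const_mul, ← integral_sub i1 (i2.const_mul s)]
      congr 1; funext x; simp only [hθ]; ring
    have h3 : ∫ x, ψ x • (h x - c) = (∫ x, h x * ψ x) - s * c := by
      rw [hs, mul_comm, ← integral_const_mul, ← integral_sub i1
        ((hψ.continuous.integrable_of_hasCompactSupport hψc).const_mul c)]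
      congr 1; funext x; simp only [smul_eq_mul]; ring
    rw [h3, ← h2, h1]
  have hae := ae_eq_zero_of_integral_contDiff_smul_eq_zero
    ((hc.sub continuous_const).locallyIntegrable (μ := volume)) (f := fun x => h x - c)
    (fun ψ h1 h2 => key ψ h1 h2)
  refine ⟨c, fun x => ?_⟩
  have := Measure.eq_of_ae_eq (μ := (volume : Measure ℝ)) (f := fun x => h x - c)
    (g := fun _ => (0 : ℝ)) hae (hc.sub continuous_const) continuous_const
  have := congrFun this x
  simpa [sub_eq_zero] using this

/-- The difference between `f` and a primitive of its weak derivative has zero distributional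
derivative, hence is constant. -/
theorem H1Pair.of_hasWeakDeriv {f g : ℝ → ℝ} (hc : Continuous f) (hf : MemLp f 2) (hg : MemLp g 2)
    (hw : HasWeakDeriv f g) : H1Pair f g := by
  have hgi := MemLp.intervalIntegrable_two hg
  set G : ℝ → ℝ := fun y => ∫ t in (0 : ℝ)..y, g t with hG
  have hGc : Continuous G := intervalIntegral.continuous_primitive (fun a b => hgi a b) 0
  have hGsub : ∀ x y, G y - G x = ∫ t in x..y, g t := fun x y =>
    intervalIntegral.integral_interval_sub_left (hgi _ _) (hgi _ _)
  have hconst : ∃ c, ∀ x, f x - G x = c := by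
    refine const_of_weakDeriv_zero (hc.sub hGc) fun φ hφ hφc => ?_
    have hφd : Continuous (deriv φ) := hφ.continuous_deriv (by simp)
    obtain ⟨R, hR'⟩ := exists_eq_zero_of_hasCompactSupport hφc
    -- The primitive `G` need not lie in `L²`, so `H1Pair.hasWeakDeriv` is not available for it and
    -- the integration by parts is done directly.
    have hpar : ∫ x, G x * deriv φ x = - ∫ x, g x * φ x := by
      have hp := H1Pair.of_contDiff (hφ.of_le (by simp)) hφc
      have hac : ∀ a b, AbsolutelyContinuousOnInterval G a b := by
        intro a b
        have h1 := (hgi a b).absolutelyContinuousOnInterval_intervalIntegral (c := a) left_mem_uIcc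
        have : G = fun y => (∫ t in a..y, g t) + G a := by
          funext y; rw [← hGsub]; ring
        rw [this]
        exact h1.fun_add ((LipschitzWith.const (G a)).lipschitzOnWith.absolutelyContinuousOnInterval)
      have hGd : ∀ᵐ x, HasDerivAt G (g x) x := by
        filter_upwards [LocallyIntegrable.ae_hasDerivAt_integral
          (MemLp.locallyIntegrable_two hg)] with x hx using hx 0
      have i1 : Integrable (fun x => g x * φ x) := hg.integrable_mul hp.memLp
      have i2 : Integrable (fun x => G x * deriv φ x) :=
        (hGc.mul hφd).integrable_of_hasCompactSupport hφc.deriv.mul_left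
      have key : ∀ r > R, ∫ t in (-r)..r, (g t * φ t + G t * deriv φ t) = 0 := by
        intro r hr
        have e := AbsolutelyContinuousOnInterval.integral_deriv_mul_eq_sub (hac (-r) r) (hp.ac (-r) r)
        rw [hR' r (fun h => by linarith [h.2]), hR' (-r) (fun h => by linarith [h.1])] at e
        simp only [mul_zero, sub_zero] at e
        rw [← e]
        refine intervalIntegral.integral_congr_ae ?_
        filter_upwards [hGd] with t ht _
        rw [ht.deriv]
      have lim := intervalIntegral_tendsto_integral (i1.add i2) tendsto_neg_atTop_atBot tendsto_id
      have : ∫ t, (g t * φ t + G t * deriv φ t) = 0 := by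
        refine tendsto_nhds_unique lim ?_
        refine tendsto_const_nhds.congr' ?_
        filter_upwards [eventually_gt_atTop R] with r hr
        exact (key r hr).symm
      rw [integral_add i1 i2] at this
      linarith
    have i1 : Integrable (fun x => f x * deriv φ x) :=
      (hc.mul hφd).integrable_of_hasCompactSupport hφc.deriv.mul_left
    have i2 : Integrable (fun x => G x * deriv φ x) :=
      (hGc.mul hφd).integrable_of_hasCompactSupport hφc.deriv.mul_left
    simp_rw [sub_mul]
    rw [integral_sub i1 i2, hw φ hφ hφc, hpar, sub_self]
  obtain ⟨c, hcst⟩ := hconst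
  refine ⟨hf, hg, fun x y => ?_⟩
  rw [← hGsub]
  linarith [hcst x, hcst y]

/-! ### The Cauchy integral: convergence, holomorphy and size. -/

/-- The Cauchy integral `(1/π) ∫ f(y) / (z - y) dy`. -/
noncomputable def cauchy (f : ℝ → ℝ) (z : ℂ) : ℂ :=
  (1 / Real.pi : ℝ) * ∫ y : ℝ, (f y : ℂ) / (z - y)

/-- Compares the Cauchy kernel with the weight `(1 + |y|)⁻¹`, which is in `L²`; its product with an
`L²` function is an integrable majorant. -/
theorem one_add_abs_le {x : ℂ} {y r : ℝ} (hr : 0 < r) (h : r ≤ ‖x - y‖) :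
    1 + |y| ≤ (1 + (1 + ‖x‖) / r) * ‖x - y‖ := by
  have h1 : |y| ≤ ‖x - y‖ + ‖x‖ := by
    have := norm_sub_norm_le (y : ℂ) x
    rw [Complex.norm_real, Real.norm_eq_abs, norm_sub_rev] at this
    linarith
  have h2 : 1 + ‖x‖ ≤ (1 + ‖x‖) / r * ‖x - y‖ := by
    rw [div_mul_eq_mul_div, le_div_iff₀ hr]
    exact mul_le_mul_of_nonneg_left h (by positivity)
  nlinarith

theorem integrable_inv_one_add_abs_sq : Integrable fun y : ℝ => ((1 + |y|)⁻¹) ^ 2 := by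
  refine (integrable_inv_one_add_sq).mono' (by fun_prop) (Eventually.of_forall fun y => ?_)
  rw [Real.norm_eq_abs, abs_of_nonneg (by positivity), inv_pow]
  refine inv_anti₀ (by positivity) ?_
  nlinarith [abs_nonneg y, sq_abs y]

theorem memLp_inv_one_add_abs : MemLp (fun y : ℝ => (1 + |y|)⁻¹) 2 := by
  refine (memLp_two_iff_integrable_sq ?_).2 integrable_inv_one_add_abs_sq
  fun_prop

theorem integrable_mul_weight {f : ℝ → ℝ} (hf : MemLp f 2) :
    Integrable fun y => |f y| * (1 + |y|)⁻¹ :=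
  hf.norm.integrable_mul memLp_inv_one_add_abs

/-- Only points where `f` is nonzero need to be far from `z`. This covers at once `Im z > 0` and
real `z` in a gap of the support. -/
theorem norm_div_le {f : ℝ → ℝ} {z : ℂ} {y r : ℝ} (hr : 0 < r) (h : f y ≠ 0 → r ≤ ‖z - y‖) :
    ‖(f y : ℂ) / (z - y)‖ ≤ (1 + (1 + ‖z‖) / r) * (|f y| * (1 + |y|)⁻¹) := by
  by_cases h0 : f y = 0
  · simp [h0]
  have h1 := h h0
  have h2 := one_add_abs_le hr h1
  rw [norm_div, Complex.norm_real, Real.norm_eq_abs, mul_left_comm, div_eq_mul_inv]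
  refine mul_le_mul_of_nonneg_left ?_ (abs_nonneg _)
  rw [inv_le_iff_one_le_mul₀ (hr.trans_le h1), mul_assoc, mul_comm _ ‖z - y‖, ← mul_assoc,
    ← div_eq_mul_inv, one_le_div (by positivity)]
  exact h2

theorem integrable_div {f : ℝ → ℝ} (hf : MemLp f 2) {z : ℂ} {r : ℝ} (hr : 0 < r)
    (h : ∀ y, f y ≠ 0 → r ≤ ‖z - y‖) : Integrable fun y : ℝ => (f y : ℂ) / (z - y) := by
  refine ((integrable_mul_weight hf).const_mul _).mono' ?_
    (Eventually.of_forall fun y => norm_div_le hr (h y))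
  have h1 : AEStronglyMeasurable (fun y => (f y : ℂ)) volume :=
    Complex.continuous_ofReal.comp_aestronglyMeasurable hf.1
  exact (h1.aemeasurable.div (by fun_prop)).aestronglyMeasurable

theorem im_le_norm_sub (z : ℂ) (y : ℝ) : z.im ≤ ‖z - y‖ := by
  have := Complex.abs_im_le_norm (z - y)
  simp only [Complex.sub_im, Complex.ofReal_im, sub_zero] at this
  exact (le_abs_self _).trans this

theorem integrable_div_of_im_pos {f : ℝ → ℝ} (hf : MemLp f 2) {z : ℂ} (hz : 0 < z.im) :
    Integrable fun y : ℝ => (f y : ℂ) / (z - y) :=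
  integrable_div hf hz fun y _ => im_le_norm_sub z y

/-- The Cauchy integral is holomorphic away from the support. -/
theorem differentiableAt_cauchy {f : ℝ → ℝ} (hf : MemLp f 2) {z : ℂ} {r : ℝ} (hr : 0 < r)
    (h : ∀ y, f y ≠ 0 → r ≤ ‖z - y‖) : DifferentiableAt ℂ (cauchy f) z := by
  have hlow : ∀ w ∈ Metric.ball z (r / 2), ∀ y, f y ≠ 0 → r / 2 ≤ ‖w - y‖ ∧
      ‖z - y‖ ≤ 2 * ‖w - y‖ := by
    intro w hw y hy
    have h1 := h y hy
    rw [mem_ball_iff_norm, norm_sub_rev] at hw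
    have h2 : ‖z - y‖ ≤ ‖z - w‖ + ‖w - y‖ := norm_sub_le_norm_sub_add_norm_sub _ _ _
    constructor <;> linarith
  have hm : AEStronglyMeasurable (fun y => (f y : ℂ)) volume :=
    Complex.continuous_ofReal.comp_aestronglyMeasurable hf.1
  have key := hasDerivAt_integral_of_dominated_loc_of_deriv_le (μ := volume)
    (F := fun (w : ℂ) (y : ℝ) => (f y : ℂ) / (w - y))
    (F' := fun (w : ℂ) (y : ℝ) => -((f y : ℂ) / (w - y) ^ 2)) (x₀ := z)
    (s := Metric.ball z (r / 2))
    -- One factor `1/‖w - y‖` is bounded by `2/r`; the other by `2/‖z - y‖`, since `w` lies within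
    -- `r/2` of `z`.
    (bound := fun y => (2 / r) * (2 * ((1 + (1 + ‖z‖) / r) * (|f y| * (1 + |y|)⁻¹))))
    (Metric.ball_mem_nhds z (by positivity)) ?_ (integrable_div hf hr h) ?_ ?_
    ((((integrable_mul_weight hf).const_mul _).const_mul _).const_mul _) ?_
  · exact (key.2.const_mul _).differentiableAt
  · filter_upwards [Metric.ball_mem_nhds z (half_pos hr)] with w hw
    exact (integrable_div hf (half_pos hr) fun y hy => (hlow w hw y hy).1).1
  · exact (hm.aemeasurable.div (by fun_prop)).neg.aestronglyMeasurable
  · refine Eventually.of_forall fun y w hw => ?_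
    by_cases h0 : f y = 0
    · simp [h0]
    obtain ⟨h1, h2⟩ := hlow w hw y h0
    have hw0 : 0 < ‖w - y‖ := (half_pos hr).trans_le h1
    have hz0 : 0 < ‖z - y‖ := hr.trans_le (h y h0)
    have h3 := norm_div_le (f := f) hr (h y)
    rw [norm_neg, pow_two, ← div_div, norm_div, norm_div, div_eq_mul_inv, mul_comm]
    rw [norm_div] at h3
    refine mul_le_mul ?_ ?_ (by positivity) (by positivity)
    · rw [inv_le_iff_one_le_mul₀ hw0]
      field_simp
      linarith
    · calc ‖(f y : ℂ)‖ / ‖w - y‖ ≤ 2 * (‖(f y : ℂ)‖ / ‖z - y‖) := by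
            rw [← mul_div_assoc, div_le_div_iff₀ hw0 hz0]
            nlinarith [norm_nonneg (f y : ℂ)]
        _ ≤ _ := by gcongr
  · refine Eventually.of_forall fun y w hw => ?_
    by_cases h0 : f y = 0
    · simpa [h0] using hasDerivAt_const w (0 : ℂ)
    have hw0 : w - y ≠ 0 := norm_pos_iff.1 ((half_pos hr).trans_le (hlow w hw y h0).1)
    have := (((hasDerivAt_id w).sub_const (y : ℂ)).inv hw0).const_mul (f y : ℂ)
    simpa [div_eq_mul_inv] using this

theorem differentiableAt_cauchy_of_im_pos {f : ℝ → ℝ} (hf : MemLp f 2) {z : ℂ} (hz : 0 < z.im) :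
    DifferentiableAt ℂ (cauchy f) z :=
  differentiableAt_cauchy hf hz fun y _ => im_le_norm_sub z y

theorem integrable_sq_kernel (x : ℝ) {η : ℝ} (hη : 0 < η) :
    Integrable (fun y : ℝ => ((x - y) ^ 2 + η ^ 2)⁻¹) ∧
      ∫ y : ℝ, ((x - y) ^ 2 + η ^ 2)⁻¹ = Real.pi / η := by
  have e : ∀ y : ℝ, (y ^ 2 + η ^ 2)⁻¹ = (η ^ 2)⁻¹ * (1 + (y / η) ^ 2)⁻¹ := by
    intro y; field_simp; ring
  have i1 : Integrable (fun y : ℝ => (y ^ 2 + η ^ 2)⁻¹) := by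
    simp_rw [e]
    exact (integrable_inv_one_add_sq.comp_div hη.ne').const_mul _
  refine ⟨i1.comp_sub_left x, ?_⟩
  rw [integral_sub_left_eq_self (fun y : ℝ => (y ^ 2 + η ^ 2)⁻¹) volume x]
  simp_rw [e]
  rw [integral_const_mul, Measure.integral_comp_div (fun y : ℝ => (1 + y ^ 2)⁻¹) η,
    integral_univ_inv_one_add_sq, smul_eq_mul, abs_of_pos hη]
  field_simp

theorem norm_sub_sq (z : ℂ) (y : ℝ) : ‖z - y‖ ^ 2 = (z.re - y) ^ 2 + z.im ^ 2 := by
  rw [← Complex.normSq_eq_norm_sq, Complex.normSq_apply]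
  simp; ring

/-- Cauchy–Schwarz bound for the Cauchy integral. -/
theorem norm_cauchy_le {f : ℝ → ℝ} (hf : MemLp f 2) {z : ℂ} (hz : 0 < z.im) :
    ‖cauchy f z‖ ≤ l2 f / √z.im := by
  have hk := integrable_sq_kernel z.re hz
  have hne : ∀ y : ℝ, ‖z - y‖ ≠ 0 := fun y => (hz.trans_le (im_le_norm_sub z y)).ne'
  have hm : MemLp (fun y : ℝ => ‖z - y‖⁻¹) 2 := by
    refine (memLp_two_iff_integrable_sq ?_).2 ?_
    · exact (Continuous.inv₀ (by fun_prop) hne).aestronglyMeasurable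
    · simp_rw [inv_pow, norm_sub_sq]; exact hk.1
  have h1 := integral_abs_mul_le hf hm
  have h2 : ∫ y : ℝ, (‖z - y‖⁻¹) ^ 2 = Real.pi / z.im := by
    simp_rw [inv_pow, norm_sub_sq]; exact hk.2
  rw [h2] at h1
  have h3 : ‖∫ y : ℝ, (f y : ℂ) / (z - y)‖ ≤ l2 f * √(Real.pi / z.im) := by
    refine (norm_integral_le_integral_norm _).trans (le_trans (le_of_eq ?_) h1)
    congr 1; funext y
    rw [norm_div, Complex.norm_real, abs_mul, abs_inv, abs_norm, div_eq_mul_inv, Real.norm_eq_abs]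
  rw [cauchy, norm_mul, Complex.norm_real, Real.norm_eq_abs, abs_of_pos (by positivity)]
  calc 1 / Real.pi * ‖∫ y : ℝ, (f y : ℂ) / (z - y)‖
      ≤ 1 / Real.pi * (l2 f * √(Real.pi / z.im)) := by gcongr
    _ = l2 f / √z.im * (√Real.pi / Real.pi) := by
        rw [Real.sqrt_div Real.pi_pos.le]; field_simp
    _ ≤ l2 f / √z.im * 1 := by
        refine mul_le_mul_of_nonneg_left ?_ (div_nonneg (l2_nonneg _) (Real.sqrt_nonneg _))
        rw [div_le_one Real.pi_pos, Real.sqrt_le_left Real.pi_pos.le]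
        nlinarith [Real.pi_gt_three]
    _ = _ := mul_one _

/-! ### Folding, and existence of the Hilbert transform on `H¹`. -/

/-- Folding of an integral over the line about the point `x`. -/
theorem integral_fold {E : Type*} [NormedAddCommGroup E] [NormedSpace ℝ E] {h : ℝ → E}
    (hh : Integrable h) (x : ℝ) :
    IntegrableOn (fun u => h (x - u)) (Ioi 0) ∧ IntegrableOn (fun u => h (x + u)) (Ioi 0) ∧
      ∫ y, h y = ∫ u in Ioi (0 : ℝ), (h (x - u) + h (x + u)) := by
  have i1 := (hh.comp_sub_left x)
  have i2 := (hh.comp_add_left x)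
  refine ⟨i1.integrableOn, i2.integrableOn, ?_⟩
  rw [integral_add i1.integrableOn i2.integrableOn]
  rw [← integral_sub_left_eq_self h volume x, ← integral_add_compl measurableSet_Ioi i1 (s := Ioi 0)]
  congr 1
  rw [compl_Ioi]
  simpa using (integral_comp_neg_Ioi 0 fun u => h (x - u)).symm

theorem tendsto_setIntegral_Ioi {E : Type*} [NormedAddCommGroup E] [NormedSpace ℝ E] {h : ℝ → E}
    (hh : IntegrableOn h (Ioi 0)) :
    Tendsto (fun ε => ∫ u in Ioi ε, h u) (𝓝[>] (0 : ℝ)) (𝓝 (∫ u in Ioi 0, h u)) := by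
  have e : ∀ ε > (0 : ℝ), ∫ u in Ioi ε, h u = ∫ u in Ioi 0, (Ioi ε).indicator h u := by
    intro ε hε
    rw [setIntegral_indicator measurableSet_Ioi, Ioi_inter_Ioi, max_eq_right hε.le]
  refine Tendsto.congr' (f₁ := fun ε => ∫ u in Ioi 0, (Ioi ε).indicator h u) ?_ ?_
  · filter_upwards [self_mem_nhdsWithin] with ε hε using (e ε hε).symm
  · refine tendsto_integral_filter_of_dominated_convergence (fun u => ‖h u‖)
      (Eventually.of_forall fun ε => hh.1.indicator measurableSet_Ioi)
      (Eventually.of_forall fun ε => Eventually.of_forall fun u => norm_indicator_le_norm_self _ _)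
      hh.norm ?_
    refine (ae_restrict_iff' measurableSet_Ioi).2 (Eventually.of_forall fun u hu => ?_)
    refine tendsto_const_nhds.congr' ?_
    filter_upwards [Ioo_mem_nhdsGT hu] with ε hε
    exact (indicator_of_mem hε.2 h).symm

theorem measurableSet_lt_abs (x ε : ℝ) : MeasurableSet {y : ℝ | ε < |x - y|} :=
  measurableSet_lt measurable_const (by fun_prop)

/-- Truncated Hilbert integrals, folded. -/
theorem truncated_fold {f : ℝ → ℝ} {x ε : ℝ} (hε : 0 < ε)
    (hi : IntegrableOn (fun y => f y / (x - y)) {y | ε < |x - y|}) :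
    ∫ y in {y | ε < |x - y|}, f y / (x - y) = ∫ u in Ioi ε, (f (x - u) - f (x + u)) / u := by
  have hs := measurableSet_lt_abs x ε
  rw [← integral_indicator hs, (integral_fold ((integrable_indicator_iff hs).2 hi) x).2.2]
  have : ∫ u in Ioi ε, (f (x - u) - f (x + u)) / u
      = ∫ u in Ioi 0, (Ioi ε).indicator (fun u => (f (x - u) - f (x + u)) / u) u := by
    rw [setIntegral_indicator measurableSet_Ioi, Ioi_inter_Ioi, max_eq_right hε.le]
  rw [this]
  refine setIntegral_congr_fun measurableSet_Ioi fun u hu => ?_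
  have hu' : (0 : ℝ) < u := hu
  simp only [indicator, mem_ofPred_eq, mem_Ioi, sub_sub_cancel, sub_add_cancel_left, abs_neg,
    abs_of_pos hu']
  split_ifs
  · rw [div_neg, sub_div]; ring
  · simp

/-- Truncation at `|x - y| > ε` is symmetric about `x`, so after folding it is the truncation `u >
ε` of a single integral; once that integral converges absolutely, the principal value is its limit.
-/
theorem hasHilbertTransformAt_of_folded {f : ℝ → ℝ} {x : ℝ}
    (hi : ∀ ε : ℝ, 0 < ε → IntegrableOn (fun y => f y / (x - y)) {y | ε < |x - y|})
    (hf : IntegrableOn (fun u => (f (x - u) - f (x + u)) / u) (Ioi 0)) :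
    HasHilbertTransformAt f x ((1 / Real.pi) * ∫ u in Ioi 0, (f (x - u) - f (x + u)) / u) := by
  refine ⟨hi, (Tendsto.congr' ?_ (tendsto_setIntegral_Ioi hf)).const_mul _⟩
  filter_upwards [self_mem_nhdsWithin] with ε hε
  exact (truncated_fold hε (hi ε hε)).symm

theorem integrableOn_truncated {f : ℝ → ℝ} (hf : MemLp f 2) (x : ℝ) {ε : ℝ} (hε : 0 < ε) :
    IntegrableOn (fun y => f y / (x - y)) {y | ε < |x - y|} := by
  refine Integrable.mono' (((integrable_mul_weight hf).const_mul
    (1 + (1 + ‖(x : ℂ)‖) / ε)).integrableOn) ?_ ?_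
  · exact (hf.1.aemeasurable.div (by fun_prop)).aestronglyMeasurable.restrict
  · refine (ae_restrict_iff' (measurableSet_lt_abs x ε)).2 (Eventually.of_forall fun y hy => ?_)
    have hy' : ε ≤ ‖(x : ℂ) - y‖ := by
      rw [← Complex.ofReal_sub, Complex.norm_real]; exact le_of_lt hy
    have := norm_div_le (f := f) (z := (x : ℂ)) (y := y) hε fun _ => hy'
    rwa [← Complex.ofReal_sub, ← Complex.ofReal_div, Complex.norm_real] at this

/-- The function `u^(-1/2) min(1, η/u)` bounds a Hölder-`1/2` increment times the difference between
the Cauchy kernel at height `η` and its boundary kernel. -/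
theorem integrableOn_sqrt_majorant {η : ℝ} (hη : 0 < η) :
    IntegrableOn (fun u : ℝ => if u ≤ η then u ^ (-(1 / 2) : ℝ) else η * u ^ (-(3 / 2) : ℝ))
      (Ioi 0) ∧
    ∫ u in Ioi (0 : ℝ), (if u ≤ η then u ^ (-(1 / 2) : ℝ) else η * u ^ (-(3 / 2) : ℝ)) = 4 * √η := by
  set b : ℝ → ℝ := fun u => if u ≤ η then u ^ (-(1 / 2) : ℝ) else η * u ^ (-(3 / 2) : ℝ) with hb
  have e1 : EqOn b (fun u => u ^ (-(1 / 2) : ℝ)) (Ioc 0 η) := fun u hu => if_pos hu.2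
  have e2 : EqOn b (fun u => η * u ^ (-(3 / 2) : ℝ)) (Ioi η) := fun u hu => if_neg (not_le.2 hu)
  have j1 : IntegrableOn (fun u : ℝ => u ^ (-(1 / 2) : ℝ)) (Ioc 0 η) :=
    (intervalIntegrable_iff_integrableOn_Ioc_of_le hη.le).1
      (intervalIntegral.intervalIntegrable_rpow' (by norm_num))
  have j2 : IntegrableOn (fun u : ℝ => η * u ^ (-(3 / 2) : ℝ)) (Ioi η) :=
    (integrableOn_Ioi_rpow_of_lt (by norm_num) hη).const_mul η
  have k1 : IntegrableOn b (Ioc 0 η) := (integrableOn_congr_fun e1 measurableSet_Ioc).2 j1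
  have k2 : IntegrableOn b (Ioi η) := (integrableOn_congr_fun e2 measurableSet_Ioi).2 j2
  rw [← Ioc_union_Ioi_eq_Ioi hη.le]
  refine ⟨k1.union k2, ?_⟩
  rw [setIntegral_union Ioc_disjoint_Ioi_same measurableSet_Ioi k1 k2,
    setIntegral_congr_fun measurableSet_Ioc e1, setIntegral_congr_fun measurableSet_Ioi e2,
    ← intervalIntegral.integral_of_le hη.le, integral_rpow (Or.inl (by norm_num)),
    integral_const_mul, integral_Ioi_rpow_of_lt (by norm_num) hη, Real.sqrt_eq_rpow]
  have h3 : η * η ^ (-(1 / 2) : ℝ) = η ^ (1 / 2 : ℝ) := by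
    nth_rewrite 1 [← Real.rpow_one η]
    rw [← Real.rpow_add hη]; norm_num
  norm_num at h3 ⊢
  linear_combination 2 * h3

theorem sqrt_div_self_le {u : ℝ} (hu : 0 < u) : √u / u = u ^ (-(1 / 2) : ℝ) := by
  rw [Real.sqrt_div_self', Real.rpow_neg hu.le, ← Real.sqrt_eq_rpow, one_div]

namespace H1Pair

variable {f g : ℝ → ℝ}

/-- For `u ≤ 1` the Hölder bound gives a multiple of `u^(-1/2)`; for `u > 1` the integrand is a
folded truncated integral, convergent by the `L²` weight estimate. -/
theorem integrableOn_folded (h : H1Pair f g) (x : ℝ) :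
    IntegrableOn (fun u => (f (x - u) - f (x + u)) / u) (Ioi 0) := by
  rw [← Ioc_union_Ioi_eq_Ioi zero_le_one]
  refine IntegrableOn.union ?_ ?_
  · have j1 : IntegrableOn (fun u : ℝ => u ^ (-(1 / 2) : ℝ)) (Ioc 0 1) :=
      (intervalIntegrable_iff_integrableOn_Ioc_of_le zero_le_one).1
        (intervalIntegral.intervalIntegrable_rpow' (by norm_num))
    refine Integrable.mono' (j1.const_mul (2 * l2 g)) ?_ ?_
    · have := h.continuous
      exact ((by fun_prop : Measurable fun u : ℝ => (f (x - u) - f (x + u)) / u)).aestronglyMeasurable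
    · refine (ae_restrict_iff' measurableSet_Ioc).2 (Eventually.of_forall fun u hu => ?_)
      have h1 := h.holder (x - u) (x + u)
      have h2 : |x - u - (x + u)| = 2 * u := by
        rw [show x - u - (x + u) = -(2 * u) by ring, abs_neg, abs_of_pos (by linarith [hu.1])]
      rw [h2, Real.sqrt_mul zero_le_two] at h1
      rw [Real.norm_eq_abs, abs_div, abs_of_pos hu.1, ← sqrt_div_self_le hu.1, ← mul_div_assoc]
      have h3 : √2 ≤ 2 := by rw [Real.sqrt_le_left (by norm_num)]; norm_num
      have h4 : |f (x - u) - f (x + u)| ≤ 2 * l2 g * √u := by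
        nlinarith [mul_nonneg (l2_nonneg g) (Real.sqrt_nonneg u)]
      exact div_le_div_of_nonneg_right h4 hu.1.le
  · have i := integrableOn_truncated h.memLp x one_pos
    have hs := measurableSet_lt_abs x 1
    have k := integral_fold ((integrable_indicator_iff hs).2 i) x
    refine (integrableOn_congr_fun ?_ measurableSet_Ioi).1
      ((k.1.add k.2.1).mono_set (Ioi_subset_Ioi zero_le_one))
    intro u hu
    have hu1 : (1 : ℝ) < u := hu
    have hu' : (0 : ℝ) < u := one_pos.trans hu1
    simp only [Pi.add_apply, indicator, mem_ofPred_eq, sub_sub_cancel, sub_add_cancel_left, abs_neg,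
      abs_of_pos hu', hu1, if_true]
    rw [div_neg, sub_div]; ring

theorem hasHilbertTransformAt_folded (h : H1Pair f g) (x : ℝ) :
    HasHilbertTransformAt f x ((1 / Real.pi) * ∫ u in Ioi 0, (f (x - u) - f (x + u)) / u) :=
  hasHilbertTransformAt_of_folded (fun _ hε => integrableOn_truncated h.memLp x hε)
    (h.integrableOn_folded x)

theorem hasHilbertTransformAt (h : H1Pair f g) (x : ℝ) :
    HasHilbertTransformAt f x (hilbertTransform f x) := by
  have := h.hasHilbertTransformAt_folded x
  rwa [this.hilbertTransform_eq]

end H1Pair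

/-! ### Boundary values and behaviour at infinity. -/

/-- Boundary values of the Cauchy integral. -/
noncomputable def boundary (f : ℝ → ℝ) (x : ℝ) : ℂ :=
  ⟨hilbertTransform f x, -f x⟩

@[simp] theorem boundary_re (f : ℝ → ℝ) (x : ℝ) : (boundary f x).re = hilbertTransform f x := rfl
@[simp] theorem boundary_im (f : ℝ → ℝ) (x : ℝ) : (boundary f x).im = -f x := rfl

/-- Each kernel difference equals `±iη/(u(±u + iη))`, of modulus at most `min(1/u, η/u²)`. The
factor `√u` from the increments then gives the integrable majorant. -/
theorem folded_kernel_le {A B : ℝ} {G u η : ℝ} (hη : 0 < η) (hu : 0 < u)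
    (hA : |A| ≤ G * √u) (hB : |B| ≤ G * √u) :
    ‖(A : ℂ) * (1 / (u + η * Complex.I) - 1 / u) + B * (1 / (-u + η * Complex.I) + 1 / u)‖
      ≤ 2 * G * (if u ≤ η then u ^ (-(1 / 2) : ℝ) else η * u ^ (-(3 / 2) : ℝ)) := by
  have hG : 0 ≤ G := by
    by_contra hneg
    have := (abs_nonneg A).trans hA
    have := Real.sqrt_pos.2 hu
    nlinarith
  have hu0 : (u : ℂ) ≠ 0 := by exact_mod_cast hu.ne'
  have n1 : ‖(u + η * Complex.I : ℂ)‖ = √(u ^ 2 + η ^ 2) := Complex.norm_add_mul_I u η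
  have n2 : ‖(-u + η * Complex.I : ℂ)‖ = √(u ^ 2 + η ^ 2) := by
    have := Complex.norm_add_mul_I (-u) η
    rw [neg_sq] at this
    simpa using this
  have hpos : 0 < √(u ^ 2 + η ^ 2) := Real.sqrt_pos.2 (by positivity)
  have d1 : (u + η * Complex.I : ℂ) ≠ 0 := norm_pos_iff.1 (n1 ▸ hpos)
  have d2 : (-u + η * Complex.I : ℂ) ≠ 0 := norm_pos_iff.1 (n2 ▸ hpos)
  have e1 : (1 / (u + η * Complex.I) - 1 / u : ℂ) = -(η * Complex.I) / (u * (u + η * Complex.I)) := by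
    field_simp; ring
  have e2 : (1 / (-u + η * Complex.I) + 1 / u : ℂ) = (η * Complex.I) / (u * (-u + η * Complex.I)) := by
    field_simp; ring
  rw [e1, e2]
  have hk : η / √(u ^ 2 + η ^ 2) ≤ if u ≤ η then 1 else η / u := by
    split_ifs with hle
    · rw [div_le_one hpos]
      exact Real.le_sqrt_of_sq_le (by nlinarith [sq_nonneg u])
    · refine div_le_div_of_nonneg_left hη.le hu ?_
      exact Real.le_sqrt_of_sq_le (by nlinarith [sq_nonneg η])
  calc _ ≤ |A| * (η / (u * √(u ^ 2 + η ^ 2))) + |B| * (η / (u * √(u ^ 2 + η ^ 2))) := by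
        refine (norm_add_le _ _).trans (le_of_eq ?_)
        simp only [norm_mul, norm_div, norm_neg, n1, n2, Complex.norm_real, Complex.norm_I,
          Real.norm_eq_abs, abs_of_pos hη, abs_of_pos hu, mul_one]
    _ ≤ G * √u * (η / (u * √(u ^ 2 + η ^ 2))) + G * √u * (η / (u * √(u ^ 2 + η ^ 2))) := by
        gcongr
    _ = 2 * G * (√u / u * (η / √(u ^ 2 + η ^ 2))) := by field_simp; ring
    _ ≤ 2 * G * (√u / u * (if u ≤ η then 1 else η / u)) := by gcongr
    _ = _ := by
        rw [sqrt_div_self_le hu]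
        congr 1
        split_ifs
        · simp
        · rw [mul_div_assoc', mul_comm, mul_div_assoc]
          congr 1
          rw [show (-(3 / 2) : ℝ) = -(1 / 2) - 1 by norm_num, Real.rpow_sub hu, Real.rpow_one]

/-- The Cauchy integral of an `H¹` function converges uniformly to its boundary values. -/
theorem H1Pair.norm_cauchy_sub_boundary_le {f g : ℝ → ℝ} (h : H1Pair f g) (x : ℝ) {η : ℝ}
    (hη : 0 < η) : ‖cauchy f (x + η * Complex.I) - boundary f x‖ ≤ 3 * l2 g * √η := by
  set z : ℂ := x + η * Complex.I with hz
  have him : 0 < z.im := by simpa [hz] using hη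
  obtain ⟨s1, s2, s3⟩ := integral_fold (integrable_div_of_im_pos h.memLp him) x
  have p1 := h.integrableOn_folded x
  have k0 := integrable_sq_kernel 0 hη
  obtain ⟨q1, q2, q3⟩ := integral_fold k0.1 0
  simp only [zero_sub, sub_neg_eq_add, zero_add, neg_sq] at q1 q2 q3 k0
  rw [k0.2] at q3
  -- The value `-i f(x)` is written as an integral over the same half-line, using that `η/(u² + η²)`
  -- has integral `π` over the line. After subtraction only the increments `f(x ± u) - f(x)` remain.
  have hb : boundary f x = (1 / Real.pi : ℝ) *
      ((∫ u in Ioi 0, (((f (x - u) - f (x + u)) / u : ℝ) : ℂ))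
        - Complex.I * f x * ∫ u in Ioi 0, ((η * ((u ^ 2 + η ^ 2)⁻¹ + (u ^ 2 + η ^ 2)⁻¹) : ℝ) : ℂ)) := by
    rw [integral_complex_ofReal, integral_complex_ofReal, integral_const_mul, ← q3]
    apply Complex.ext
    · simp [(h.hasHilbertTransformAt_folded x).hilbertTransform_eq]
    · simp [field]
  have hint2 : IntegrableOn (fun u : ℝ => ((η * ((u ^ 2 + η ^ 2)⁻¹ + (u ^ 2 + η ^ 2)⁻¹) : ℝ) : ℂ))
      (Ioi 0) := ((q1.add q2).const_mul η).ofReal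
  have hint1 : IntegrableOn (fun u : ℝ => (((f (x - u) - f (x + u)) / u : ℝ) : ℂ)) (Ioi 0) :=
    p1.ofReal
  have hS : IntegrableOn (fun u : ℝ => (f (x - u) : ℂ) / (z - (x - u : ℝ)) +
      (f (x + u) : ℂ) / (z - (x + u : ℝ))) (Ioi 0) := s1.add s2
  have hint3 : IntegrableOn (fun u : ℝ => (((f (x - u) - f (x + u)) / u : ℝ) : ℂ) - Complex.I * f x *
      ((η * ((u ^ 2 + η ^ 2)⁻¹ + (u ^ 2 + η ^ 2)⁻¹) : ℝ) : ℂ)) (Ioi 0) :=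
    hint1.sub (hint2.const_mul _)
  have hdiff : cauchy f z - boundary f x = (1 / Real.pi : ℝ) * ∫ u in Ioi (0 : ℝ),
      (((f (x - u) - f x : ℝ) : ℂ) * (1 / (u + η * Complex.I) - 1 / u)
        + ((f (x + u) - f x : ℝ) : ℂ) * (1 / (-u + η * Complex.I) + 1 / u)) := by
    rw [cauchy, hb, s3, ← mul_sub, ← integral_const_mul, ← integral_sub hint1 (hint2.const_mul _),
      ← integral_sub hS hint3]
    congr 1
    refine setIntegral_congr_fun measurableSet_Ioi fun u hu => ?_
    have hu' : (0 : ℝ) < u := hu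
    have hu0 : (u : ℂ) ≠ 0 := by exact_mod_cast hu'.ne'
    have d1 : (u + η * Complex.I : ℂ) ≠ 0 := fun h0 => by
      have := congrArg Complex.im h0; simp at this; exact hη.ne' this
    have d2 : (-u + η * Complex.I : ℂ) ≠ 0 := fun h0 => by
      have := congrArg Complex.im h0; simp at this; exact hη.ne' this
    have z1 : z - (x - u : ℝ) = u + η * Complex.I := by rw [hz]; push_cast; ring
    have z2 : z - (x + u : ℝ) = -u + η * Complex.I := by rw [hz]; push_cast; ring
    have key : (1 / (u + η * Complex.I) + 1 / (-u + η * Complex.I) : ℂ)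
        = -Complex.I * ((η * ((u ^ 2 + η ^ 2)⁻¹ + (u ^ 2 + η ^ 2)⁻¹) : ℝ) : ℂ) := by
      have d3 : ((u : ℂ) ^ 2 + (η : ℂ) ^ 2) ≠ 0 := by
        have : (0 : ℝ) < u ^ 2 + η ^ 2 := by positivity
        exact_mod_cast this.ne'
      have d4 : (u + η * Complex.I : ℂ) * (-u + η * Complex.I) = -((u : ℂ) ^ 2 + (η : ℂ) ^ 2) := by
        linear_combination (η : ℂ) ^ 2 * Complex.I_sq
      rw [div_add_div _ _ d1 d2, d4]
      push_cast
      field_simp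
      ring
    simp only [z1, z2]
    push_cast at key ⊢
    linear_combination (f x : ℂ) * key
  rw [hdiff, norm_mul, Complex.norm_real, Real.norm_eq_abs, abs_of_pos (by positivity)]
  have hG := integrableOn_sqrt_majorant hη
  have hle : ‖∫ u in Ioi (0 : ℝ),
      (((f (x - u) - f x : ℝ) : ℂ) * (1 / (u + η * Complex.I) - 1 / u)
        + ((f (x + u) - f x : ℝ) : ℂ) * (1 / (-u + η * Complex.I) + 1 / u))‖
      ≤ 2 * l2 g * (4 * √η) := by
    rw [← hG.2, ← integral_const_mul]
    refine norm_integral_le_of_norm_le (hG.1.const_mul _) ?_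
    refine (ae_restrict_iff' measurableSet_Ioi).2 (Eventually.of_forall fun u hu => ?_)
    have hu' : (0 : ℝ) < u := hu
    refine folded_kernel_le hη hu' ?_ ?_
    · have := h.holder (x - u) x
      simpa [abs_of_pos hu'] using this
    · have := h.holder (x + u) x
      simpa [abs_of_pos hu'] using this
  calc 1 / Real.pi * _ ≤ 1 / Real.pi * (2 * l2 g * (4 * √η)) := by gcongr
    _ = (l2 g * √η) * (8 / Real.pi) := by ring
    _ ≤ (l2 g * √η) * 3 := by
        refine mul_le_mul_of_nonneg_left ?_ (mul_nonneg (l2_nonneg _) (Real.sqrt_nonneg _))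
        rw [div_le_iff₀ Real.pi_pos]; linarith [Real.pi_gt_three]
    _ = _ := by ring

theorem H1Pair.norm_boundary_le {f g : ℝ → ℝ} (h : H1Pair f g) (x : ℝ) :
    ‖boundary f x‖ ≤ l2 f + 3 * l2 g := by
  have h1 := h.norm_cauchy_sub_boundary_le x one_pos
  have h2 := norm_cauchy_le h.memLp (z := x + (1 : ℝ) * Complex.I) (by simp)
  have h3 := norm_sub_norm_le (boundary f x) (cauchy f (x + (1 : ℝ) * Complex.I))
  rw [norm_sub_rev] at h3
  simp at h1 h2 h3
  linarith

theorem norm_eq_re_add_im (z : ℂ) : (z.re : ℂ) + z.im * Complex.I = z := Complex.re_add_im z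

/-- The Cauchy integral of an `H¹` function is bounded on the upper half-plane. -/
theorem H1Pair.norm_cauchy_le_of_im_pos {f g : ℝ → ℝ} (h : H1Pair f g) {z : ℂ} (hz : 0 < z.im) :
    ‖cauchy f z‖ ≤ l2 f + 6 * l2 g := by
  have hf := l2_nonneg f
  have hg := l2_nonneg g
  rcases le_total z.im 1 with h1 | h1
  · have h2 := h.norm_cauchy_sub_boundary_le z.re hz
    rw [norm_eq_re_add_im] at h2
    have h3 : √z.im ≤ 1 := Real.sqrt_le_one.2 h1
    have h4 := h.norm_boundary_le z.re
    have h5 := norm_sub_norm_le (cauchy f z) (boundary f z.re)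
    nlinarith
  · have h2 := norm_cauchy_le h.memLp hz
    have h3 : 1 ≤ √z.im := Real.one_le_sqrt.2 h1
    have : l2 f / √z.im ≤ l2 f := div_le_self hf h3
    linarith

/-- The Cauchy integral tends to zero at infinity on half-planes `η₀ ≤ Im z`. -/
theorem cauchy_small_of_le_im {f : ℝ → ℝ} (hf : MemLp f 2) {η₀ ε : ℝ} (hη : 0 < η₀) (hε : 0 < ε) :
    ∃ M, ∀ z : ℂ, η₀ ≤ z.im → M ≤ ‖z‖ → ‖cauchy f z‖ ≤ ε := by
  -- Outside a large interval `f` has small `L²` norm, and `norm_cauchy_le` controls that tail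
  -- uniformly on `Im z ≥ η₀`. The part inside is integrable, so its Cauchy integral is `O(1/(‖z‖ -
  -- R))`.
  obtain ⟨R, hR⟩ : ∃ R : ℝ, 0 < R ∧ l2 (fun y => (Icc (-R) R)ᶜ.indicator f y) / √η₀ ≤ ε / 2 := by
    have hlim : Tendsto (fun R : ℝ => l2 (fun y => (Icc (-R) R)ᶜ.indicator f y) / √η₀) atTop
        (𝓝 (0 / √η₀)) := by
      refine Tendsto.div_const ?_ _
      rw [← Real.sqrt_zero]
      refine Tendsto.sqrt ?_
      have : (0 : ℝ) = ∫ _ : ℝ, (0 : ℝ) := by simp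
      rw [this]
      refine tendsto_integral_filter_of_dominated_convergence (fun y => f y ^ 2)
        (Eventually.of_forall fun R => ?_) (Eventually.of_forall fun R => Eventually.of_forall fun y => ?_)
        hf.integrable_sq (Eventually.of_forall fun y => ?_)
      · exact (hf.1.indicator measurableSet_Icc.compl).pow 2
      · by_cases hy : y ∈ (Icc (-R) R)ᶜ
        · simp [indicator_of_mem hy]
        · simp [indicator_of_notMem hy, sq_nonneg]
      · refine tendsto_const_nhds.congr' ?_
        filter_upwards [eventually_ge_atTop |y|] with R hR
        have : y ∉ (Icc (-R) R)ᶜ := by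
          simpa [abs_le] using hR
        simp [indicator_of_notMem this]
    rw [zero_div] at hlim
    obtain ⟨R, h1, h2⟩ := ((hlim.eventually (ge_mem_nhds (half_pos hε))).and
      (eventually_gt_atTop 0)).exists
    exact ⟨R, h2, h1⟩
  obtain ⟨hR0, hR⟩ := hR
  set f₁ := (Icc (-R) R).indicator f with hf₁
  set f₂ := (Icc (-R) R)ᶜ.indicator f with hf₂
  have m1 : MemLp f₁ 2 := hf.indicator measurableSet_Icc
  have m2 : MemLp f₂ 2 := hf.indicator measurableSet_Icc.compl
  have hI : IntegrableOn f (Icc (-R) R) :=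
    (MemLp.locallyIntegrable_two hf).integrableOn_isCompact isCompact_Icc
  set A := ∫ y, |f₁ y| with hA
  have hA0 : 0 ≤ A := integral_nonneg fun _ => abs_nonneg _
  have i1 : Integrable f₁ := (integrable_indicator_iff measurableSet_Icc).2 hI
  refine ⟨R + 2 * A / ε + 1, fun z hz hM => ?_⟩
  have him : 0 < z.im := hη.trans_le hz
  have hsum : cauchy f z = cauchy f₁ z + cauchy f₂ z := by
    rw [cauchy, cauchy, cauchy, ← mul_add, ← integral_add (integrable_div_of_im_pos m1 him)
      (integrable_div_of_im_pos m2 him)]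
    congr 2; funext y
    rw [← add_div, ← Complex.ofReal_add]
    congr 2
    exact (indicator_self_add_compl_apply _ _ _).symm
  have hd : 0 < ‖z‖ - R := by
    have : 0 ≤ 2 * A / ε := by positivity
    linarith
  have b1 : ‖cauchy f₁ z‖ ≤ ε / 2 := by
    rw [cauchy, norm_mul, Complex.norm_real, Real.norm_eq_abs, abs_of_pos (by positivity)]
    have : ‖∫ y : ℝ, (f₁ y : ℂ) / (z - y)‖ ≤ A / (‖z‖ - R) := by
      rw [hA, ← integral_div]
      refine norm_integral_le_of_norm_le (i1.abs.div_const _) (Eventually.of_forall fun y => ?_)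
      by_cases hy : y ∈ Icc (-R) R
      · rw [norm_div, Complex.norm_real, Real.norm_eq_abs]
        refine div_le_div_of_nonneg_left (abs_nonneg _) hd ?_
        have h1 := norm_sub_norm_le z y
        rw [Complex.norm_real, Real.norm_eq_abs] at h1
        have := abs_le.2 hy
        linarith
      · simp [hf₁, indicator_of_notMem hy]
    have h2 : A / (‖z‖ - R) ≤ ε / 2 := by
      rw [div_le_iff₀ hd]
      have : 2 * A / ε ≤ ‖z‖ - R := by linarith
      rw [div_le_iff₀ hε] at this
      linarith
    have h3 : 1 / Real.pi ≤ 1 := by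
      rw [div_le_one Real.pi_pos]; linarith [Real.pi_gt_three]
    calc _ ≤ 1 * (ε / 2) := by
          refine mul_le_mul h3 (this.trans h2) (norm_nonneg _) zero_le_one
      _ = _ := one_mul _
  have b2 : ‖cauchy f₂ z‖ ≤ ε / 2 := by
    refine (norm_cauchy_le m2 him).trans (le_trans ?_ hR)
    exact div_le_div_of_nonneg_left (l2_nonneg _) (Real.sqrt_pos.2 hη) (Real.sqrt_le_sqrt hz)
  rw [hsum]
  linarith [norm_add_le (cauchy f₁ z) (cauchy f₂ z)]

/-- The Cauchy integral of an `H¹` function and its boundary values tend to zero at infinity. -/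
theorem H1Pair.cauchy_small {f g : ℝ → ℝ} (h : H1Pair f g) {ε : ℝ} (hε : 0 < ε) :
    ∃ M, (∀ z : ℂ, 0 < z.im → M ≤ ‖z‖ → ‖cauchy f z‖ ≤ ε) ∧
      ∀ x : ℝ, M ≤ |x| → ‖boundary f x‖ ≤ ε := by
  -- Points below the line `Im z = η₀` are compared with the boundary, and the boundary with that
  -- line, each at cost `ε/3`; the decay on the line supplies the last third.
  obtain ⟨η₀, hη, hsm⟩ : ∃ η₀ : ℝ, 0 < η₀ ∧ 3 * l2 g * √η₀ ≤ ε / 3 := by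
    have hlim : Tendsto (fun η : ℝ => 3 * l2 g * √η) (𝓝[>] 0) (𝓝 (3 * l2 g * √0)) :=
      (Continuous.tendsto (by fun_prop) 0).mono_left nhdsWithin_le_nhds
    rw [Real.sqrt_zero, mul_zero] at hlim
    obtain ⟨η, h1, h2⟩ := ((hlim.eventually (ge_mem_nhds (by positivity : (0 : ℝ) < ε / 3))).and
      self_mem_nhdsWithin).exists
    exact ⟨η, h2, h1⟩
  obtain ⟨M, hM⟩ := cauchy_small_of_le_im h.memLp hη (by positivity : 0 < ε / 3)
  have hb : ∀ x : ℝ, M + η₀ ≤ |x| → ‖boundary f x‖ ≤ 2 * (ε / 3) := by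
    intro x hx
    have h1 := h.norm_cauchy_sub_boundary_le x hη
    have h2 : ‖cauchy f (x + η₀ * Complex.I)‖ ≤ ε / 3 := by
      refine hM _ (by simp) ?_
      have := Complex.abs_re_le_norm (x + η₀ * Complex.I)
      simp at this
      linarith
    have h3 := norm_sub_norm_le (boundary f x) (cauchy f (x + η₀ * Complex.I))
    rw [norm_sub_rev] at h3
    linarith
  refine ⟨M + 2 * η₀, fun z hz hzM => ?_, fun x hx => (hb x (by linarith)).trans (by linarith)⟩
  rcases le_total η₀ z.im with h1 | h1
  · exact (hM z h1 (by linarith)).trans (by linarith)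
  · have h2 := h.norm_cauchy_sub_boundary_le z.re hz
    rw [norm_eq_re_add_im] at h2
    have h3 : M + η₀ ≤ |z.re| := by
      have := Complex.norm_le_abs_re_add_abs_im z
      rw [abs_of_pos hz] at this
      linarith
    have h4 := hb z.re h3
    have h5 := norm_sub_norm_le (cauchy f z) (boundary f z.re)
    have h6 : 3 * l2 g * √z.im ≤ 3 * l2 g * √η₀ := by
      have := l2_nonneg g
      gcongr
    linarith

/-! ### `L²` bounds on horizontal lines, and `H` on `H¹`. -/

theorem norm_inv_sub_le {α : ℂ} {r : ℝ} (hr : 0 < r) (h : r ≤ |α.im|) (x : ℝ) :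
    ‖((x : ℂ) - α)⁻¹‖ ≤ (1 + (1 + ‖α‖) / r) * (1 + |x|)⁻¹ := by
  have h1 : r ≤ ‖α - x‖ := by
    have := Complex.abs_im_le_norm (α - x)
    simp only [Complex.sub_im, Complex.ofReal_im, sub_zero] at this
    exact h.trans this
  have h2 := one_add_abs_le hr h1
  rw [norm_inv, norm_sub_rev, inv_le_iff_one_le_mul₀ (hr.trans_le h1), mul_assoc,
    mul_comm _ ‖α - x‖, ← mul_assoc, ← div_eq_mul_inv, one_le_div (by positivity)]
  exact h2

/-- A residue computation. -/
theorem integral_inv_mul_inv {α β : ℂ} (hα : α.im < 0) (hβ : 0 < β.im) :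
    ∫ x : ℝ, ((x : ℂ) - α)⁻¹ * ((x : ℂ) - β)⁻¹ = 2 * Real.pi * Complex.I / (β - α) := by
  have hαβ : α - β ≠ 0 := fun h => by
    have := congrArg Complex.im h; simp at this; linarith
  have hαx : ∀ x : ℝ, (x : ℂ) - α ≠ 0 := fun x h => by
    have := congrArg Complex.im h; simp at this; linarith
  have hβx : ∀ x : ℝ, (x : ℂ) - β ≠ 0 := fun x h => by
    have := congrArg Complex.im h; simp at this; linarith
  have hint : Integrable fun x : ℝ => ((x : ℂ) - α)⁻¹ * ((x : ℂ) - β)⁻¹ := by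
    refine Integrable.mono' (integrable_inv_one_add_abs_sq.const_mul
      ((1 + (1 + ‖α‖) / |α.im|) * (1 + (1 + ‖β‖) / |β.im|))) ?_ (Eventually.of_forall fun x => ?_)
    · exact ((Continuous.inv₀ (by fun_prop) hαx).mul
        (Continuous.inv₀ (by fun_prop) hβx)).aestronglyMeasurable
    · have h1 := norm_inv_sub_le (abs_pos.2 hα.ne) le_rfl x
      have h2 := norm_inv_sub_le (abs_pos.2 hβ.ne') le_rfl x
      rw [norm_mul, pow_two]
      refine (mul_le_mul h1 h2 (norm_nonneg _) (by positivity)).trans (le_of_eq (by ring))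
  -- A primitive in terms of the principal logarithm. It vanishes at `+∞`; as `x → -∞` the point `x
  -- - α` approaches the cut from above and `x - β` from below, so the difference of logarithms
  -- tends to `2πi`.
  set F : ℝ → ℂ := fun x => (Complex.log (x - α) - Complex.log (x - β)) / (α - β) with hF
  have hder : ∀ x : ℝ, HasDerivAt F (((x : ℂ) - α)⁻¹ * ((x : ℂ) - β)⁻¹) x := by
    intro x
    have s1 : (x : ℂ) - α ∈ Complex.slitPlane := Or.inr (by simpa using hα.ne)
    have s2 : (x : ℂ) - β ∈ Complex.slitPlane := Or.inr (by simpa using hβ.ne')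
    have d1 := (((hasDerivAt_id x).ofReal_comp).sub_const α).clog_real s1
    have d2 := (((hasDerivAt_id x).ofReal_comp).sub_const β).clog_real s2
    refine ((d1.sub d2).div_const (α - β)).congr_deriv ?_
    have h1 := hαx x
    have h2 := hβx x
    simp only [id, Complex.ofReal_one]
    field_simp
    ring
  have hinvT : Tendsto (fun x : ℝ => (x : ℂ)⁻¹) atTop (𝓝 0) := by
    simpa [Function.comp_def] using (Complex.continuous_ofReal.tendsto 0).comp tendsto_inv_atTop_zero
  have hinvB : Tendsto (fun x : ℝ => (x : ℂ)⁻¹) atBot (𝓝 0) := by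
    simpa [Function.comp_def] using (Complex.continuous_ofReal.tendsto 0).comp tendsto_inv_atBot_zero
  have htop : Tendsto F atTop (𝓝 0) := by
    have hl : ∀ γ : ℂ, Tendsto (fun x : ℝ => Complex.log (1 - γ * (x : ℂ)⁻¹)) atTop (𝓝 0) := by
      intro γ
      have h1 : Tendsto (fun x : ℝ => 1 - γ * (x : ℂ)⁻¹) atTop (𝓝 1) := by
        simpa using (hinvT.const_mul γ).const_sub 1
      have := (continuousAt_clog Complex.one_mem_slitPlane).tendsto.comp h1
      simpa [Function.comp_def] using this
    have h2 := ((hl α).sub (hl β)).div_const (α - β)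
    rw [sub_zero, zero_div] at h2
    refine h2.congr' ?_
    filter_upwards [eventually_gt_atTop 0] with x hx
    have hx0 : (x : ℂ) ≠ 0 := by exact_mod_cast hx.ne'
    have e : ∀ γ : ℂ, (x : ℂ) - γ ≠ 0 →
        Complex.log (x - γ) = Real.log x + Complex.log (1 - γ * (x : ℂ)⁻¹) := by
      intro γ hγ
      have e1 : (x : ℂ) - γ = x * (1 - γ * (x : ℂ)⁻¹) := by field_simp
      rw [e1, Complex.log_ofReal_mul hx]
      intro h0
      rw [h0, mul_zero] at e1
      exact hγ e1
    simp only [hF, e α (hαx x), e β (hβx x)]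
    ring
  have hbot : Tendsto F atBot (𝓝 (2 * Real.pi * Complex.I / (α - β))) := by
    have hl1 : Tendsto (fun x : ℝ => Complex.log (-1 + α * (x : ℂ)⁻¹)) atBot
        (𝓝 (Real.pi * Complex.I)) := by
      have h1 : Tendsto (fun x : ℝ => -1 + α * (x : ℂ)⁻¹) atBot (𝓝[{z | 0 ≤ z.im}] (-1)) := by
        refine tendsto_nhdsWithin_iff.2 ⟨by simpa using (hinvB.const_mul α).const_add (-1), ?_⟩
        filter_upwards [eventually_lt_atBot 0] with x hx
        rw [← Complex.ofReal_inv]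
        simpa using mul_nonneg_of_nonpos_of_nonpos hα.le (inv_nonpos.2 hx.le)
      have h2 := Complex.continuousWithinAt_log_of_re_neg_of_im_zero (z := -1) (by simp) (by simp)
      have := h2.tendsto.comp h1
      rwa [Complex.log_neg_one] at this
    have hl2 : Tendsto (fun x : ℝ => Complex.log (-1 + β * (x : ℂ)⁻¹)) atBot
        (𝓝 (-(Real.pi * Complex.I))) := by
      have h1 : Tendsto (fun x : ℝ => -1 + β * (x : ℂ)⁻¹) atBot (𝓝[{z | z.im < 0}] (-1)) := by
        refine tendsto_nhdsWithin_iff.2 ⟨by simpa using (hinvB.const_mul β).const_add (-1), ?_⟩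
        filter_upwards [eventually_lt_atBot 0] with x hx
        rw [← Complex.ofReal_inv]
        simpa using mul_neg_of_pos_of_neg hβ (inv_lt_zero.2 hx)
      have h2 := Complex.tendsto_log_nhdsWithin_im_neg_of_re_neg_of_im_zero (z := -1)
        (by simp) (by simp)
      have := h2.comp h1
      simpa [Function.comp_def] using this
    have h2 := (hl1.sub hl2).div_const (α - β)
    have e0 : (Real.pi * Complex.I - -(Real.pi * Complex.I)) / (α - β)
      = 2 * Real.pi * Complex.I / (α - β) := by ring
    rw [e0] at h2
    refine h2.congr' ?_
    filter_upwards [eventually_lt_atBot 0] with x hx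
    have hx0 : (x : ℂ) ≠ 0 := by exact_mod_cast hx.ne
    have e : ∀ γ : ℂ, (x : ℂ) - γ ≠ 0 →
        Complex.log (x - γ) = Real.log (-x) + Complex.log (-1 + γ * (x : ℂ)⁻¹) := by
      intro γ hγ
      have e1 : (x : ℂ) - γ = (-x : ℝ) * (-1 + γ * (x : ℂ)⁻¹) := by push_cast; field_simp; ring
      rw [e1, Complex.log_ofReal_mul (by linarith)]
      intro h0
      rw [h0, mul_zero] at e1
      exact hγ e1
    simp only [hF, e α (hαx x), e β (hβx x)]
    ring
  rw [integral_of_hasDerivAt_of_tendsto hder hint hbot htop, zero_sub, ← div_neg, neg_sub]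

/-- Fatou's lemma for sequences of integrable functions. -/
theorem integrable_of_tendsto_of_integral_le {u : ℕ → ℝ → ℝ} {v : ℝ → ℝ} {M : ℝ}
    (hi : ∀ n, Integrable (u n)) (hn : ∀ n x, 0 ≤ u n x) (hM : ∀ n, ∫ x, u n x ≤ M)
    (hlim : ∀ x, Tendsto (fun n => u n x) atTop (𝓝 (v x))) : Integrable v ∧ ∫ x, v x ≤ M := by
  have hv : ∀ x, 0 ≤ v x := fun x => ge_of_tendsto' (hlim x) fun n => hn n x
  have hvm : AEStronglyMeasurable v volume :=
    aestronglyMeasurable_of_tendsto_ae atTop (fun n => (hi n).1) (Eventually.of_forall hlim)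
  have hM0 : 0 ≤ M := (integral_nonneg (hn 0)).trans (hM 0)
  have hle : ∫⁻ x, ENNReal.ofReal (v x) ≤ ENNReal.ofReal M := by
    have h1 : ∀ x, liminf (fun n => ENNReal.ofReal (u n x)) atTop = ENNReal.ofReal (v x) := fun x =>
      ((ENNReal.continuous_ofReal.tendsto _).comp (hlim x)).liminf_eq
    calc ∫⁻ x, ENNReal.ofReal (v x) = ∫⁻ x, liminf (fun n => ENNReal.ofReal (u n x)) atTop := by
          simp_rw [h1]
      _ ≤ liminf (fun n => ∫⁻ x, ENNReal.ofReal (u n x)) atTop :=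
          lintegral_liminf_le' fun n => (hi n).1.aemeasurable.ennreal_ofReal
      _ ≤ ENNReal.ofReal M := by
          refine liminf_le_of_le (by isBoundedDefault) fun b hb => ?_
          obtain ⟨n, hbn⟩ := hb.exists
          refine hbn.trans ?_
          rw [← ofReal_integral_eq_lintegral_ofReal (hi n) (Eventually.of_forall (hn n))]
          exact ENNReal.ofReal_le_ofReal (hM n)
  refine ⟨⟨hvm, ?_⟩, ?_⟩
  · rw [hasFiniteIntegral_iff_ofReal (Eventually.of_forall hv)]
    exact hle.trans_lt ENNReal.ofReal_lt_top
  · rw [integral_eq_lintegral_of_nonneg_ae (Eventually.of_forall hv) hvm]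
    exact ENNReal.toReal_le_of_le_ofReal hM0 hle

/-- The squared modulus is expanded as a double integral in `y, y'`; after Fubini the integral over
`x` is the residue computation. Its real part leaves the positive kernel `4πη/((y - y')² + 4η²)`,
and `2 g(y) g(y') ≤ g(y)² + g(y')²` finishes. The bounded support makes the triple integrand
absolutely integrable. -/
theorem integrable_norm_cauchy_sq_of_support {g : ℝ → ℝ} (hg : MemLp g 2) {R : ℝ}
    (hR : ∀ y, R < |y| → g y = 0) {η : ℝ} (hη : 0 < η) :
    Integrable (fun x : ℝ => ‖cauchy g (x + η * Complex.I)‖ ^ 2) ∧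
      ∫ x : ℝ, ‖cauchy g (x + η * Complex.I)‖ ^ 2 ≤ 2 * ∫ y, g y ^ 2 := by
  have hgi : Integrable g := by
    have h1 : IntegrableOn g (Icc (-R) R) :=
      (MemLp.locallyIntegrable_two hg).integrableOn_isCompact isCompact_Icc
    refine (integrableOn_iff_integrable_of_support_subset ?_).1 h1
    intro y hy
    by_contra hne
    exact hy (hR y (by rw [← not_le, abs_le]; exact hne))
  set k : ℝ → ℝ → ℂ := fun x y => ((x : ℂ) - (y - η * Complex.I))⁻¹ with hk
  set k' : ℝ → ℝ → ℂ := fun x y => ((x : ℂ) - (y + η * Complex.I))⁻¹ with hk'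
  have hconj : ∀ x y, k' x y = starRingEnd ℂ (k x y) := by
    intro x y
    simp only [hk, hk', map_inv₀, map_sub, map_mul, Complex.conj_ofReal, Complex.conj_I]
    congr 1; ring
  set D := 1 + (1 + (|R| + η)) / η with hD
  have hkb : ∀ x y, |y| ≤ |R| → ‖k x y‖ ≤ D * (1 + |x|)⁻¹ := by
    intro x y hy
    refine (norm_inv_sub_le hη (α := y - η * Complex.I) (by simp [abs_of_pos hη]) x).trans ?_
    have : ‖(y - η * Complex.I : ℂ)‖ ≤ |R| + η := by
      refine (norm_sub_le _ _).trans ?_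
      simpa [abs_of_pos hη] using hy
    rw [hD]; gcongr
  have hk'b : ∀ x y, |y| ≤ |R| → ‖k' x y‖ ≤ D * (1 + |x|)⁻¹ := by
    intro x y hy
    rw [hconj, RCLike.norm_conj]
    exact hkb x y hy
  have hgm : AEStronglyMeasurable (fun y => (g y : ℂ)) volume :=
    Complex.continuous_ofReal.comp_aestronglyMeasurable hg.1
  set Φ : ℝ → ℝ × ℝ → ℂ := fun x p => ((g p.1 : ℂ) * k x p.1) * ((g p.2 : ℂ) * k' x p.2) with hΦ
  have hΦi : Integrable (Function.uncurry Φ) (volume.prod (volume.prod volume)) := by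
    have hmaj : Integrable (fun q : ℝ × (ℝ × ℝ) => ((1 + |q.1|)⁻¹ ^ 2) * (|g q.2.1| * |g q.2.2|))
        (volume.prod (volume.prod volume)) :=
      integrable_inv_one_add_abs_sq.mul_prod (hgi.abs.mul_prod hgi.abs)
    refine (hmaj.const_mul (D ^ 2)).mono' ?_ (Eventually.of_forall fun q => ?_)
    · have m1 : AEStronglyMeasurable (fun q : ℝ × (ℝ × ℝ) => (g q.2.1 : ℂ))
          (volume.prod (volume.prod volume)) := (hgm.comp_fst (ν := volume)).comp_snd (μ := volume)
      have m2 : AEStronglyMeasurable (fun q : ℝ × (ℝ × ℝ) => (g q.2.2 : ℂ))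
          (volume.prod (volume.prod volume)) := (hgm.comp_snd (μ := volume)).comp_snd (μ := volume)
      have m3 : Measurable (fun q : ℝ × (ℝ × ℝ) => k q.1 q.2.1) := by
        simp only [hk]; fun_prop
      have m4 : Measurable (fun q : ℝ × (ℝ × ℝ) => k' q.1 q.2.2) := by
        simp only [hk']; fun_prop
      exact (m1.mul m3.aestronglyMeasurable).mul (m2.mul m4.aestronglyMeasurable)
    · obtain ⟨x, y, y'⟩ := q
      simp only [Function.uncurry, hΦ]
      by_cases h1 : |y| ≤ |R|
      · by_cases h2 : |y'| ≤ |R|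
        · have b1 := hkb x y h1
          have b2 := hk'b x y' h2
          simp only [norm_mul, Complex.norm_real, Real.norm_eq_abs]
          calc |g y| * ‖k x y‖ * (|g y'| * ‖k' x y'‖)
              ≤ |g y| * (D * (1 + |x|)⁻¹) * (|g y'| * (D * (1 + |x|)⁻¹)) := by gcongr
            _ = _ := by ring
        · have : g y' = 0 := hR _ ((le_abs_self R).trans_lt (not_le.1 h2))
          simp [this]
      · have : g y = 0 := hR _ ((le_abs_self R).trans_lt (not_le.1 h1))
        simp [this]
  have hcauchy : ∀ x : ℝ, cauchy g (x + η * Complex.I)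
      = (1 / Real.pi : ℝ) * ∫ y, (g y : ℂ) * k x y := by
    intro x
    rw [cauchy]
    congr 2; funext y
    simp only [hk, div_eq_mul_inv]
    congr 2; ring
  have hinner : ∀ x : ℝ, ∫ p, Φ x p ∂(volume.prod volume)
      = ((Real.pi ^ 2 * ‖cauchy g (x + η * Complex.I)‖ ^ 2 : ℝ) : ℂ) := by
    intro x
    simp only [hΦ]
    rw [integral_prod_mul (fun y => (g y : ℂ) * k x y) (fun y => (g y : ℂ) * k' x y)]
    have e1 : ∫ y, (g y : ℂ) * k' x y = starRingEnd ℂ (∫ y, (g y : ℂ) * k x y) := by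
      rw [← integral_conj]
      congr 1; funext y
      rw [hconj, map_mul, Complex.conj_ofReal]
    rw [e1, Complex.mul_conj, hcauchy, norm_mul, mul_pow, Complex.normSq_eq_norm_sq,
      Complex.norm_real, Real.norm_eq_abs, sq_abs]
    congr 1
    field_simp
  have hint : Integrable (fun x : ℝ => ‖cauchy g (x + η * Complex.I)‖ ^ 2) := by
    have h1 := hΦi.integral_prod_left
    simp only [Function.uncurry, hinner] at h1
    have h2 := h1.re
    simp only [RCLike.re_to_complex, Complex.ofReal_re] at h2
    refine (h2.const_mul ((Real.pi ^ 2)⁻¹)).congr (Eventually.of_forall fun x => ?_)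
    simp only
    field_simp
  refine ⟨hint, ?_⟩
  have hswap := integral_integral_swap hΦi
  simp_rw [hinner] at hswap
  have hin2 : ∀ p : ℝ × ℝ, ∫ x, Φ x p
      = (g p.1 : ℂ) * g p.2 * (2 * Real.pi * Complex.I / (p.2 - p.1 + 2 * η * Complex.I)) := by
    intro p
    have := integral_inv_mul_inv (α := p.1 - η * Complex.I) (β := p.2 + η * Complex.I)
      (by simpa using hη) (by simpa using hη)
    have e : ∀ x, Φ x p = (g p.1 : ℂ) * g p.2 * (k x p.1 * k' x p.2) := fun x => by
      simp only [hΦ]; ring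
    simp_rw [e]
    rw [integral_const_mul, this]
    congr 2; ring
  simp_rw [hin2] at hswap
  rw [integral_complex_ofReal, integral_const_mul] at hswap
  set K : ℝ → ℝ := fun u => (u ^ 2 + (2 * η) ^ 2)⁻¹ with hK
  have hKi : Integrable K ∧ ∫ u, K u = Real.pi / (2 * η) := by
    have := integrable_sq_kernel 0 (mul_pos two_pos hη)
    simpa [hK] using this
  have hre : ∀ p : ℝ × ℝ, ((g p.1 : ℂ) * g p.2 *
      (2 * Real.pi * Complex.I / (p.2 - p.1 + 2 * η * Complex.I))).re
      = g p.1 * g p.2 * (4 * Real.pi * η * K (p.1 - p.2)) := by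
    intro p
    rw [← Complex.ofReal_mul, Complex.re_ofReal_mul]
    congr 1
    have hd : (p.2 - p.1 + 2 * η * Complex.I : ℂ) = ((p.2 - p.1 : ℝ) : ℂ) + ((2 * η : ℝ) : ℂ) * Complex.I := by
      push_cast; ring
    have hn : (0 : ℝ) < (p.2 - p.1) ^ 2 + (2 * η) ^ 2 := by positivity
    rw [hd, Complex.div_re, Complex.normSq_add_mul_I]
    simp [hK]
    rw [show (p.1 - p.2) ^ 2 = (p.2 - p.1) ^ 2 by ring]
    field_simp
    ring
  have hGi : Integrable (fun p : ℝ × ℝ => (g p.1 : ℂ) * g p.2 *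
      (2 * Real.pi * Complex.I / (p.2 - p.1 + 2 * η * Complex.I))) (volume.prod volume) := by
    have := hΦi.integral_prod_right
    simp only [Function.uncurry, hin2] at this
    exact this
  have hswap' := congrArg Complex.re hswap
  rw [Complex.ofReal_re, ← RCLike.re_to_complex, ← integral_re hGi] at hswap'
  simp only [RCLike.re_to_complex, hre] at hswap'
  have hGr : Integrable (fun p : ℝ × ℝ => g p.1 * g p.2 * (4 * Real.pi * η * K (p.1 - p.2)))
      (volume.prod volume) := by
    have := hGi.re
    simpa only [RCLike.re_to_complex, hre] using this
  have hg2 := hg.integrable_sq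
  have c1 : Integrable (fun p : ℝ × ℝ => g p.2 ^ 2 * K (p.1 - p.2)) (volume.prod volume) :=
    hg2.convolution_integrand (ContinuousLinearMap.mul ℝ ℝ) hKi.1
  have v1 : ∫ p : ℝ × ℝ, g p.2 ^ 2 * K (p.1 - p.2) ∂(volume.prod volume)
      = (∫ y, g y ^ 2) * (Real.pi / (2 * η)) := by
    have := integral_convolution (ContinuousLinearMap.mul ℝ ℝ) hg2 hKi.1
    rw [hKi.2] at this
    rw [integral_prod _ c1]
    exact this
  have hKs : ∀ p : ℝ × ℝ, K (p.2 - p.1) = K (p.1 - p.2) := fun p => by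
    simp only [hK]; congr 1; ring
  have c2 : Integrable (fun p : ℝ × ℝ => g p.1 ^ 2 * K (p.1 - p.2)) (volume.prod volume) := by
    have := c1.swap
    simpa [Function.comp_def, hKs] using this
  have v2 : ∫ p : ℝ × ℝ, g p.1 ^ 2 * K (p.1 - p.2) ∂(volume.prod volume)
      = (∫ y, g y ^ 2) * (Real.pi / (2 * η)) := by
    rw [← v1, ← integral_prod_swap]
    simp [hKs]
  have hle : ∫ p : ℝ × ℝ, g p.1 * g p.2 * (4 * Real.pi * η * K (p.1 - p.2)) ∂(volume.prod volume)
      ≤ ∫ p : ℝ × ℝ, 2 * Real.pi * η * (g p.2 ^ 2 * K (p.1 - p.2) + g p.1 ^ 2 * K (p.1 - p.2))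
        ∂(volume.prod volume) := by
    refine integral_mono hGr ((c1.add c2).const_mul _) fun p => ?_
    have hKp : 0 ≤ K (p.1 - p.2) := by simp only [hK]; positivity
    have hc : 0 ≤ Real.pi * η * K (p.1 - p.2) := by positivity
    simp only
    nlinarith [mul_nonneg hc (sq_nonneg (g p.1 - g p.2))]
  rw [integral_const_mul, integral_add c1 c2, v1, v2] at hle
  rw [← hswap'] at hle
  have hpi := Real.pi_pos
  have e2 : 2 * Real.pi * η * ((∫ y, g y ^ 2) * (Real.pi / (2 * η)) + (∫ y, g y ^ 2) * (Real.pi / (2 * η)))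
      = Real.pi ^ 2 * (2 * ∫ y, g y ^ 2) := by field_simp; ring
  rw [e2] at hle
  exact le_of_mul_le_mul_left hle (by positivity)

/-- Cauchy integrals of `L²` functions are bounded in `L²` on horizontal lines. -/
theorem integrable_norm_cauchy_sq {g : ℝ → ℝ} (hg : MemLp g 2) {η : ℝ} (hη : 0 < η) :
    Integrable (fun x : ℝ => ‖cauchy g (x + η * Complex.I)‖ ^ 2) ∧
      ∫ x : ℝ, ‖cauchy g (x + η * Complex.I)‖ ^ 2 ≤ 2 * ∫ y, g y ^ 2 := by
  -- Truncations have bounds independent of `n`, and their Cauchy integrals converge pointwise, so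
  -- Fatou's lemma applies.
  set G : ℕ → ℝ → ℝ := fun n => (Icc (-n : ℝ) n).indicator g with hG
  have hGm : ∀ n, MemLp (G n) 2 := fun n => hg.indicator measurableSet_Icc
  have key : ∀ n, Integrable (fun x : ℝ => ‖cauchy (G n) (x + η * Complex.I)‖ ^ 2) ∧
      ∫ x : ℝ, ‖cauchy (G n) (x + η * Complex.I)‖ ^ 2 ≤ 2 * ∫ y, G n y ^ 2 := fun n =>
    integrable_norm_cauchy_sq_of_support (hGm n) (R := n) (fun y hy => by
      refine indicator_of_notMem ?_ g
      rw [mem_Icc, ← abs_le, not_le]; exact hy) hη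
  refine integrable_of_tendsto_of_integral_le (u := fun n x => ‖cauchy (G n) (x + η * Complex.I)‖ ^ 2)
    (fun n => (key n).1) (fun n x => by positivity) (fun n => (key n).2.trans ?_) (fun x => ?_)
  · refine mul_le_mul_of_nonneg_left (integral_mono (hGm n).integrable_sq hg.integrable_sq
      fun y => ?_) zero_le_two
    by_cases hy : y ∈ Icc (-n : ℝ) n
    · simp [hG, indicator_of_mem hy]
    · simp [hG, indicator_of_notMem hy, sq_nonneg]
  · refine ((Tendsto.const_mul _ ?_).norm).pow 2
    have him : 0 < (x + η * Complex.I : ℂ).im := by simpa using hη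
    refine tendsto_integral_of_dominated_convergence
      (fun y : ℝ => ‖(g y : ℂ) / (x + η * Complex.I - y)‖)
      (fun n => (integrable_div_of_im_pos (hGm n) him).1)
      (integrable_div_of_im_pos hg him).norm
      (fun n => Eventually.of_forall fun y => ?_) (Eventually.of_forall fun y => ?_)
    · by_cases hy : y ∈ Icc (-n : ℝ) n
      · simp [hG, indicator_of_mem hy]
      · simp only [hG, indicator_of_notMem hy, Complex.ofReal_zero, zero_div, norm_zero]
        exact norm_nonneg _
    · refine tendsto_const_nhds.congr' ?_
      obtain ⟨N, hN⟩ := exists_nat_ge |y|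
      filter_upwards [eventually_ge_atTop N] with n hn
      have : y ∈ Icc (-n : ℝ) n := abs_le.1 (hN.trans (by exact_mod_cast hn))
      simp [hG, indicator_of_mem this]

theorem continuous_cauchy_line {f : ℝ → ℝ} (hf : MemLp f 2) {η : ℝ} (hη : 0 < η) :
    Continuous fun x : ℝ => cauchy f (x + η * Complex.I) := by
  rw [continuous_iff_continuousAt]
  intro x
  have h := (differentiableAt_cauchy_of_im_pos hf (z := x + η * Complex.I)
    (by simpa using hη)).continuousAt
  exact ContinuousAt.comp (f := fun x : ℝ => (x + η * Complex.I : ℂ)) h (by fun_prop)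

theorem memLp_cauchy_re {g : ℝ → ℝ} (hg : MemLp g 2) {η : ℝ} (hη : 0 < η) :
    MemLp (fun x : ℝ => (cauchy g (x + η * Complex.I)).re) 2 ∧
      ∫ x : ℝ, (cauchy g (x + η * Complex.I)).re ^ 2 ≤ 2 * ∫ y, g y ^ 2 := by
  have h := integrable_norm_cauchy_sq hg hη
  have hc : Continuous fun x : ℝ => (cauchy g (x + η * Complex.I)).re :=
    Complex.continuous_re.comp (continuous_cauchy_line hg hη)
  have hle : ∀ x : ℝ, (cauchy g (x + η * Complex.I)).re ^ 2 ≤ ‖cauchy g (x + η * Complex.I)‖ ^ 2 :=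
    fun x => sq_le_sq.2 (by simpa using Complex.abs_re_le_norm _)
  have hi : Integrable (fun x : ℝ => (cauchy g (x + η * Complex.I)).re ^ 2) :=
    h.1.mono' (hc.pow 2).aestronglyMeasurable (Eventually.of_forall fun x => by
      rw [Real.norm_eq_abs, abs_of_nonneg (sq_nonneg _)]; exact hle x)
  exact ⟨(memLp_two_iff_integrable_sq hc.aestronglyMeasurable).2 hi,
    (integral_mono hi h.1 hle).trans h.2⟩

/-- On horizontal lines, the derivative of the Cauchy integral is the Cauchy integral of the
derivative. -/
theorem H1Pair.cauchy_sub_cauchy {f g : ℝ → ℝ} (h : H1Pair f g) {η : ℝ} (hη : 0 < η) (a b : ℝ) :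
    cauchy f (b + η * Complex.I) - cauchy f (a + η * Complex.I)
      = ∫ x in a..b, cauchy g (x + η * Complex.I) := by
  have hK0 : ∀ u : ℝ, (u + η * Complex.I : ℂ) ≠ 0 := fun u h0 => by
    have := congrArg Complex.im h0; simp at this; exact hη.ne' this
  -- The substitution `y = x - u` moves the dependence on `x` from the kernel to the function, where
  -- `f` is the primitive of `g`.
  have hshift : ∀ (φ : ℝ → ℝ) (x : ℝ), cauchy φ (x + η * Complex.I)
      = (1 / Real.pi : ℝ) * ∫ u : ℝ, (φ (x - u) : ℂ) / (u + η * Complex.I) := by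
    intro φ x
    rw [cauchy, ← integral_sub_left_eq_self (fun y : ℝ => (φ y : ℂ) / (x + η * Complex.I - y)) volume x]
    congr 2; funext u
    push_cast
    congr 1; ring
  have hshift_int : ∀ (φ : ℝ → ℝ), MemLp φ 2 → ∀ x : ℝ,
      Integrable fun u : ℝ => (φ (x - u) : ℂ) / (u + η * Complex.I) := by
    intro φ hφ x
    have := (integrable_div_of_im_pos hφ (z := x + η * Complex.I) (by simpa using hη)).comp_sub_left x
    refine this.congr (Eventually.of_forall fun u => ?_)
    simp only
    push_cast
    congr 1; ring
  have hprod : Integrable (Function.uncurry fun (x u : ℝ) => (g (x - u) : ℂ) / (u + η * Complex.I))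
      ((volume.restrict (uIoc a b)).prod volume) := by
    have hm : AEStronglyMeasurable
        (Function.uncurry fun (x u : ℝ) => (g (x - u) : ℂ) / (u + η * Complex.I))
        ((volume.restrict (uIoc a b)).prod volume) := by
      have m1 : AEStronglyMeasurable (fun p : ℝ × ℝ => (g (p.1 - p.2) : ℂ))
          ((volume : Measure ℝ).prod volume) :=
        Complex.continuous_ofReal.comp_aestronglyMeasurable
          (h.memLp_deriv.1.comp_quasiMeasurePreserving (quasiMeasurePreserving_sub volume volume))
      have m2 := m1.mono_ac (Measure.AbsolutelyContinuous.prod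
        (Measure.restrict_le_self (s := uIoc a b)).absolutelyContinuous
        (Measure.AbsolutelyContinuous.refl volume))
      exact (m2.aemeasurable.div (by fun_prop)).aestronglyMeasurable
    rw [integrable_prod_iff hm]
    refine ⟨Eventually.of_forall fun x => hshift_int g h.memLp_deriv x, ?_⟩
    have hb : ∀ x : ℝ, ∫ u : ℝ, ‖(g (x - u) : ℂ) / (u + η * Complex.I)‖
        ≤ l2 g * √(∫ u : ℝ, ‖(u + η * Complex.I : ℂ)‖⁻¹ ^ 2) := by
      intro x
      have hmg : MemLp (fun u => g (x - u)) 2 :=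
        h.memLp_deriv.comp_measurePreserving (Measure.measurePreserving_sub_left volume x)
      have hk := integrable_sq_kernel 0 hη
      have hn : ∀ u : ℝ, ‖(u + η * Complex.I : ℂ)‖⁻¹ ^ 2 = ((0 - u) ^ 2 + η ^ 2)⁻¹ := by
        intro u
        rw [inv_pow, Complex.norm_add_mul_I, Real.sq_sqrt (by positivity)]
        congr 1; ring
      have hmk : MemLp (fun u : ℝ => ‖(u + η * Complex.I : ℂ)‖⁻¹) 2 := by
        refine (memLp_two_iff_integrable_sq ?_).2 ?_
        · exact (Continuous.inv₀ (by fun_prop) fun u => norm_ne_zero_iff.2 (hK0 u)).aestronglyMeasurable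
        · simp_rw [hn]; exact hk.1
      have := integral_abs_mul_le hmg hmk
      rw [integral_sub_left_eq_self (fun y => g y ^ 2) volume x] at this
      refine le_trans (le_of_eq ?_) this
      congr 1; funext u
      rw [norm_div, Complex.norm_real, abs_mul, abs_inv, abs_norm, div_eq_mul_inv, Real.norm_eq_abs]
    simp only [Function.uncurry]
    have : IsFiniteMeasure ((volume : Measure ℝ).restrict (uIoc a b)) := ⟨by simp [uIoc]⟩
    refine Integrable.of_bound hm.norm.integral_prod_right'
      (l2 g * √(∫ u : ℝ, ‖(u + η * Complex.I : ℂ)‖⁻¹ ^ 2)) (Eventually.of_forall fun x => ?_)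
    rw [Real.norm_eq_abs, abs_of_nonneg (integral_nonneg fun _ => norm_nonneg _)]
    exact hb x
  simp_rw [hshift]
  rw [← mul_sub, intervalIntegral.integral_const_mul, ← integral_sub (hshift_int f h.memLp b)
    (hshift_int f h.memLp a)]
  congr 1
  rw [intervalIntegral_integral_swap hprod]
  congr 1; funext u
  rw [intervalIntegral.integral_div, ← sub_div, ← Complex.ofReal_sub]
  congr 1
  rw [intervalIntegral.integral_ofReal, h.sub_eq]
  congr 1
  exact (intervalIntegral.integral_comp_sub_right (fun x => g x) u).symm

/-- Weak compactness: if the primitives of a bounded sequence in `L²` converge, then the limit has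
a derivative in `L²`. -/
theorem exists_memLp_of_tendsto {u : ℕ → ℝ → ℝ} (hu : ∀ n, MemLp (u n) 2) {M : ℝ}
    (hM : ∀ n, ∫ x, u n x ^ 2 ≤ M) {Φ : ℝ → ℝ}
    (hΦ : ∀ x y, Tendsto (fun n => ∫ t in x..y, u n t) atTop (𝓝 (Φ y - Φ x))) :
    ∃ G : ℝ → ℝ, MemLp G 2 ∧ ∀ x y, Φ y - Φ x = ∫ t in x..y, G t := by
  let U : ℕ → Lp ℝ 2 (volume : Measure ℝ) := fun n => (hu n).toLp (u n)
  let D : ℕ → WeakDual ℝ (Lp ℝ 2 (volume : Measure ℝ)) := fun n =>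
    StrongDual.toWeakDual (InnerProductSpace.toDual ℝ _ (U n))
  have hUb : ∀ n, ‖U n‖ ≤ √M := by
    intro n
    rw [Lp.norm_toLp, ← l2_eq_eLpNorm (hu n)]
    exact Real.sqrt_le_sqrt (hM n)
  have hcpt := WeakDual.isCompact_closedBall (𝕜 := ℝ)
    (0 : StrongDual ℝ (Lp ℝ 2 (volume : Measure ℝ))) (√M)
  -- An ultrafilter limit plays the role of a weakly convergent subsequence. The primitives converge
  -- along the full sequence, so the limit is the right one.
  let 𝒰 : Ultrafilter ℕ := Ultrafilter.of atTop
  obtain ⟨L, hL, hle⟩ := hcpt.ultrafilter_le_nhds (𝒰.map D) (by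
    rw [le_principal_iff]
    refine Eventually.of_forall (f := (𝒰 : Filter ℕ)) fun n => ?_
    rw [mem_preimage, mem_closedBall_zero_iff]
    exact (LinearIsometryEquiv.norm_map (InnerProductSpace.toDual ℝ _) (U n)).le.trans (hUb n))
  have hT : Tendsto D 𝒰 (𝓝 L) := hle
  let V : Lp ℝ 2 (volume : Measure ℝ) :=
    (InnerProductSpace.toDual ℝ _).symm (WeakDual.toStrongDual L)
  refine ⟨V, Lp.memLp V, ?_⟩
  have hmain : ∀ x y, x ≤ y → Φ y - Φ x = ∫ t in x..y, V t := by
    intro x y hxy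
    have hfin : volume (Ioc x y) ≠ ⊤ := by simp
    let e := indicatorConstLp 2 (measurableSet_Ioc (a := x) (b := y)) hfin (1 : ℝ)
    have h1 : Tendsto (fun n => D n e) 𝒰 (𝓝 (L e)) :=
      ((WeakDual.eval_continuous e).tendsto L).comp hT
    have h2 : ∀ n, D n e = ∫ t in x..y, u n t := by
      intro n
      change inner ℝ (U n) e = _
      rw [real_inner_comm, L2.inner_indicatorConstLp_one, intervalIntegral.integral_of_le hxy]
      refine setIntegral_congr_ae measurableSet_Ioc ?_
      filter_upwards [(hu n).coeFn_toLp] with t ht _ using ht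
    have h3 : L e = ∫ t in x..y, V t := by
      have : L e = inner ℝ V e := by
        rw [InnerProductSpace.toDual_symm_apply]; rfl
      rw [this, real_inner_comm, L2.inner_indicatorConstLp_one, intervalIntegral.integral_of_le hxy]
    simp_rw [h2] at h1
    rw [← h3]
    exact tendsto_nhds_unique ((hΦ x y).mono_left (Ultrafilter.of_le atTop)) h1
  intro x y
  rcases le_total x y with hxy | hxy
  · exact hmain x y hxy
  · rw [intervalIntegral.integral_symm, ← hmain y x hxy]; ring

/-- The Hilbert transform maps `H¹` to itself. -/
theorem H1Pair.exists_hilbert {f g : ℝ → ℝ} (h : H1Pair f g) :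
    ∃ g', H1Pair (hilbertTransform f) g' := by
  -- Real parts on the lines `Im z = 1/(n + 1)` converge pointwise to `H(f)`. Fatou's lemma puts the
  -- limit in `L²`, and weak compactness of the Cauchy integrals of `g` on the same lines provides
  -- its derivative.
  have hη : ∀ n : ℕ, (0 : ℝ) < 1 / ((n : ℝ) + 1) := fun n => Nat.one_div_pos_of_nat
  have hlim : ∀ x : ℝ, Tendsto (fun n : ℕ => (cauchy f (x + (1 / ((n : ℝ) + 1) : ℝ) * Complex.I)).re)
      atTop (𝓝 (hilbertTransform f x)) := by
    intro x
    have h0 : Tendsto (fun n : ℕ => 3 * l2 g * √(1 / ((n : ℝ) + 1))) atTop (𝓝 0) := by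
      have := (tendsto_one_div_add_atTop_nhds_zero_nat (𝕜 := ℝ)).sqrt.const_mul (3 * l2 g)
      simpa using this
    have h1 : Tendsto (fun n : ℕ => cauchy f (x + (1 / ((n : ℝ) + 1) : ℝ) * Complex.I)) atTop
        (𝓝 (boundary f x)) := by
      rw [tendsto_iff_norm_sub_tendsto_zero]
      exact squeeze_zero (fun _ => norm_nonneg _)
        (fun n => h.norm_cauchy_sub_boundary_le x (hη n)) h0
    exact (Complex.continuous_re.tendsto _).comp h1
  have hm : MemLp (hilbertTransform f) 2 := by
    have hf := integrable_of_tendsto_of_integral_le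
      (u := fun (n : ℕ) (x : ℝ) => (cauchy f (x + (1 / ((n : ℝ) + 1) : ℝ) * Complex.I)).re ^ 2)
      (fun n => (memLp_cauchy_re h.memLp (hη n)).1.integrable_sq) (fun n x => sq_nonneg _)
      (fun n => (memLp_cauchy_re h.memLp (hη n)).2) (fun x => (hlim x).pow 2)
    refine (memLp_two_iff_integrable_sq ?_).2 hf.1
    exact aestronglyMeasurable_of_tendsto_ae atTop
      (fun n => (memLp_cauchy_re h.memLp (hη n)).1.1) (Eventually.of_forall hlim)
  obtain ⟨G, hG, hGe⟩ := exists_memLp_of_tendsto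
    (u := fun (n : ℕ) (x : ℝ) => (cauchy g (x + (1 / ((n : ℝ) + 1) : ℝ) * Complex.I)).re)
    (fun n => (memLp_cauchy_re h.memLp_deriv (hη n)).1)
    (fun n => (memLp_cauchy_re h.memLp_deriv (hη n)).2) (Φ := hilbertTransform f) (fun x y => by
      refine ((hlim y).sub (hlim x)).congr fun n => ?_
      rw [← Complex.sub_re, h.cauchy_sub_cauchy (hη n)]
      have hi := (continuous_cauchy_line h.memLp_deriv (hη n)).intervalIntegrable (μ := volume) x y
      exact (intervalIntegral.intervalIntegral_re hi).symm)
  exact ⟨G, hm, hG, hGe⟩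

/-! ### The uniqueness principle and Tricomi's identity. -/

theorem isPreconnected_upperHalf : IsPreconnected {z : ℂ | 0 < z.im} :=
  (convex_halfSpace_im_gt 0).isPreconnected

theorem isOpen_upperHalf : IsOpen {z : ℂ | 0 < z.im} :=
  isOpen_lt continuous_const Complex.continuous_im

/-- Maximum principle: a bounded holomorphic function on the upper half-plane whose imaginary part
tends to zero uniformly at the boundary and which vanishes at `i∞` is zero. -/
theorem eq_zero_of_im_boundary {K : ℂ → ℂ} (hd : DifferentiableOn ℂ K {z | 0 < z.im}) {M : ℝ}
    (hM : ∀ z : ℂ, 0 < z.im → ‖K z‖ ≤ M)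
    (h0 : Tendsto (fun η : ℝ => K (η * Complex.I)) atTop (𝓝 0))
    (hb : ∀ ε > 0, ∀ᶠ η : ℝ in 𝓝[>] 0, ∀ x : ℝ, |(K (x + η * Complex.I)).im| ≤ ε) {z : ℂ}
    (hz : 0 < z.im) : K z = 0 := by
  -- Exponentiating turns control of the imaginary part alone into control of a modulus; both signs
  -- of `l` are used.
  have hnorm : ∀ (l : ℝ) (w : ℂ), ‖Complex.exp (Complex.I * l * K w)‖ = Real.exp (-l * (K w).im) := by
    intro l w
    rw [Complex.norm_exp]
    congr 1
    simp [mul_assoc]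
  have step : ∀ (l : ℝ) (z : ℂ), 0 < z.im → Real.exp (-l * (K z).im) ≤ 1 := by
    intro l z hz
    have hall : ∀ ε > 0, Real.exp (-l * (K z).im) ≤ Real.exp (|l| * ε) := by
      intro ε hε
      obtain ⟨η, h1, hη⟩ := ((hb ε hε).and (Ioo_mem_nhdsGT hz)).exists
      -- The half-plane above height `η` is rotated to the right half-plane, the setting of the
      -- Phragmén–Lindelöf theorem. Staying at height `η` avoids needing an extension of `K` to the
      -- boundary.
      set ψ : ℂ → ℂ := fun w => Complex.exp (Complex.I * l * K (Complex.I * w + η * Complex.I)) with hψ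
      have him : ∀ w : ℂ, (Complex.I * w + η * Complex.I).im = w.re + η := fun w => by simp
      have hdiff : DiffContOnCl ℂ ψ {w | 0 < w.re} := by
        apply DifferentiableOn.diffContOnCl
        rw [Complex.closure_setOfPred_lt_re]
        intro w hw
        have hw' : 0 < (Complex.I * w + η * Complex.I).im := by
          rw [him]; exact add_pos_of_nonneg_of_pos hw hη.1
        have hK : DifferentiableAt ℂ K (Complex.I * w + η * Complex.I) :=
          (hd _ hw').differentiableAt (isOpen_upperHalf.mem_nhds hw')
        have h2 : DifferentiableAt ℂ (fun w : ℂ => K (Complex.I * w + η * Complex.I)) w :=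
          hK.comp w (f := fun w : ℂ => Complex.I * w + η * Complex.I) (by fun_prop)
        exact (h2.const_mul (Complex.I * l)).cexp.differentiableWithinAt
      have hψb : ∀ w : ℂ, 0 ≤ w.re → ‖ψ w‖ ≤ Real.exp (|l| * M) := by
        intro w hw
        have hw' : 0 < (Complex.I * w + η * Complex.I).im := by
          rw [him]; exact add_pos_of_nonneg_of_pos hw hη.1
        simp only [hψ, hnorm]
        refine Real.exp_le_exp.2 ((le_abs_self _).trans ?_)
        rw [abs_mul, abs_neg]
        exact mul_le_mul_of_nonneg_left ((Complex.abs_im_le_norm _).trans (hM _ hw')) (abs_nonneg _)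
      have hres := PhragmenLindelof.right_half_plane_of_bounded_on_real (C := Real.exp (|l| * ε))
        hdiff ⟨1, by norm_num, 0, ?_⟩ ?_ ?_ (z := -Complex.I * (z - η * Complex.I)) ?_
      · have e : Complex.I * (-Complex.I * (z - η * Complex.I)) + η * Complex.I = z := by
          linear_combination (-(z - η * Complex.I)) * Complex.I_sq
        simp only [hψ, e, hnorm] at hres
        exact hres
      · refine Asymptotics.IsBigO.of_bound (Real.exp (|l| * M)) ?_
        refine eventually_inf_principal.2 (Eventually.of_forall fun w hw => ?_)
        simpa using hψb w (le_of_lt hw)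
      · refine isBoundedUnder_of_eventually_le (a := Real.exp (|l| * M)) ?_
        filter_upwards [eventually_ge_atTop 0] with x hx
        exact hψb x (by simpa using hx)
      · intro x
        have e : Complex.I * (x * Complex.I) + η * Complex.I = ((-x : ℝ) : ℂ) + η * Complex.I := by
          push_cast; linear_combination (x : ℂ) * Complex.I_sq
        simp only [hψ, e, hnorm]
        refine Real.exp_le_exp.2 ((le_abs_self _).trans ?_)
        rw [abs_mul, abs_neg]
        exact mul_le_mul_of_nonneg_left (h1 (-x)) (abs_nonneg _)
      · simpa using hη.2.le
    have hlim : Tendsto (fun ε : ℝ => Real.exp (|l| * ε)) (𝓝[>] 0) (𝓝 (Real.exp (|l| * 0))) :=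
      (Continuous.tendsto (by fun_prop) 0).mono_left nhdsWithin_le_nhds
    rw [mul_zero, Real.exp_zero] at hlim
    refine ge_of_tendsto hlim ?_
    filter_upwards [self_mem_nhdsWithin] with ε hε using hall ε hε
  have him0 : ∀ z : ℂ, 0 < z.im → (K z).im = 0 := by
    intro z hz
    have h1 := step 1 z hz
    have h2 := step (-1) z hz
    rw [Real.exp_le_one_iff] at h1 h2
    linarith
  -- The function has constant modulus, hence is constant by the maximum modulus principle, and its
  -- limit at `i∞` is `exp 0`.
  have hone : ∀ l : ℝ, Complex.exp (Complex.I * l * K z) = 1 := by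
    intro l
    have hdl : DifferentiableOn ℂ (fun w => Complex.exp (Complex.I * l * K w)) {z | 0 < z.im} :=
      (hd.const_mul (Complex.I * l)).cexp
    have hconst := Complex.eqOn_of_isPreconnected_of_isMaxOn_norm isPreconnected_upperHalf
      isOpen_upperHalf hdl hz (fun w hw => by
        simp only [Function.comp_apply, mem_ofPred_eq, hnorm, him0 w hw, him0 z hz]
        exact le_rfl)
    have h1 : Tendsto (fun η : ℝ => Complex.exp (Complex.I * l * K (η * Complex.I))) atTop
        (𝓝 (Complex.exp (Complex.I * l * 0))) :=
      (Complex.continuous_exp.tendsto _).comp (h0.const_mul _)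
    rw [mul_zero, Complex.exp_zero] at h1
    refine tendsto_nhds_unique (tendsto_const_nhds.congr' ?_) h1
    filter_upwards [eventually_gt_atTop 0] with η hη
    exact (hconst (show 0 < (η * Complex.I : ℂ).im by simpa using hη)).symm
  have hre : K z = ((K z).re : ℂ) := Complex.ext (by simp) (by simpa using him0 z hz)
  by_contra hne
  have hk : (K z).re ≠ 0 := fun h => hne (by rw [hre, h]; simp)
  -- For this `l` the exponential equals `exp(iπ) = -1`, contradicting the value `1`.
  have h1 := hone (Real.pi / (K z).re)
  have e : Complex.I * ((Real.pi / (K z).re : ℝ) : ℂ) * K z = Real.pi * Complex.I := by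
    rw [hre]
    have : ((K z).re : ℂ) ≠ 0 := by exact_mod_cast hk
    push_cast
    simp only [Complex.ofReal_re]
    field_simp
  rw [e, Complex.exp_pi_mul_I] at h1
  norm_num at h1

/-- A bounded holomorphic function on the upper half-plane is the Cauchy integral of its
imaginary boundary values. -/
theorem eq_cauchy_of_im_boundary {G : ℂ → ℂ} {w w' : ℝ → ℝ} (hw : H1Pair w w')
    (hd : DifferentiableOn ℂ G {z | 0 < z.im}) {M : ℝ} (hM : ∀ z : ℂ, 0 < z.im → ‖G z‖ ≤ M)
    (h0 : Tendsto (fun η : ℝ => G (η * Complex.I)) atTop (𝓝 0))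
    (hb : ∀ ε > 0, ∀ᶠ η : ℝ in 𝓝[>] 0, ∀ x : ℝ, |(G (x + η * Complex.I)).im + w x| ≤ ε) {z : ℂ}
    (hz : 0 < z.im) : G z = cauchy w z := by
  rw [← sub_eq_zero]
  refine eq_zero_of_im_boundary (K := fun z => G z - cauchy w z) (M := M + (l2 w + 6 * l2 w')) ?_
    (fun z hz => ?_) ?_ ?_ hz
  · exact hd.sub fun z hz => (differentiableAt_cauchy_of_im_pos hw.memLp hz).differentiableWithinAt
  · exact (norm_sub_le _ _).trans (add_le_add (hM z hz) (hw.norm_cauchy_le_of_im_pos hz))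
  · have h1 : Tendsto (fun η : ℝ => cauchy w (η * Complex.I)) atTop (𝓝 0) := by
      have h2 : Tendsto (fun η : ℝ => l2 w / √η) atTop (𝓝 0) :=
        Tendsto.const_div_atTop Real.tendsto_sqrt_atTop _
      refine squeeze_zero_norm' ?_ h2
      filter_upwards [eventually_gt_atTop 0] with η hη
      have := norm_cauchy_le hw.memLp (z := η * Complex.I) (by simpa using hη)
      simpa using this
    simpa using h0.sub h1
  · intro ε hε
    have hlim : Tendsto (fun η : ℝ => 3 * l2 w' * √η) (𝓝[>] 0) (𝓝 (3 * l2 w' * √0)) :=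
      (Continuous.tendsto (by fun_prop) 0).mono_left nhdsWithin_le_nhds
    rw [Real.sqrt_zero, mul_zero] at hlim
    filter_upwards [hb (ε / 2) (half_pos hε), hlim.eventually (ge_mem_nhds (half_pos hε)),
      self_mem_nhdsWithin] with η h1 h2 h3 x
    have h4 := (Complex.abs_im_le_norm _).trans (hw.norm_cauchy_sub_boundary_le x h3)
    simp only [Complex.sub_im, boundary_im, sub_neg_eq_add] at h4 ⊢
    have h5 := h1 x
    have e : (G (x + η * Complex.I)).im - (cauchy w (x + η * Complex.I)).im
        = ((G (x + η * Complex.I)).im + w x) - ((cauchy w (x + η * Complex.I)).im + w x) := by ring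
    rw [e]
    exact (abs_sub _ _).trans (by linarith)

theorem H1Pair.tendsto_cauchy {f g : ℝ → ℝ} (h : H1Pair f g) (x : ℝ) :
    Tendsto (fun η : ℝ => cauchy f (x + η * Complex.I)) (𝓝[>] 0) (𝓝 (boundary f x)) := by
  have hlim : Tendsto (fun η : ℝ => 3 * l2 g * √η) (𝓝[>] 0) (𝓝 (3 * l2 g * √0)) :=
    (Continuous.tendsto (by fun_prop) 0).mono_left nhdsWithin_le_nhds
  rw [Real.sqrt_zero, mul_zero] at hlim
  rw [tendsto_iff_norm_sub_tendsto_zero]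
  refine squeeze_zero' (Eventually.of_forall fun _ => norm_nonneg _) ?_ hlim
  filter_upwards [self_mem_nhdsWithin] with η hη using h.norm_cauchy_sub_boundary_le x hη

/-- If the Cauchy integral agrees with `G`, the boundary values are the limits of `G`. -/
theorem H1Pair.boundary_eq {f g : ℝ → ℝ} (h : H1Pair f g) {G : ℂ → ℂ}
    (hG : ∀ z : ℂ, 0 < z.im → G z = cauchy f z) {x : ℝ} {b : ℂ}
    (hb : Tendsto (fun η : ℝ => G (x + η * Complex.I)) (𝓝[>] 0) (𝓝 b)) : boundary f x = b := by
  refine tendsto_nhds_unique (h.tendsto_cauchy x) (hb.congr' ?_)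
  filter_upwards [self_mem_nhdsWithin] with η hη
  exact hG _ (by simpa using hη)

theorem H1Pair.abs_hilbert_le {f g : ℝ → ℝ} (h : H1Pair f g) (x : ℝ) :
    |hilbertTransform f x| ≤ l2 f + 3 * l2 g :=
  (Complex.abs_re_le_norm (boundary f x)).trans (h.norm_boundary_le x)

/-- The product of an `H¹` function with its Hilbert transform is in `H¹`. -/
theorem H1Pair.exists_mul_hilbert {f g : ℝ → ℝ} (h : H1Pair f g) :
    ∃ w', H1Pair (fun x => f x * hilbertTransform f x) w' := by
  obtain ⟨g', hg'⟩ := h.exists_hilbert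
  have := l2_nonneg g
  exact ⟨_, h.mul hg' (M := l2 f + 3 * l2 g) (fun x => (h.abs_le x).trans (by linarith))
    h.abs_hilbert_le⟩

/-- Tricomi's identity. -/
theorem H1Pair.cauchy_mul_hilbert {f g : ℝ → ℝ} (h : H1Pair f g) {z : ℂ} (hz : 0 < z.im) :
    cauchy (fun x => f x * hilbertTransform f x) z = cauchy f z ^ 2 / 2 := by
  obtain ⟨w', hw⟩ := h.exists_mul_hilbert
  set M := l2 f + 6 * l2 g with hMdef
  have hg := l2_nonneg g
  have hf := l2_nonneg f
  have hM0 : 0 ≤ M := by positivity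
  symm
  refine eq_cauchy_of_im_boundary (G := fun z => cauchy f z ^ 2 / 2) hw (M := M ^ 2 / 2) ?_ ?_ ?_ ?_ hz
  · exact DifferentiableOn.div_const (DifferentiableOn.pow (fun z hz =>
      (differentiableAt_cauchy_of_im_pos h.memLp hz).differentiableWithinAt) 2) 2
  · intro z hz
    rw [norm_div, norm_pow, Complex.norm_two]
    have := h.norm_cauchy_le_of_im_pos hz
    gcongr
  · have h2 : Tendsto (fun η : ℝ => l2 f / √η) atTop (𝓝 0) :=
      Tendsto.const_div_atTop Real.tendsto_sqrt_atTop _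
    have h1 : Tendsto (fun η : ℝ => cauchy f (η * Complex.I)) atTop (𝓝 0) := by
      refine squeeze_zero_norm' ?_ h2
      filter_upwards [eventually_gt_atTop 0] with η hη
      have := norm_cauchy_le h.memLp (z := η * Complex.I) (by simpa using hη)
      simpa using this
    simpa using (h1.pow 2).div_const 2
  · intro ε hε
    have hlim : Tendsto (fun η : ℝ => 3 * l2 g * √η * M) (𝓝[>] 0) (𝓝 (3 * l2 g * √0 * M)) :=
      (Continuous.tendsto (by fun_prop) 0).mono_left nhdsWithin_le_nhds
    rw [Real.sqrt_zero, mul_zero, zero_mul] at hlim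
    filter_upwards [hlim.eventually (ge_mem_nhds hε), self_mem_nhdsWithin] with η h2 h3 x
    have h3' : (0 : ℝ) < η := h3
    have h4 := h.norm_cauchy_sub_boundary_le x h3
    set F := cauchy f (x + η * Complex.I) with hF
    have h5 : ‖F‖ ≤ M := h.norm_cauchy_le_of_im_pos (by simpa using h3')
    have h6 : ‖boundary f x‖ ≤ M := (h.norm_boundary_le x).trans (by linarith)
    -- The boundary value `(H(f) - if)²/2` has imaginary part `-f H(f)`; factoring the difference of
    -- squares leaves one small and one bounded factor.
    have e : (F ^ 2 / 2).im + f x * hilbertTransform f x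
        = ((F - boundary f x) * (F + boundary f x) / 2).im := by
      have e1 : (F - boundary f x) * (F + boundary f x) / 2 = F ^ 2 / 2 - boundary f x ^ 2 / 2 := by ring
      have e2 : (boundary f x ^ 2 / 2).im = -(f x * hilbertTransform f x) := by
        rw [pow_two, Complex.div_ofNat_im, Complex.mul_im]
        simp; ring
      rw [e1, Complex.sub_im, e2]; ring
    rw [e]
    refine (Complex.abs_im_le_norm _).trans ?_
    rw [norm_div, norm_mul, Complex.norm_two]
    have h7 : ‖F + boundary f x‖ ≤ 2 * M := (norm_add_le _ _).trans (by linarith)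
    have h8 : ‖F - boundary f x‖ * ‖F + boundary f x‖ ≤ (3 * l2 g * √η) * (2 * M) := by gcongr
    linarith

/-! ### Every solution is given by the explicit formula. -/

theorem l2_le_add {u v : ℝ → ℝ} (hu : MemLp u 2) (hv : MemLp v 2) :
    l2 u ≤ l2 v + (eLpNorm (u - v) 2 volume).toReal := by
  rw [l2_eq_eLpNorm hu, l2_eq_eLpNorm hv, ← ENNReal.toReal_add hv.2.ne (hu.sub hv).2.ne]
  refine ENNReal.toReal_mono (ENNReal.add_ne_top.2 ⟨hv.2.ne, (hu.sub hv).2.ne⟩) ?_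
  have := eLpNorm_add_le (p := 2) (μ := volume) hv.1 (hu.sub hv).1 (by norm_num)
  rwa [add_sub_cancel] at this

theorem Ico_mem_nhdsWithin_Ici {T t : ℝ} (ht : t ∈ Ico 0 T) : Ico 0 T ∈ 𝓝[Ici t] t :=
  mem_of_superset (Ico_mem_nhdsGE ht.2) (Ico_subset_Ico_left ht.1)

/-- Compactness of the time interval makes the `H¹` norms locally uniformly bounded. The combination
with the factor `3` is the one that dominates `|H(ω)|` in `H1Pair.abs_hilbert_le`. -/
theorem ContinuousIntoH1.exists_pairs {T : ℝ} {ω : ℝ → ℝ → ℝ}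
    (h : ContinuousIntoH1 (Ico 0 T) ω) :
    ∃ ω' : ℝ → ℝ → ℝ, (∀ t ∈ Ico 0 T, H1Pair (ω t) (ω' t)) ∧
      ∀ t₁ < T, ∃ M, 0 ≤ M ∧ ∀ t ∈ Icc 0 t₁, l2 (ω t) + 3 * l2 (ω' t) ≤ M := by
  obtain ⟨h1, ω', h2, h3⟩ := h
  have hp : ∀ t ∈ Ico 0 T, H1Pair (ω t) (ω' t) := fun t ht =>
    H1Pair.of_hasWeakDeriv (h1 t ht).1 (h1 t ht).2.1 (h2 t ht).1 (h2 t ht).2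
  refine ⟨ω', hp, fun t₁ ht₁ => ?_⟩
  have hsub : Icc 0 t₁ ⊆ Ico 0 T := fun s hs => ⟨hs.1, hs.2.trans_lt ht₁⟩
  obtain ⟨M, hM⟩ : ∃ M, ∀ t ∈ Icc 0 t₁, l2 (ω t) + 3 * l2 (ω' t) ≤ M := by
    refine isCompact_Icc.induction_on (p := fun S => ∃ M, ∀ t ∈ S, l2 (ω t) + 3 * l2 (ω' t) ≤ M)
      ⟨0, fun t ht => ht.elim⟩ (fun s t hst ⟨M, hM⟩ => ⟨M, fun x hx => hM x (hst hx)⟩)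
      (fun s t ⟨M, hM⟩ ⟨N, hN⟩ => ⟨max M N, fun x hx => hx.elim
        (fun h => (hM x h).trans (le_max_left _ _)) (fun h => (hN x h).trans (le_max_right _ _))⟩) ?_
    intro t ht
    have h4 := (h3 t (hsub ht)).mono_left (nhdsWithin_mono t hsub)
    have h5 := h4.eventually (gt_mem_nhds one_pos)
    refine ⟨_, inter_mem h5 self_mem_nhdsWithin, l2 (ω t) + 3 * l2 (ω' t) + 4, fun s hs => ?_⟩
    obtain ⟨hs1, hs2⟩ := hs
    have ps := hp s (hsub hs2)
    have pt := hp t (hsub ht)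
    have a1 : (eLpNorm (ω s - ω t) 2 volume).toReal ≤ 1 :=
      ENNReal.toReal_le_of_le_ofReal zero_le_one
        (by simpa using (le_self_add).trans (le_of_lt hs1))
    have a2 : (eLpNorm (ω' s - ω' t) 2 volume).toReal ≤ 1 :=
      ENNReal.toReal_le_of_le_ofReal zero_le_one
        (by simpa using (le_add_self).trans (le_of_lt hs1))
    have := l2_le_add ps.memLp pt.memLp
    have := l2_le_add ps.memLp_deriv pt.memLp_deriv
    linarith
  exact ⟨max M 0, le_max_right _ _, fun t ht => (hM t ht).trans (le_max_left _ _)⟩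

/-- Solutions are dominated by a multiple of the initial value, locally uniformly in time. -/
theorem IsSolution.exists_bounds {f : ℝ → ℝ} {T : ℝ} {ω : ℝ → ℝ → ℝ} (hs : IsSolution f T ω)
    {t₁ : ℝ} (ht₁ : t₁ < T) :
    ∃ C, 0 ≤ C ∧ (∀ t ∈ Icc 0 t₁, l2 (ω t) ≤ C) ∧
      ∀ s ∈ Icc 0 t₁, ∀ t ∈ Icc 0 t₁, t ≤ s → ∀ y, |ω s y - ω t y| ≤ C * |f y| * (s - t) := by
  obtain ⟨ω', hp, hM⟩ := hs.continuousInto.exists_pairs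
  obtain ⟨M, hM0, hM⟩ := hM t₁ ht₁
  have hsub : Icc 0 t₁ ⊆ Ico 0 T := fun s hs => ⟨hs.1, hs.2.trans_lt ht₁⟩
  have hder : ∀ t ∈ Ico 0 T, ∀ y, HasDerivWithinAt (fun s => ω s y)
      (ω t y * hilbertTransform (ω t) y) (Ico 0 T) t := by
    intro t ht y
    obtain ⟨h, h1, h2⟩ := hs.equation t ht y
    rwa [h1.hilbertTransform_eq]
  have hcont : ∀ y, ContinuousOn (fun s => ω s y) (Icc 0 t₁) := fun y t ht =>
    ((hder t (hsub ht) y).continuousWithinAt).mono hsub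
  have hH : ∀ t ∈ Icc 0 t₁, ∀ y, |hilbertTransform (ω t) y| ≤ M := fun t ht y =>
    ((hp t (hsub ht)).abs_hilbert_le y).trans (hM t ht)
  have hder' : ∀ t ∈ Icc 0 t₁, ∀ y, HasDerivWithinAt (fun s => ω s y)
      (ω t y * hilbertTransform (ω t) y) (Ici t) t := fun t ht y =>
    (hder t (hsub ht) y).mono_of_mem_nhdsWithin (Ico_mem_nhdsWithin_Ici (hsub ht))
  -- At fixed `y` the equation is a scalar linear one with coefficient bounded by `M`. Grönwall's
  -- inequality makes `|f|` a majorant in `y`, which later permits differentiation under the Cauchy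
  -- integral.
  have hgr : ∀ y, ∀ t ∈ Icc 0 t₁, |ω t y| ≤ |f y| * Real.exp (M * t₁) := by
    intro y t ht
    have := norm_le_gronwallBound_of_norm_deriv_right_le (f := fun s => ω s y)
      (f' := fun t => ω t y * hilbertTransform (ω t) y) (δ := |f y|) (K := M) (ε := 0)
      (hcont y) (fun x hx => hder' x (Ico_subset_Icc_self hx) y) (by simp [hs.initial])
      (fun x hx => by
        rw [norm_mul, add_zero, mul_comm]
        exact mul_le_mul_of_nonneg_right (hH x (Ico_subset_Icc_self hx) y) (norm_nonneg _)) t ht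
    rw [gronwallBound_ε0, sub_zero, Real.norm_eq_abs] at this
    refine this.trans ?_
    have := ht.2
    gcongr
  refine ⟨M + Real.exp (M * t₁) * M, by positivity, fun t ht => ?_, ?_⟩
  · have := hM t ht
    have := l2_nonneg (ω' t)
    have : 0 ≤ Real.exp (M * t₁) * M := by positivity
    linarith
  · intro s hs' t ht hts y
    have hss : Icc t s ⊆ Icc 0 t₁ := Icc_subset_Icc ht.1 hs'.2
    have := norm_image_sub_le_of_norm_deriv_right_le_segment (f := fun s => ω s y)
      (f' := fun t => ω t y * hilbertTransform (ω t) y) (C := |f y| * Real.exp (M * t₁) * M)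
      ((hcont y).mono hss) (fun x hx => hder' x (hss (Ico_subset_Icc_self hx)) y)
      (fun x hx => by
        rw [norm_mul]
        have h1 := hgr y x (hss (Ico_subset_Icc_self hx))
        have h2 := hH x (hss (Ico_subset_Icc_self hx)) y
        exact mul_le_mul h1 h2 (norm_nonneg _) (by positivity)) s (right_mem_Icc.2 hts)
    rw [Real.norm_eq_abs] at this
    refine this.trans (mul_le_mul_of_nonneg_right ?_ (sub_nonneg.2 hts))
    nlinarith [mul_nonneg hM0 (abs_nonneg (f y))]

/-- The Cauchy integral of a solution satisfies `F_t = F² / 2`. -/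
theorem IsSolution.hasDerivWithinAt_cauchy {f : ℝ → ℝ} {T : ℝ} {ω : ℝ → ℝ → ℝ}
    (hs : IsSolution f T ω) (hf : MemLp f 2) {z : ℂ} (hz : 0 < z.im) {t : ℝ} (ht : t ∈ Ico 0 T) :
    HasDerivWithinAt (fun s => cauchy (ω s) z) (cauchy (ω t) z ^ 2 / 2) (Ici t) t := by
  obtain ⟨ω', hp, -⟩ := hs.continuousInto.exists_pairs
  obtain ⟨t₁, htt₁, ht₁⟩ := exists_between ht.2
  obtain ⟨C, hC0, -, hC⟩ := hs.exists_bounds ht₁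
  -- By Tricomi's identity the claimed derivative is the Cauchy integral of `ω H(ω)`, the pointwise
  -- limit of the difference quotients; dominated convergence concludes.
  rw [← (hp t ht).cauchy_mul_hilbert hz, ← hasDerivWithinAt_Ioi_iff_Ici,
    hasDerivWithinAt_iff_tendsto_slope' self_notMem_Ioi]
  have hnear : Ioc t t₁ ∈ 𝓝[>] t := Ioc_mem_nhdsGT htt₁
  have hmem : ∀ s ∈ Ioc t t₁, s ∈ Ico 0 T := fun s hs' => ⟨ht.1.trans hs'.1.le, hs'.2.trans_lt ht₁⟩
  have hslope : ∀ s ∈ Ioc t t₁, (1 / Real.pi : ℝ) * ∫ y : ℝ, (((ω s y - ω t y) / (s - t) : ℝ) : ℂ) / (z - y)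
      = slope (fun s => cauchy (ω s) z) t s := by
    intro s hs'
    rw [slope_def_module, cauchy, cauchy, ← mul_sub, ← integral_sub
      (integrable_div_of_im_pos (hp s (hmem s hs')).memLp hz)
      (integrable_div_of_im_pos (hp t ht).memLp hz), ← mul_smul_comm, ← integral_smul]
    congr 2; funext y
    rw [Complex.real_smul]
    push_cast
    ring
  refine Tendsto.congr' (f₁ := fun s => (1 / Real.pi : ℝ) * ∫ y : ℝ,
    (((ω s y - ω t y) / (s - t) : ℝ) : ℂ) / (z - y)) ?_ ?_
  · filter_upwards [hnear] with s hs' using hslope s hs'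
  · refine Tendsto.const_mul _ ?_
    refine tendsto_integral_filter_of_dominated_convergence
      (fun y : ℝ => C * ‖(f y : ℂ) / (z - y)‖) ?_ ?_
      ((integrable_div_of_im_pos hf hz).norm.const_mul C) (Eventually.of_forall fun y => ?_)
    · filter_upwards [hnear] with s hs'
      have hm : MemLp (fun y => (ω s y - ω t y) / (s - t)) 2 := by
        have := ((hp s (hmem s hs')).memLp.sub (hp t ht).memLp).const_mul (s - t)⁻¹
        simpa [div_eq_inv_mul] using this
      exact (integrable_div_of_im_pos hm hz).1
    · filter_upwards [hnear] with s hs'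
      refine Eventually.of_forall fun y => ?_
      have h1 := hC s ⟨ht.1.trans hs'.1.le, hs'.2⟩ t ⟨ht.1, htt₁.le⟩ hs'.1.le y
      have hpos : 0 < s - t := sub_pos.2 hs'.1
      rw [norm_div, norm_div, Complex.norm_real, Complex.norm_real, ← mul_div_assoc]
      refine div_le_div_of_nonneg_right ?_ (norm_nonneg _)
      rw [Real.norm_eq_abs, abs_div, abs_of_pos hpos, div_le_iff₀ hpos, Real.norm_eq_abs]
      exact h1
    · obtain ⟨h, h1, h2⟩ := hs.equation t ht y
      have h3 := (h2.mono_of_mem_nhdsWithin (Ico_mem_nhdsWithin_Ici ht)).Ioi_of_Ici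
      rw [hasDerivWithinAt_iff_tendsto_slope' self_notMem_Ioi] at h3
      have h4 := ((Complex.continuous_ofReal.tendsto _).comp h3).div_const (z - y)
      rw [← h1.hilbertTransform_eq] at h4
      refine h4.congr fun s => ?_
      simp [slope_def_field]

/-- Every solution is given by the explicit formula. -/
theorem IsSolution.cauchy_mul {f g : ℝ → ℝ} (hf : H1Pair f g) {T : ℝ} {ω : ℝ → ℝ → ℝ}
    (hs : IsSolution f T ω) {z : ℂ} (hz : 0 < z.im) {t : ℝ} (ht : t ∈ Ico 0 T) :
    cauchy (ω t) z * (1 - t * cauchy f z / 2) = cauchy f z := by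
  obtain ⟨ω', hp, -⟩ := hs.continuousInto.exists_pairs
  obtain ⟨C, hC0, hC1, hC⟩ := hs.exists_bounds ht.2
  have hsub : Icc 0 t ⊆ Ico 0 T := fun s hs => ⟨hs.1, hs.2.trans_lt ht.2⟩
  set F : ℝ → ℂ := fun s => cauchy (ω s) z with hF
  -- This defect satisfies the linear equation `e' = (F/2) e` with `e(0) = 0`, so it vanishes by
  -- Grönwall. No lower bound on the denominator is needed.
  set e : ℝ → ℂ := fun s => F s * (1 - s * cauchy f z / 2) - cauchy f z with he
  have hlip : ∀ s ∈ Icc 0 t, ∀ s' ∈ Icc 0 t, s' ≤ s → ‖F s - F s'‖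
      ≤ (∫ y : ℝ, C * ‖(f y : ℂ) / (z - y)‖) * |s - s'| := by
    intro s hs s' hs' hle
    simp only [hF]
    rw [cauchy, cauchy, ← mul_sub, ← integral_sub
      (integrable_div_of_im_pos (hp s (hsub hs)).memLp hz)
      (integrable_div_of_im_pos (hp s' (hsub hs')).memLp hz), norm_mul, Complex.norm_real,
      Real.norm_eq_abs, abs_of_pos (by positivity), ← integral_mul_const]
    have h1 : ‖∫ y : ℝ, ((ω s y : ℂ) / (z - y) - (ω s' y : ℂ) / (z - y))‖
        ≤ ∫ y : ℝ, C * ‖(f y : ℂ) / (z - y)‖ * |s - s'| := by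
      refine norm_integral_le_of_norm_le
        (((integrable_div_of_im_pos hf.memLp hz).norm.const_mul C).mul_const _)
        (Eventually.of_forall fun y => ?_)
      rw [← sub_div, ← Complex.ofReal_sub, norm_div, norm_div, Complex.norm_real, Complex.norm_real,
        ← mul_div_assoc, div_mul_eq_mul_div, abs_of_nonneg (sub_nonneg.2 hle)]
      exact div_le_div_of_nonneg_right (hC s hs s' hs' hle y) (norm_nonneg _)
    have h2 : 1 / Real.pi ≤ 1 := by
      rw [div_le_one Real.pi_pos]; linarith [Real.pi_gt_three]
    exact (mul_le_mul h2 h1 (norm_nonneg _) zero_le_one).trans (one_mul _).le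
  have hFc : ContinuousOn F (Icc 0 t) := by
    intro s hs
    rw [ContinuousWithinAt, tendsto_iff_norm_sub_tendsto_zero]
    have h0 : Tendsto (fun s' : ℝ => (∫ y : ℝ, C * ‖(f y : ℂ) / (z - y)‖) * |s' - s|)
        (𝓝[Icc 0 t] s) (𝓝 ((∫ y : ℝ, C * ‖(f y : ℂ) / (z - y)‖) * |s - s|)) :=
      (Continuous.tendsto (by fun_prop) s).mono_left nhdsWithin_le_nhds
    rw [sub_self, abs_zero, mul_zero] at h0
    refine squeeze_zero' (Eventually.of_forall fun _ => norm_nonneg _) ?_ h0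
    filter_upwards [self_mem_nhdsWithin] with s' hs'
    rcases le_total s s' with h | h
    · exact hlip s' hs' s hs h
    · rw [norm_sub_rev, abs_sub_comm]
      exact hlip s hs s' hs' h
  have hec : ContinuousOn e (Icc 0 t) := by
    refine (hFc.mul (Continuous.continuousOn ?_)).sub continuousOn_const
    fun_prop
  have hed : ∀ s ∈ Ico 0 t, HasDerivWithinAt e (F s / 2 * e s) (Ici s) s := by
    intro s hs'
    have h1 := hs.hasDerivWithinAt_cauchy hf.memLp hz (hsub (Ico_subset_Icc_self hs'))
    have h2 : HasDerivAt (fun s : ℝ => (1 - s * cauchy f z / 2 : ℂ)) (-(cauchy f z / 2)) s := by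
      have := (((hasDerivAt_id s).ofReal_comp.mul_const (cauchy f z)).div_const 2).const_sub 1
      simpa using this
    refine ((h1.mul h2.hasDerivWithinAt).sub_const (cauchy f z)).congr_deriv ?_
    simp only [he, hF]
    ring
  have hFb : ∀ s ∈ Icc 0 t, ‖F s‖ ≤ C / √z.im := fun s hs =>
    (norm_cauchy_le (hp s (hsub hs)).memLp hz).trans
      (div_le_div_of_nonneg_right (hC1 s hs) (Real.sqrt_nonneg _))
  have hfin := norm_le_gronwallBound_of_norm_deriv_right_le (δ := 0) (K := C / √z.im / 2) (ε := 0)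
    hec hed (by simp [he, hF, hs.initial]) (fun s hs => by
      rw [norm_mul, norm_div, Complex.norm_two, add_zero]
      have := hFb s (Ico_subset_Icc_self hs)
      gcongr) t (right_mem_Icc.2 ht.1)
  rw [gronwallBound_ε0, zero_mul, norm_le_zero_iff] at hfin
  exact sub_eq_zero.1 hfin

theorem IsSolution.boundary_mul {f g : ℝ → ℝ} (hf : H1Pair f g) {T : ℝ} {ω : ℝ → ℝ → ℝ}
    (hs : IsSolution f T ω) {t : ℝ} (ht : t ∈ Ico 0 T) (x : ℝ) :
    boundary (ω t) x * (1 - t * boundary f x / 2) = boundary f x := by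
  obtain ⟨ω', hp, -⟩ := hs.continuousInto.exists_pairs
  have h1 := (hp t ht).tendsto_cauchy x
  have h2 := hf.tendsto_cauchy x
  refine tendsto_nhds_unique ((h1.mul (((h2.const_mul (t : ℂ)).div_const 2).const_sub 1)).congr' ?_) h2
  filter_upwards [self_mem_nhdsWithin] with η hη
  exact hs.cauchy_mul hf (by simpa using hη) ht

/-! ### The explicit formula gives a solution. -/

/-- `1 - t Z / 2` is bounded below on the closed upper half-plane, locally uniformly in time. -/
def Nonvanishing (f : ℝ → ℝ) (T : ℝ) : Prop :=
  ∀ t₁ ∈ Ico 0 T, ∃ κ > 0, ∀ t ∈ Icc 0 t₁, (∀ z : ℂ, 0 < z.im → κ ≤ ‖1 - t * cauchy f z / 2‖) ∧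
    ∀ x : ℝ, κ ≤ ‖1 - t * boundary f x / 2‖

/-- The explicit solution of the equation with boundary values `Z / (1 - t Z / 2)`. -/
noncomputable def evolved (f : ℝ → ℝ) (t x : ℝ) : ℂ :=
  boundary f x / (1 - t * boundary f x / 2)

theorem abs_neg_im_sub_le (z w : ℂ) : |-z.im - -w.im| ≤ ‖z - w‖ := by
  rw [show -z.im - -w.im = -(z - w).im by rw [Complex.sub_im]; ring, abs_neg]
  exact Complex.abs_im_le_norm _

theorem boundary_eq_ofReal (f : ℝ → ℝ) (x : ℝ) :
    boundary f x = (hilbertTransform f x : ℂ) - (f x : ℂ) * Complex.I :=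
  Complex.ext (by simp) (by simp)

theorem H1Pair.continuous_boundary {f g : ℝ → ℝ} (h : H1Pair f g) : Continuous (boundary f) := by
  obtain ⟨g', hg'⟩ := h.exists_hilbert
  have h1 := h.continuous
  have h2 := hg'.continuous
  rw [funext (boundary_eq_ofReal f)]
  fun_prop

theorem norm_boundary_sub_le (f : ℝ → ℝ) (x y : ℝ) : ‖boundary f x - boundary f y‖
    ≤ |hilbertTransform f x - hilbertTransform f y| + |f x - f y| := by
  have := Complex.norm_le_abs_re_add_abs_im (boundary f x - boundary f y)
  simp only [Complex.sub_re, Complex.sub_im, boundary_re, boundary_im] at this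
  rwa [show -f x - -f y = -(f x - f y) by ring, abs_neg] at this

/-- The cross terms cancel and the difference is `Z - W` over the product of the denominators, so
the Lipschitz constant does not involve `t`. -/
theorem norm_div_sub_div_le {Z W : ℂ} {t κ : ℝ} (hκ : 0 < κ) (hZ : κ ≤ ‖1 - t * Z / 2‖)
    (hW : κ ≤ ‖1 - t * W / 2‖) :
    ‖Z / (1 - t * Z / 2) - W / (1 - t * W / 2)‖ ≤ (κ ^ 2)⁻¹ * ‖Z - W‖ := by
  have hZ0 : 1 - t * Z / 2 ≠ 0 := norm_pos_iff.1 (hκ.trans_le hZ)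
  have hW0 : 1 - t * W / 2 ≠ 0 := norm_pos_iff.1 (hκ.trans_le hW)
  have e : Z / (1 - t * Z / 2) - W / (1 - t * W / 2)
      = (Z - W) / ((1 - t * Z / 2) * (1 - t * W / 2)) := by
    rw [div_sub_div _ _ hZ0 hW0]; congr 1; ring
  rw [e, norm_div, norm_mul, div_eq_inv_mul, pow_two]
  gcongr

section Existence

variable {f g gH : ℝ → ℝ} {t κ : ℝ}

/-- The spatial derivative of the explicit solution. -/
noncomputable def evolvedDeriv (f g gH : ℝ → ℝ) (t x : ℝ) : ℂ :=
  ((gH x : ℂ) - (g x : ℂ) * Complex.I) / (1 - t * boundary f x / 2) ^ 2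

theorem H1Pair.memLp_abs_add (h : H1Pair f g) (hH : H1Pair (hilbertTransform f) gH) :
    MemLp (fun x => |hilbertTransform f x| + |f x|) 2 ∧ MemLp (fun x => |gH x| + |g x|) 2 :=
  ⟨hH.memLp.norm.add h.memLp.norm, hH.memLp_deriv.norm.add h.memLp_deriv.norm⟩

theorem norm_boundary_le_abs (f : ℝ → ℝ) (x : ℝ) :
    ‖boundary f x‖ ≤ |hilbertTransform f x| + |f x| := by
  simpa using Complex.norm_le_abs_re_add_abs_im (boundary f x)

theorem norm_ofReal_sub_le (p q : ℝ) : ‖(p : ℂ) - (q : ℂ) * Complex.I‖ ≤ |p| + |q| := by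
  refine (norm_sub_le _ _).trans ?_
  simp

theorem aestronglyMeasurable_evolvedDeriv (h : H1Pair f g) (hH : H1Pair (hilbertTransform f) gH)
    (t : ℝ) : AEStronglyMeasurable (evolvedDeriv f g gH t) volume := by
  have m1 : AEStronglyMeasurable (fun x => (gH x : ℂ) - (g x : ℂ) * Complex.I) volume :=
    (Complex.continuous_ofReal.comp_aestronglyMeasurable hH.memLp_deriv.1).sub
      ((Complex.continuous_ofReal.comp_aestronglyMeasurable h.memLp_deriv.1).mul_const _)
  have m2 : Measurable fun x => (1 - t * boundary f x / 2) ^ 2 := by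
    have := h.continuous_boundary.measurable
    fun_prop
  exact (m1.aemeasurable.div m2.aemeasurable).aestronglyMeasurable

theorem measurable_evolved (h : H1Pair f g) (t : ℝ) : Measurable (evolved f t) := by
  have := h.continuous_boundary.measurable
  unfold evolved
  fun_prop

/-- The candidate is a function of `H(f)` and `f`, Lipschitz where the denominator is bounded below,
so `H1Pair.chain` applies to these two `H¹` functions. -/
theorem H1Pair.evolved (h : H1Pair f g) (hH : H1Pair (hilbertTransform f) gH) (hκ : 0 < κ)
    (hb : ∀ x : ℝ, κ ≤ ‖1 - t * boundary f x / 2‖) :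
    H1Pair (fun x => -(evolved f t x).im) (fun x => -(evolvedDeriv f g gH t x).im) where
  memLp := by
    refine ((h.memLp_abs_add hH).1.const_mul κ⁻¹).of_le
      (Complex.measurable_im.comp (measurable_evolved h t)).neg.aestronglyMeasurable
      (Eventually.of_forall fun x => ?_)
    rw [norm_neg, Real.norm_eq_abs]
    refine (Complex.abs_im_le_norm _).trans ?_
    rw [CLM.evolved, norm_div, div_eq_inv_mul, Real.norm_eq_abs, abs_of_nonneg (by positivity)]
    have := norm_boundary_le_abs f x
    have := hb x
    gcongr
  memLp_deriv := by
    refine ((h.memLp_abs_add hH).2.const_mul (κ ^ 2)⁻¹).of_le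
      (Complex.measurable_im.comp_aemeasurable
        (aestronglyMeasurable_evolvedDeriv h hH t).aemeasurable).neg.aestronglyMeasurable
      (Eventually.of_forall fun x => ?_)
    rw [norm_neg, Real.norm_eq_abs]
    refine (Complex.abs_im_le_norm _).trans ?_
    rw [CLM.evolvedDeriv, norm_div, norm_pow, div_eq_inv_mul, Real.norm_eq_abs,
      abs_of_nonneg (by positivity)]
    have := norm_ofReal_sub_le (gH x) (g x)
    have := hb x
    gcongr
  sub_eq := by
    refine H1Pair.chain (C := (κ ^ 2)⁻¹) hH h (fun x y => ?_) (fun x h1 h2 => ?_)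
    · refine (abs_neg_im_sub_le _ _).trans ((norm_div_sub_div_le hκ (hb x) (hb y)).trans ?_)
      exact mul_le_mul_of_nonneg_left (norm_boundary_sub_le f x y) (by positivity)
    · have hZ : HasDerivAt (boundary f) ((gH x : ℂ) - (g x : ℂ) * Complex.I) x := by
        rw [funext (boundary_eq_ofReal f)]
        exact h1.ofReal_comp.sub (h2.ofReal_comp.mul_const _)
      have hne : 1 - t * boundary f x / 2 ≠ 0 := norm_pos_iff.1 (hκ.trans_le (hb x))
      have hW : HasDerivAt (CLM.evolved f t) (evolvedDeriv f g gH t x) x := by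
        refine (hZ.div (((hZ.const_mul (t : ℂ)).div_const 2).const_sub 1) hne).congr_deriv ?_
        rw [evolvedDeriv]
        congr 1
        ring
      exact (Complex.imCLM.hasFDerivAt.comp_hasDerivAt x hW).neg

/-- The Cauchy integral of the explicit solution. -/
theorem H1Pair.cauchy_evolved (h : H1Pair f g) {w' : ℝ → ℝ}
    (hw : H1Pair (fun x => -(CLM.evolved f t x).im) w') (hκ : 0 < κ)
    (hc : ∀ z : ℂ, 0 < z.im → κ ≤ ‖1 - t * cauchy f z / 2‖)
    (hb : ∀ x : ℝ, κ ≤ ‖1 - t * boundary f x / 2‖) {z : ℂ} (hz : 0 < z.im) :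
    cauchy f z / (1 - t * cauchy f z / 2) = cauchy (fun x => -(CLM.evolved f t x).im) z := by
  have hne : ∀ z : ℂ, 0 < z.im → 1 - t * cauchy f z / 2 ≠ 0 := fun z hz =>
    norm_pos_iff.1 (hκ.trans_le (hc z hz))
  refine eq_cauchy_of_im_boundary (G := fun z => cauchy f z / (1 - t * cauchy f z / 2)) hw
    (M := (l2 f + 6 * l2 g) / κ) ?_ ?_ ?_ ?_ hz
  · intro z hz
    have hd := differentiableAt_cauchy_of_im_pos h.memLp hz
    exact (hd.div (((hd.const_mul (t : ℂ)).div_const 2).const_sub 1)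
      (hne z hz)).differentiableWithinAt
  · intro z hz
    rw [norm_div]
    have h1 := h.norm_cauchy_le_of_im_pos hz
    have h2 := hc z hz
    have := l2_nonneg f
    have := l2_nonneg g
    gcongr
  · have h2 : Tendsto (fun η : ℝ => l2 f / √η) atTop (𝓝 0) :=
      Tendsto.const_div_atTop Real.tendsto_sqrt_atTop _
    have h1 : Tendsto (fun η : ℝ => cauchy f (η * Complex.I)) atTop (𝓝 0) := by
      refine squeeze_zero_norm' ?_ h2
      filter_upwards [eventually_gt_atTop 0] with η hη
      have := norm_cauchy_le h.memLp (z := η * Complex.I) (by simpa using hη)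
      simpa using this
    have := h1.div (((h1.const_mul (t : ℂ)).div_const 2).const_sub 1) (by simp)
    simpa [Pi.div_def] using this
  · intro ε hε
    have hlim : Tendsto (fun η : ℝ => (κ ^ 2)⁻¹ * (3 * l2 g * √η)) (𝓝[>] 0)
        (𝓝 ((κ ^ 2)⁻¹ * (3 * l2 g * √0))) :=
      (Continuous.tendsto (by fun_prop) 0).mono_left nhdsWithin_le_nhds
    rw [Real.sqrt_zero, mul_zero, mul_zero] at hlim
    filter_upwards [hlim.eventually (ge_mem_nhds hε), self_mem_nhdsWithin] with η h2 h3 x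
    have h3' : (0 : ℝ) < η := h3
    rw [← sub_eq_add_neg, ← Complex.sub_im]
    refine (Complex.abs_im_le_norm _).trans (le_trans ?_ h2)
    refine (norm_div_sub_div_le hκ (hc _ (by simpa using h3')) (hb x)).trans ?_
    exact mul_le_mul_of_nonneg_left (h.norm_cauchy_sub_boundary_le x h3) (by positivity)

/-- Its real part computes the Hilbert transform of the candidate, which the verification of the
equation requires. -/
theorem H1Pair.boundary_evolved (h : H1Pair f g) {w' : ℝ → ℝ}
    (hw : H1Pair (fun x => -(CLM.evolved f t x).im) w') (hκ : 0 < κ)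
    (hc : ∀ z : ℂ, 0 < z.im → κ ≤ ‖1 - t * cauchy f z / 2‖)
    (hb : ∀ x : ℝ, κ ≤ ‖1 - t * boundary f x / 2‖) (x : ℝ) :
    boundary (fun x => -(CLM.evolved f t x).im) x = CLM.evolved f t x := by
  refine hw.boundary_eq (fun z hz => h.cauchy_evolved hw hκ hc hb hz) ?_
  have h1 := h.tendsto_cauchy x
  exact h1.div (((h1.const_mul (t : ℂ)).div_const 2).const_sub 1)
    (norm_pos_iff.1 (hκ.trans_le (hb x)))

theorem hasDerivAt_evolved {x : ℝ} (hne : 1 - t * boundary f x / 2 ≠ 0) :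
    HasDerivAt (fun s : ℝ => evolved f s x) (evolved f t x ^ 2 / 2) t := by
  have h1 : HasDerivAt (fun s : ℝ => (1 - s * boundary f x / 2 : ℂ)) (-(boundary f x / 2)) t := by
    have := (((hasDerivAt_id t).ofReal_comp.mul_const (boundary f x)).div_const 2).const_sub 1
    simpa using this
  refine ((hasDerivAt_const t (boundary f x)).div h1 hne).congr_deriv ?_
  rw [evolved]
  field_simp
  ring

/-- Lipschitz dependence on time with a factor that is an `L²` function of `x`; integrating gives
continuity in time with values in `L²`. The next estimate does the same for the spatial derivative.
-/
theorem norm_evolved_sub_le {s x M : ℝ} (hκ : 0 < κ) (hM : ‖boundary f x‖ ≤ M)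
    (hs : κ ≤ ‖1 - s * boundary f x / 2‖) (ht : κ ≤ ‖1 - t * boundary f x / 2‖) :
    ‖evolved f s x - evolved f t x‖
      ≤ (M / (2 * κ ^ 2) * |s - t|) * (|hilbertTransform f x| + |f x|) := by
  have hs0 : 1 - s * boundary f x / 2 ≠ 0 := norm_pos_iff.1 (hκ.trans_le hs)
  have ht0 : 1 - t * boundary f x / 2 ≠ 0 := norm_pos_iff.1 (hκ.trans_le ht)
  have e : evolved f s x - evolved f t x = boundary f x * boundary f x * ((s - t : ℝ) : ℂ)
      / (2 * ((1 - s * boundary f x / 2) * (1 - t * boundary f x / 2))) := by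
    rw [evolved, evolved, div_sub_div _ _ hs0 ht0, div_eq_div_iff (mul_ne_zero hs0 ht0)
      (mul_ne_zero two_ne_zero (mul_ne_zero hs0 ht0))]
    push_cast; ring
  rw [e, norm_div, norm_mul, norm_mul, norm_mul, norm_mul, Complex.norm_real, Complex.norm_two,
    Real.norm_eq_abs]
  have hM0 : 0 ≤ M := (norm_nonneg _).trans hM
  calc _ ≤ (|hilbertTransform f x| + |f x|) * M * |s - t| / (2 * (κ * κ)) := by
        have := norm_boundary_le_abs f x
        gcongr
    _ = _ := by rw [pow_two]; ring

theorem norm_evolvedDeriv_sub_le {s x M τ : ℝ} (hκ : 0 < κ) (hM : ‖boundary f x‖ ≤ M)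
    (hsτ : |s| ≤ τ) (htτ : |t| ≤ τ)
    (hs : κ ≤ ‖1 - s * boundary f x / 2‖) (ht : κ ≤ ‖1 - t * boundary f x / 2‖) :
    ‖evolvedDeriv f g gH s x - evolvedDeriv f g gH t x‖
      ≤ (M * (2 + τ * M) / (2 * κ ^ 4) * |s - t|) * (|gH x| + |g x|) := by
  have hs0 : 1 - s * boundary f x / 2 ≠ 0 := norm_pos_iff.1 (hκ.trans_le hs)
  have ht0 : 1 - t * boundary f x / 2 ≠ 0 := norm_pos_iff.1 (hκ.trans_le ht)
  have hM0 : 0 ≤ M := (norm_nonneg _).trans hM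
  have hτ0 : 0 ≤ τ := (abs_nonneg _).trans hsτ
  set A : ℂ := (gH x : ℂ) - (g x : ℂ) * Complex.I with hA
  have e : evolvedDeriv f g gH s x - evolvedDeriv f g gH t x
      = A * (((s - t : ℝ) : ℂ) * boundary f x * (2 - s * boundary f x / 2 - t * boundary f x / 2))
      / (2 * ((1 - s * boundary f x / 2) ^ 2 * (1 - t * boundary f x / 2) ^ 2)) := by
    rw [evolvedDeriv, evolvedDeriv, div_sub_div _ _ (pow_ne_zero 2 hs0) (pow_ne_zero 2 ht0),
      div_eq_div_iff (mul_ne_zero (pow_ne_zero 2 hs0) (pow_ne_zero 2 ht0))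
      (mul_ne_zero two_ne_zero (mul_ne_zero (pow_ne_zero 2 hs0) (pow_ne_zero 2 ht0)))]
    push_cast; ring
  have hb : ‖(2 - s * boundary f x / 2 - t * boundary f x / 2 : ℂ)‖ ≤ 2 + τ * M := by
    refine (norm_sub_le _ _).trans ?_
    refine (add_le_add (norm_sub_le _ _) le_rfl).trans ?_
    simp only [norm_div, norm_mul, Complex.norm_real, Complex.norm_two, Real.norm_eq_abs]
    have h1 : |s| * ‖boundary f x‖ ≤ τ * M := by gcongr
    have h2 : |t| * ‖boundary f x‖ ≤ τ * M := by gcongr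
    linarith
  rw [e, norm_div, norm_mul, norm_mul, norm_mul, norm_mul, norm_mul, norm_pow, norm_pow,
    Complex.norm_real, Complex.norm_two, Real.norm_eq_abs]
  calc _ ≤ (|gH x| + |g x|) * (|s - t| * M * (2 + τ * M)) / (2 * (κ ^ 2 * κ ^ 2)) := by
        have := norm_ofReal_sub_le (gH x) (g x)
        gcongr
    _ = _ := by rw [← pow_add]; ring

/-- The explicit formula gives a solution as long as the denominators do not vanish. -/
theorem H1Pair.isSolution (h : H1Pair f g) {T : ℝ} (hN : Nonvanishing f T) :
    IsSolution f T (fun t x => -(CLM.evolved f t x).im) := by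
  obtain ⟨gH, hH⟩ := h.exists_hilbert
  have hpair : ∀ t ∈ Ico 0 T, H1Pair (fun x => -(CLM.evolved f t x).im)
      (fun x => -(evolvedDeriv f g gH t x).im) := by
    intro t ht
    obtain ⟨κ, hκ, h1⟩ := hN t ht
    exact h.evolved hH hκ (h1 t (right_mem_Icc.2 ht.1)).2
  refine ⟨?_, ⟨fun t ht => (hpair t ht).memH1, fun t x => -(evolvedDeriv f g gH t x).im,
    fun t ht => ⟨(hpair t ht).memLp_deriv, (hpair t ht).hasWeakDeriv⟩, fun t ht => ?_⟩, ?_⟩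
  · funext x
    simp [CLM.evolved]
  · obtain ⟨t₁, htt₁, ht₁⟩ := exists_between ht.2
    obtain ⟨κ, hκ, hκb⟩ := hN t₁ ⟨ht.1.trans htt₁.le, ht₁⟩
    obtain ⟨m1, m2⟩ := h.memLp_abs_add hH
    set M := l2 f + 3 * l2 g
    have hM : ∀ x, ‖boundary f x‖ ≤ M := h.norm_boundary_le
    set c1 := M / (2 * κ ^ 2)
    set c2 := M * (2 + t₁ * M) / (2 * κ ^ 4)
    set N1 := eLpNorm (fun x => |hilbertTransform f x| + |f x|) 2 volume
    set N2 := eLpNorm (fun x => |gH x| + |g x|) 2 volume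
    have hlim : Tendsto (fun s : ℝ => ENNReal.ofReal (c1 * |s - t|) * N1
        + ENNReal.ofReal (c2 * |s - t|) * N2) (𝓝[Ico 0 T] t) (𝓝 0) := by
      have ha : ∀ (c : ℝ) (N : ENNReal), N ≠ ⊤ →
          Tendsto (fun s : ℝ => ENNReal.ofReal (c * |s - t|) * N) (𝓝[Ico 0 T] t) (𝓝 0) := by
        intro c N hN
        have h0 : Tendsto (fun s : ℝ => ENNReal.ofReal (c * |s - t|)) (𝓝[Ico 0 T] t)
            (𝓝 (ENNReal.ofReal (c * |t - t|))) :=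
          (ENNReal.continuous_ofReal.tendsto _).comp
            ((Continuous.tendsto (by fun_prop) t).mono_left nhdsWithin_le_nhds)
        rw [sub_self, abs_zero, mul_zero, ENNReal.ofReal_zero] at h0
        simpa using ENNReal.Tendsto.mul_const h0 (Or.inr hN)
      simpa using (ha c1 N1 m1.2.ne).add (ha c2 N2 m2.2.ne)
    refine tendsto_of_tendsto_of_tendsto_of_le_of_le' tendsto_const_nhds hlim
      (Eventually.of_forall fun _ => bot_le) ?_
    filter_upwards [self_mem_nhdsWithin, nhdsWithin_le_nhds (Iio_mem_nhds htt₁)] with s hs hst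
    have hs' : s ∈ Icc 0 t₁ := ⟨hs.1, le_of_lt hst⟩
    have ht' : t ∈ Icc 0 t₁ := ⟨ht.1, htt₁.le⟩
    refine add_le_add ?_ ?_
    · refine eLpNorm_le_mul_eLpNorm_of_ae_le_mul (Eventually.of_forall fun x => ?_) 2
      have h1 := norm_evolved_sub_le hκ (hM x) ((hκb s hs').2 x) ((hκb t ht').2 x)
      rw [Real.norm_of_nonneg (by positivity : 0 ≤ |hilbertTransform f x| + |f x|)]
      exact (abs_neg_im_sub_le _ _).trans h1
    · refine eLpNorm_le_mul_eLpNorm_of_ae_le_mul (Eventually.of_forall fun x => ?_) 2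
      have h1 := norm_evolvedDeriv_sub_le (g := g) (gH := gH) hκ (hM x)
        (_root_.abs_le.2 ⟨by linarith [hs'.1, hs'.2], hs'.2⟩) (_root_.abs_le.2 ⟨by linarith [ht'.1, ht'.2], ht'.2⟩)
        ((hκb s hs').2 x) ((hκb t ht').2 x)
      rw [Real.norm_of_nonneg (by positivity : 0 ≤ |gH x| + |g x|)]
      exact (abs_neg_im_sub_le _ _).trans h1
  · intro t ht x
    obtain ⟨κ, hκ, h1⟩ := hN t ht
    obtain ⟨hc, hb⟩ := h1 t (right_mem_Icc.2 ht.1)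
    have h2 := h.boundary_evolved (hpair t ht) hκ hc hb x
    refine ⟨hilbertTransform (fun x => -(CLM.evolved f t x).im) x,
      (hpair t ht).hasHilbertTransformAt x, ?_⟩
    have h3 : hilbertTransform (fun x => -(CLM.evolved f t x).im) x = (CLM.evolved f t x).re := by
      rw [← h2]; rfl
    -- The equation is the imaginary part of `F_t = F²/2`: since `F = H(ω) - iω`, minus that part is
    -- `ω H(ω)`.
    have h4 := (Complex.imCLM.hasFDerivAt.comp_hasDerivAt t
      (hasDerivAt_evolved (norm_pos_iff.1 (hκ.trans_le (hb x))))).neg.hasDerivWithinAt (s := Ico 0 T)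
    refine h4.congr_deriv ?_
    rw [h3, Complex.imCLM_apply, pow_two, Complex.div_ofNat_im, Complex.mul_im]
    ring

end Existence

/-! ### Lower bounds for the denominator by compactness. -/

/-- The continuous extension of the Cauchy integral to the closed upper half-plane. -/
noncomputable def cauchyExt (f : ℝ → ℝ) (z : ℂ) : ℂ :=
  if 0 < z.im then cauchy f z else boundary f z.re

theorem H1Pair.continuousOn_cauchyExt {f g : ℝ → ℝ} (h : H1Pair f g) :
    ContinuousOn (cauchyExt f) {z | 0 ≤ z.im} := by
  intro z hz
  rcases lt_or_eq_of_le (show 0 ≤ z.im from hz) with hpos | hzero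
  · refine ((differentiableAt_cauchy_of_im_pos h.memLp hpos).continuousAt.congr ?_).continuousWithinAt
    filter_upwards [isOpen_upperHalf.mem_nhds hpos] with w hw
    exact (if_pos hw).symm
  · have hz0 : cauchyExt f z = boundary f z.re := if_neg (by rw [← hzero]; exact lt_irrefl 0)
    rw [ContinuousWithinAt, hz0, tendsto_iff_norm_sub_tendsto_zero]
    have hlim : Tendsto (fun w : ℂ => 3 * l2 g * √w.im + ‖boundary f w.re - boundary f z.re‖)
        (𝓝[{z | 0 ≤ z.im}] z) (𝓝 (3 * l2 g * √z.im + ‖boundary f z.re - boundary f z.re‖)) := by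
      have := h.continuous_boundary
      exact (Continuous.tendsto (by fun_prop) z).mono_left nhdsWithin_le_nhds
    rw [← hzero, Real.sqrt_zero, mul_zero, sub_self, norm_zero, add_zero] at hlim
    refine squeeze_zero' (Eventually.of_forall fun _ => norm_nonneg _) ?_ hlim
    filter_upwards [self_mem_nhdsWithin] with w hw
    rcases lt_or_eq_of_le (show 0 ≤ w.im from hw) with hw1 | hw1
    · have h1 := h.norm_cauchy_sub_boundary_le w.re hw1
      rw [norm_eq_re_add_im] at h1
      have e : cauchyExt f w = cauchy f w := if_pos hw1
      rw [e]
      exact (norm_sub_le_norm_sub_add_norm_sub _ (boundary f w.re) _).trans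
        (add_le_add h1 le_rfl)
    · have e : cauchyExt f w = boundary f w.re := if_neg (by rw [← hw1]; exact lt_irrefl 0)
      rw [e, ← hw1]
      simp

/-- The Cauchy integral is small near infinity, which bounds the denominator below by `1/2` there.
On the remaining compact set of times and points a continuous nonvanishing function attains a
positive minimum. -/
theorem H1Pair.nonvanishing_of_ne {f g : ℝ → ℝ} (h : H1Pair f g) {T : ℝ}
    (hne : ∀ t ∈ Ico 0 T, ∀ z : ℂ, 0 ≤ z.im → 1 - t * cauchyExt f z / 2 ≠ 0) :
    Nonvanishing f T := by
  intro t₁ ht₁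
  -- With this `ε`, `t ‖F‖ ≤ 1` for all `t ≤ t₁`; the `+ 1` keeps it meaningful at `t₁ = 0`.
  obtain ⟨M, hM1, hM2⟩ := h.cauchy_small (ε := 1 / (t₁ + 1))
    (by have := ht₁.1; positivity)
  have hfar : ∀ z : ℂ, 0 ≤ z.im → M ≤ ‖z‖ → ‖cauchyExt f z‖ ≤ 1 / (t₁ + 1) := by
    intro z hz hzM
    rcases lt_or_eq_of_le hz with h1 | h1
    · rw [cauchyExt, if_pos h1]; exact hM1 z h1 hzM
    · rw [cauchyExt, if_neg (by rw [← h1]; exact lt_irrefl 0)]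
      refine hM2 z.re ?_
      have : z = (z.re : ℂ) := Complex.ext rfl (by simp [← h1])
      rw [this, Complex.norm_real] at hzM
      exact hzM
  set S : Set (ℝ × ℂ) := Icc 0 t₁ ×ˢ ({z | 0 ≤ z.im} ∩ Metric.closedBall 0 M) with hS
  have hScpt : IsCompact S :=
    isCompact_Icc.prod ((isCompact_closedBall 0 M).inter_left
      (isClosed_le continuous_const Complex.continuous_im))
  have hcont : ContinuousOn (fun p : ℝ × ℂ => ‖1 - p.1 * cauchyExt f p.2 / 2‖) S := by
    have h1 : ContinuousOn (fun p : ℝ × ℂ => cauchyExt f p.2) S :=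
      h.continuousOn_cauchyExt.comp continuousOn_snd fun p hp => hp.2.1
    have h2 : ContinuousOn (fun p : ℝ × ℂ => (p.1 : ℂ)) S := by fun_prop
    exact (continuousOn_const.sub ((h2.mul h1).div_const 2)).norm
  obtain ⟨κ, hκ, hκS⟩ : ∃ κ > 0, ∀ p ∈ S, κ ≤ ‖1 - p.1 * cauchyExt f p.2 / 2‖ := by
    rcases S.eq_empty_or_nonempty with he | hn
    · exact ⟨1, one_pos, fun p hp => by rw [he] at hp; exact hp.elim⟩
    · obtain ⟨p, hp, hmin⟩ := hScpt.exists_isMinOn hn hcont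
      refine ⟨_, norm_pos_iff.2 (hne p.1 ⟨hp.1.1, hp.1.2.trans_lt ht₁.2⟩ p.2 hp.2.1), fun q hq => hmin hq⟩
  have hall : ∀ t ∈ Icc 0 t₁, ∀ z : ℂ, 0 ≤ z.im →
      min κ (1 / 2) ≤ ‖1 - t * cauchyExt f z / 2‖ := by
    intro t ht z hz
    by_cases hzM : ‖z‖ ≤ M
    · exact (min_le_left _ _).trans (hκS (t, z) ⟨ht, hz, by simpa using hzM⟩)
    · refine (min_le_right _ _).trans ?_
      have h1 := hfar z hz (le_of_not_ge hzM)
      have h2 : ‖(t * cauchyExt f z / 2 : ℂ)‖ ≤ 1 / 2 := by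
        rw [norm_div, norm_mul, Complex.norm_real, Complex.norm_two, Real.norm_eq_abs,
          abs_of_nonneg ht.1]
        have h3 : t * ‖cauchyExt f z‖ ≤ (t₁ + 1) * (1 / (t₁ + 1)) := by
          have := ht.1
          have := ht.2
          have := ht₁.1
          gcongr
          linarith
        have h4 : (t₁ + 1) * (1 / (t₁ + 1)) = 1 := by
          have := ht₁.1
          field_simp
        linarith
      have h3 := norm_sub_norm_le (1 : ℂ) (t * cauchyExt f z / 2)
      rw [norm_one] at h3
      linarith
  refine ⟨min κ (1 / 2), by positivity, fun t ht => ⟨fun z hz => ?_, fun x => ?_⟩⟩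
  · have := hall t ht z hz.le
    rwa [cauchyExt, if_pos hz] at this
  · have := hall t ht x (by simp)
    rwa [cauchyExt, if_neg (by simp), Complex.ofReal_re] at this

/-! ### Signs of the Cauchy integral for odd data. -/

section Odd

variable {f : ℝ → ℝ}

theorem cauchy_odd (hf : MemLp f 2) (hodd : Function.Odd f) {z : ℂ} (hz : 0 < z.im) :
    IntegrableOn (fun u : ℝ => ((2 * u * f u : ℝ) : ℂ) / (z ^ 2 - u ^ 2)) (Ioi 0) ∧
    cauchy f z = (1 / Real.pi : ℝ) * ∫ u in Ioi (0 : ℝ), ((2 * u * f u : ℝ) : ℂ) / (z ^ 2 - u ^ 2) := by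
  obtain ⟨i1, i2, h⟩ := integral_fold (integrable_div_of_im_pos hf hz) 0
  have e : ∀ u : ℝ, (f (0 - u) : ℂ) / (z - (0 - u : ℝ)) + (f (0 + u) : ℂ) / (z - (0 + u : ℝ))
      = ((2 * u * f u : ℝ) : ℂ) / (z ^ 2 - u ^ 2) := by
    intro u
    have h1 : z - u ≠ 0 := fun h0 => by
      have := congrArg Complex.im h0; simp at this; exact hz.ne' this
    have h2 : z + u ≠ 0 := fun h0 => by
      have := congrArg Complex.im h0; simp at this; exact hz.ne' this
    rw [zero_sub, zero_add, hodd u, sq_sub_sq]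
    push_cast
    rw [sub_neg_eq_add]
    field_simp
    ring
  have i3 := i1.add i2
  refine ⟨i3.congr (Eventually.of_forall fun u => e u), ?_⟩
  rw [cauchy, h]
  simp_rw [e]

theorem hilbertTransform_zero_odd {g : ℝ → ℝ} (h : H1Pair f g) (hodd : Function.Odd f) :
    IntegrableOn (fun u => -(2 * f u / u)) (Ioi 0) ∧
    hilbertTransform f 0 = (1 / Real.pi) * ∫ u in Ioi (0 : ℝ), -(2 * f u / u) := by
  have e : ∀ u : ℝ, (f (0 - u) - f (0 + u)) / u = -(2 * f u / u) := by
    intro u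
    rw [zero_sub, zero_add, hodd u]; ring
  have h1 := h.integrableOn_folded 0
  have h2 := (h.hasHilbertTransformAt_folded 0).hilbertTransform_eq
  simp_rw [e] at h1 h2
  exact ⟨h1, h2⟩

theorem neg_of_sign (hsign : ∀ x, Real.sign (f x) = -Real.sign x) {u : ℝ} (hu : 0 < u) : f u < 0 := by
  have h1 := hsign u
  rw [Real.sign_of_pos hu] at h1
  rcases lt_trichotomy (f u) 0 with h | h | h
  · exact h
  · rw [h, Real.sign_zero] at h1; norm_num at h1
  · rw [Real.sign_of_pos h] at h1; norm_num at h1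

theorem setIntegral_Ioi_pos {φ : ℝ → ℝ} (hi : IntegrableOn φ (Ioi 0)) (hpos : ∀ u > 0, 0 < φ u) :
    0 < ∫ u in Ioi 0, φ u := by
  rw [setIntegral_pos_iff_support_of_nonneg_ae _ hi]
  · have : Function.support φ ∩ Ioi 0 = Ioi 0 :=
      inter_eq_right.2 fun u hu => (hpos u hu).ne'
    rw [this]; simp
  · exact (ae_restrict_iff' measurableSet_Ioi).2 (Eventually.of_forall fun u hu => (hpos u hu).le)

theorem hilbertTransform_zero_pos {g : ℝ → ℝ} (h : H1Pair f g) (hodd : Function.Odd f)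
    (hneg : ∀ u > 0, f u < 0) : 0 < hilbertTransform f 0 := by
  obtain ⟨h1, h2⟩ := hilbertTransform_zero_odd h hodd
  rw [h2]
  refine mul_pos (by positivity) (setIntegral_Ioi_pos h1 fun u hu => ?_)
  have := div_pos (neg_pos.2 (hneg u hu)) hu
  rw [mul_div_assoc]
  rw [neg_div] at this
  linarith

/-- The sign of the Cauchy integral of an odd function negative on the positive half-line. -/
theorem cauchy_im_mul_re_pos (hf : MemLp f 2) (hodd : Function.Odd f) (hneg : ∀ u > 0, f u < 0)
    {z : ℂ} (hz : 0 < z.im) (hre : z.re ≠ 0) : (cauchy f z).im ≠ 0 := by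
  obtain ⟨hi, he⟩ := cauchy_odd hf hodd hz
  have hne : ∀ u : ℝ, z ^ 2 - u ^ 2 ≠ 0 := by
    intro u h0
    have := congrArg Complex.im h0
    simp only [pow_two, Complex.sub_im, Complex.mul_im, Complex.ofReal_im, Complex.ofReal_re,
      Complex.zero_im, mul_zero, zero_mul, add_zero, sub_zero] at this
    exact mul_ne_zero hre hz.ne' (by linarith)
  -- The imaginary part is `Re z` times a quantity that is positive for every `u > 0`, so the
  -- integral cannot vanish.
  have him : ∀ u : ℝ, (((2 * u * f u : ℝ) : ℂ) / (z ^ 2 - u ^ 2)).im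
      = z.re * (-(4 * z.im * u * f u) / Complex.normSq (z ^ 2 - u ^ 2)) := by
    intro u
    rw [Complex.div_im, Complex.ofReal_im, Complex.ofReal_re]
    simp [pow_two]
    ring
  have hi2 : IntegrableOn (fun u : ℝ => z.re *
      (-(4 * z.im * u * f u) / Complex.normSq (z ^ 2 - u ^ 2))) (Ioi 0) := by
    exact Integrable.congr hi.im (Eventually.of_forall fun u => him u)
  have hi3 : IntegrableOn (fun u : ℝ =>
      (-(4 * z.im * u * f u) / Complex.normSq (z ^ 2 - u ^ 2))) (Ioi 0) := by
    exact Integrable.congr (Integrable.const_mul hi2 (z.re)⁻¹)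
      (Eventually.of_forall fun u => inv_mul_cancel_left₀ hre _)
  have hval : (∫ u in Ioi (0 : ℝ), ((2 * u * f u : ℝ) : ℂ) / (z ^ 2 - u ^ 2)).im
      = z.re * ∫ u in Ioi (0 : ℝ), (-(4 * z.im * u * f u) / Complex.normSq (z ^ 2 - u ^ 2)) := by
    rw [← RCLike.im_to_complex, ← integral_im hi, ← integral_const_mul]
    simp only [RCLike.im_to_complex, him]
  rw [he, Complex.im_ofReal_mul, hval]
  refine mul_ne_zero (by positivity) (mul_ne_zero hre (setIntegral_Ioi_pos hi3 fun u hu => ?_).ne')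
  refine div_pos ?_ (Complex.normSq_pos.2 (hne u))
  have := mul_pos (mul_pos hz hu) (neg_pos.2 (hneg u hu))
  linarith

/-- At `z = iη` the folded integrand is `-2u f(u)/(η² + u²)`, which is largest at `η = 0`. -/
theorem cauchy_re_le {g : ℝ → ℝ} (h : H1Pair f g) (hodd : Function.Odd f) (hneg : ∀ u > 0, f u < 0)
    {z : ℂ} (hz : 0 < z.im) (hre : z.re = 0) : (cauchy f z).re ≤ hilbertTransform f 0 := by
  obtain ⟨hi, he⟩ := cauchy_odd h.memLp hodd hz
  obtain ⟨h1, h2⟩ := hilbertTransform_zero_odd h hodd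
  rw [he, Complex.re_ofReal_mul, h2]
  refine mul_le_mul_of_nonneg_left ?_ (by positivity)
  rw [← RCLike.re_to_complex, ← integral_re hi]
  refine setIntegral_mono_on hi.re h1 measurableSet_Ioi fun u hu => ?_
  have hu' : (0 : ℝ) < u := hu
  have hz2 : z ^ 2 - u ^ 2 = ((-(z.im ^ 2 + u ^ 2) : ℝ) : ℂ) := by
    apply Complex.ext <;> simp [pow_two, hre]
    ring
  rw [hz2, ← Complex.ofReal_div, RCLike.re_to_complex, Complex.ofReal_re, div_neg, neg_le_neg_iff,
    div_le_div_iff₀ hu' (by positivity)]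
  have := hneg u hu
  nlinarith [mul_pos (mul_pos hz hz) (neg_pos.2 this)]

/-- A zero of the denominator requires `F = 2/t`, a real number above `2a`. But `F` is real only on
the closed upper imaginary axis, and there it is at most `2a`. -/
theorem nonvanishing_of_odd {g : ℝ → ℝ} (h : H1Pair f g) (hodd : Function.Odd f)
    (hneg : ∀ u > 0, f u < 0) {a : ℝ} (ha : 0 < a) (h0 : hilbertTransform f 0 = 2 * a) :
    Nonvanishing f (1 / a) := by
  refine h.nonvanishing_of_ne fun t ht z hz heq => ?_
  have hta : t * a < 1 := by
    have := ht.2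
    rwa [lt_div_iff₀ ha] at this
  have hre := congrArg Complex.re heq
  have him := congrArg Complex.im heq
  have e : (t * cauchyExt f z / 2 : ℂ) = ((t / 2 : ℝ) : ℂ) * cauchyExt f z := by push_cast; ring
  rw [e, Complex.sub_re, Complex.re_ofReal_mul, Complex.one_re, Complex.zero_re] at hre
  rw [e, Complex.sub_im, Complex.im_ofReal_mul, Complex.one_im, Complex.zero_im] at him
  have ht0 : t ≠ 0 := by rintro rfl; norm_num at hre
  have him0 : (cauchyExt f z).im = 0 := by
    have h1 : t / 2 * (cauchyExt f z).im = 0 := by linarith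
    exact (mul_eq_zero.1 h1).resolve_left (by positivity)
  have hle : (cauchyExt f z).re ≤ 2 * a := by
    rcases lt_or_eq_of_le hz with h1 | h1
    · rw [cauchyExt, if_pos h1] at him0 ⊢
      rw [← h0]
      refine cauchy_re_le h hodd hneg h1 ?_
      by_contra hne
      exact cauchy_im_mul_re_pos h.memLp hodd hneg h1 hne him0
    · rw [cauchyExt, if_neg (by rw [← h1]; exact lt_irrefl 0)] at him0 ⊢
      rw [boundary_im, neg_eq_zero] at him0
      have hz0 : z.re = 0 := by
        rcases lt_trichotomy z.re 0 with h | h | h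
        · have h3 := hneg (-z.re) (by linarith)
          rw [hodd] at h3
          linarith
        · exact h
        · have h3 := hneg z.re h
          linarith
      rw [hz0, boundary_re, h0]
  nlinarith [ht.1, lt_of_le_of_ne ht.1 (Ne.symm ht0)]

end Odd

/-! ### The Hilbert transform of smooth compactly supported functions. -/

section CompactSupport

variable {f : ℝ → ℝ}

theorem contDiff_deriv {m : ℕ} (hf : ContDiff ℝ (m + 1 : ℕ) f) : ContDiff ℝ m (deriv f) := by
  push_cast at hf
  exact (contDiff_succ_iff_deriv.1 hf).2.2

theorem contDiffAt_deriv {m : ℕ} {x : ℝ} (hf : ContDiffAt ℝ (m + 1 : ℕ) f x) :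
    ContDiffAt ℝ m (deriv f) x :=
  (hf.fderiv_right (m := m) (by norm_cast)).clm_apply contDiffAt_const

theorem exists_eq_zero_of_lt_abs (hc : HasCompactSupport f) : ∃ R, ∀ x, R < |x| → f x = 0 := by
  obtain ⟨R, hR⟩ := exists_eq_zero_of_hasCompactSupport hc
  exact ⟨R, fun x hx => hR x fun h => (_root_.abs_le.2 h).not_gt hx⟩

theorem hilbertTransform_eq_folded {g : ℝ → ℝ} (h : H1Pair f g) (x : ℝ) :
    hilbertTransform f x = (1 / Real.pi) * ∫ u in Ioi (0 : ℝ), (f (x - u) - f (x + u)) / u :=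
  (h.hasHilbertTransformAt_folded x).hilbertTransform_eq

/-- The folded integral is differentiated under the integral sign. As `f'` is Lipschitz, the
symmetric difference quotient is bounded by `2L`, and it vanishes for large `u` uniformly for base
points within distance one of `x`. -/
theorem hasDerivAt_hilbertTransform (hf : ContDiff ℝ 2 f) (hc : HasCompactSupport f) (x : ℝ) :
    HasDerivAt (hilbertTransform f) (hilbertTransform (deriv f) x) x := by
  have hf1 : ContDiff ℝ 1 (deriv f) := contDiff_deriv (m := 1) hf
  have p1 := H1Pair.of_contDiff (hf.of_le one_le_two) hc
  have p2 := H1Pair.of_contDiff hf1 hc.deriv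
  obtain ⟨L, hL⟩ := hf1.lipschitzWith_of_hasCompactSupport hc.deriv one_ne_zero
  obtain ⟨R, hR⟩ := exists_eq_zero_of_lt_abs hc.deriv
  have hd : ∀ y, HasDerivAt f (deriv f y) y := fun y =>
    (hf.differentiable two_ne_zero y).hasDerivAt
  rw [funext (hilbertTransform_eq_folded p1), hilbertTransform_eq_folded p2]
  refine HasDerivAt.const_mul _ ?_
  refine (hasDerivAt_integral_of_dominated_loc_of_deriv_le (μ := volume.restrict (Ioi 0))
    (F := fun x u => (f (x - u) - f (x + u)) / u)
    (F' := fun x u => (deriv f (x - u) - deriv f (x + u)) / u)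
    (s := Metric.ball x 1)
    (bound := (Ioc 0 (|R| + |x| + 1)).indicator fun _ => 2 * (L : ℝ))
    (Metric.ball_mem_nhds x one_pos) (Eventually.of_forall fun y => (p1.integrableOn_folded y).1)
    (p1.integrableOn_folded x) (p2.integrableOn_folded x).1 ?_ ?_ ?_).2
  · refine (ae_restrict_iff' measurableSet_Ioi).2 (Eventually.of_forall fun u hu y hy => ?_)
    have hu' : (0 : ℝ) < u := hu
    have hy' : |y - x| < 1 := by simpa [Real.dist_eq] using hy
    by_cases huR : u ≤ |R| + |x| + 1
    · rw [indicator_of_mem (show u ∈ Ioc 0 (|R| + |x| + 1) from ⟨hu', huR⟩), Real.norm_eq_abs,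
        abs_div, abs_of_pos hu', div_le_iff₀ hu']
      have h1 := hL.dist_le_mul (y - u) (y + u)
      rw [Real.dist_eq, Real.dist_eq, show y - u - (y + u) = -(2 * u) by ring, abs_neg,
        abs_of_pos (by positivity : 0 < 2 * u)] at h1
      linarith
    · rw [not_le] at huR
      have h1 := abs_sub_abs_le_abs_sub y x
      have h2 := abs_sub_abs_le_abs_sub u y
      have h3 := abs_sub_abs_le_abs_sub u (-y)
      rw [abs_neg, sub_neg_eq_add] at h3
      rw [abs_of_pos hu'] at h2 h3
      have h4 := le_abs_self R
      have e1 : deriv f (y - u) = 0 := hR _ (by rw [abs_sub_comm]; linarith)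
      have e2 : deriv f (y + u) = 0 := hR _ (by rw [add_comm]; linarith)
      rw [e1, e2, sub_zero, zero_div, norm_zero]
      exact indicator_nonneg (fun _ _ => by positivity) _
  · exact ((integrable_indicator_iff measurableSet_Ioc).2 (integrableOn_const (by simp))).restrict
  · refine Eventually.of_forall fun u y _ => ?_
    exact (((hd _).comp_sub_const y u).sub ((hd _).comp_add_const y u)).div_const u

/-- Induction through `H(f)' = H(f')`. One derivative is given up in the base case, where continuity
of `H(f)` is taken from `f ∈ H¹`. -/
theorem contDiff_hilbertTransform : ∀ (m : ℕ) {f : ℝ → ℝ}, ContDiff ℝ (m + 1 : ℕ) f →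
    HasCompactSupport f → ContDiff ℝ m (hilbertTransform f)
  | 0, f, hf, hc => by
    obtain ⟨g', hg⟩ := (H1Pair.of_contDiff (hf.of_le (by norm_num)) hc).exists_hilbert
    exact contDiff_zero.2 hg.continuous
  | m + 1, f, hf, hc => by
    have h2 : ContDiff ℝ 2 f := hf.of_le (by exact_mod_cast (by omega : 2 ≤ m + 1 + 1))
    have hd := hasDerivAt_hilbertTransform h2 hc
    have hf' : ContDiff ℝ (m + 1 : ℕ) (deriv f) := contDiff_deriv hf
    push_cast
    refine contDiff_succ_iff_deriv.2 ⟨fun x => (hd x).differentiableAt, by simp, ?_⟩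
    rw [funext fun x => (hd x).deriv]
    exact contDiff_hilbertTransform m hf' hc.deriv

theorem hilbertTransform_sub {f₁ g g₁ : ℝ → ℝ} (h : H1Pair f g) (h₁ : H1Pair f₁ g₁) (x : ℝ) :
    hilbertTransform (fun y => f y - f₁ y) x = hilbertTransform f x - hilbertTransform f₁ x := by
  rw [hilbertTransform_eq_folded (h.sub h₁), hilbertTransform_eq_folded h,
    hilbertTransform_eq_folded h₁, ← mul_sub,
    ← integral_sub (h.integrableOn_folded x) (h₁.integrableOn_folded x)]
  congr 2
  funext u
  ring

theorem hilbertTransform_even {g : ℝ → ℝ} (h : H1Pair f g) (hodd : Function.Odd f) :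
    Function.Even (hilbertTransform f) := by
  intro x
  rw [hilbertTransform_eq_folded h, hilbertTransform_eq_folded h]
  congr 2
  funext u
  rw [show -x - u = -(x + u) by ring, show -x + u = -(x - u) by ring, hodd, hodd]
  ring

theorem deriv_even_of_odd (hodd : Function.Odd f) : Function.Even (deriv f) := by
  intro x
  have := deriv_comp_neg f x
  rw [show (fun y => f (-y)) = fun y => -f y from funext hodd, deriv.fun_neg] at this
  linarith

theorem deriv_odd_of_even (heven : Function.Even f) : Function.Odd (deriv f) := by
  intro x
  have := deriv_comp_neg f x
  rw [show (fun y => f (-y)) = f from funext heven] at this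
  linarith

theorem abs_le_mul_pow_of_deriv {M : ℝ} {k : ℕ} (hf : Differentiable ℝ f) (h0 : f 0 = 0)
    (hb : ∀ u, 0 ≤ u → |deriv f u| ≤ M * u ^ k) {u : ℝ} (hu : 0 ≤ u) :
    |f u| ≤ M * u ^ (k + 1) := by
  have h1 := (convex_Icc (0 : ℝ) u).norm_image_sub_le_of_norm_deriv_le (f := f) (C := M * u ^ k)
    (fun x _ => hf x) (fun x hx => ?_) (left_mem_Icc.2 hu) (right_mem_Icc.2 hu)
  · rw [h0, sub_zero, sub_zero, Real.norm_eq_abs, Real.norm_eq_abs, abs_of_nonneg hu] at h1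
    rw [pow_succ, ← mul_assoc]
    exact h1
  · have hM : 0 ≤ M := by
      have := (abs_nonneg _).trans (hb 1 zero_le_one)
      simpa using this
    refine (hb x hx.1).trans ?_
    have := hx.1
    have := hx.2
    gcongr

/-- Integration by parts: the second derivative of the Hilbert transform at the origin. -/
theorem integral_deriv_deriv_div (hf : ContDiff ℝ 3 f) (hc : HasCompactSupport f)
    (hodd : Function.Odd f) (h0 : f 0 = 0) (h1 : deriv f 0 = 0) (h2 : deriv (deriv f) 0 = 0) :
    IntegrableOn (fun u => f u / u ^ 3) (Ioi 0) ∧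
    hilbertTransform (deriv (deriv f)) 0 = -(4 / Real.pi) * ∫ u in Ioi (0 : ℝ), f u / u ^ 3 := by
  have c1 : ContDiff ℝ 2 (deriv f) := contDiff_deriv (m := 2) hf
  have c2 : ContDiff ℝ 1 (deriv (deriv f)) := contDiff_deriv (m := 1) c1
  have c3 : Continuous (deriv (deriv (deriv f))) := c2.continuous_deriv le_rfl
  obtain ⟨M, hM⟩ := hc.deriv.deriv.deriv.exists_bound_of_continuous c3
  have b2 : ∀ u, 0 ≤ u → |deriv (deriv f) u| ≤ M * u ^ 1 := fun u hu =>
    abs_le_mul_pow_of_deriv (k := 0) (c2.differentiable one_ne_zero) h2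
      (fun v _ => by simpa using hM v) hu
  have b1 : ∀ u, 0 ≤ u → |deriv f u| ≤ M * u ^ 2 := fun u hu =>
    abs_le_mul_pow_of_deriv (c1.differentiable two_ne_zero) h1 b2 hu
  have b0 : ∀ u, 0 ≤ u → |f u| ≤ M * u ^ 3 := fun u hu =>
    abs_le_mul_pow_of_deriv (hf.differentiable three_ne_zero) h0 b1 hu
  have p2 := H1Pair.of_contDiff c2 hc.deriv.deriv
  have hodd2 : Function.Odd (deriv (deriv f)) := deriv_odd_of_even (deriv_even_of_odd hodd)
  obtain ⟨i2, e2⟩ := hilbertTransform_zero_odd p2 hodd2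
  obtain ⟨R, hR⟩ := exists_eq_zero_of_lt_abs hc
  obtain ⟨R', hR'⟩ := exists_eq_zero_of_lt_abs hc.deriv
  have i0 : IntegrableOn (fun u => f u / u ^ 3) (Ioi 0) := by
    have hb : Integrable ((Ioc 0 |R|).indicator fun _ => M) (volume.restrict (Ioi 0)) :=
      ((integrable_indicator_iff measurableSet_Ioc).2 (integrableOn_const (by simp))).restrict
    refine Integrable.mono' hb ?_ ?_
    · exact (hf.continuous.measurable.div (by fun_prop)).aestronglyMeasurable
    · refine (ae_restrict_iff' measurableSet_Ioi).2 (Eventually.of_forall fun u hu => ?_)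
      have hu' : (0 : ℝ) < u := hu
      by_cases huR : u ≤ |R|
      · rw [indicator_of_mem (show u ∈ Ioc 0 |R| from ⟨hu', huR⟩), Real.norm_eq_abs, abs_div,
          abs_of_pos (by positivity : 0 < u ^ 3), div_le_iff₀ (by positivity)]
        exact b0 u hu'.le
      · rw [indicator_of_notMem (fun h => huR h.2), hR u (by
          rw [abs_of_pos hu']; linarith [le_abs_self R, not_le.1 huR]), zero_div, norm_zero]
  refine ⟨i0, ?_⟩
  have i2' : IntegrableOn (fun u => deriv (deriv f) u / u) (Ioi 0) := by
    refine (i2.const_mul (-(1 / 2))).congr (Eventually.of_forall fun u => ?_)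
    simp only
    ring
  -- Two integrations by parts at once: the integrand is the derivative of `f'/u + f/u²`, which
  -- vanishes at both ends.
  have key : ∫ u in Ioi (0 : ℝ), (deriv (deriv f) u / u - 2 * (f u / u ^ 3)) = 0 - 0 := by
    -- Division by zero gives the value `0`, which agrees with the limit at the origin, so the
    -- primitive is continuous from the right there.
    have hz : deriv f 0 / 0 + f 0 / 0 ^ 2 = 0 := by simp
    have := integral_Ioi_of_hasDerivAt_of_tendsto (a := 0) (m := 0)
      (f := fun u => deriv f u / u + f u / u ^ 2)
      (f' := fun u => deriv (deriv f) u / u - 2 * (f u / u ^ 3)) ?_ ?_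
      (i2'.sub (i0.const_mul 2)) ?_
    · rwa [hz] at this
    · rw [ContinuousWithinAt, hz]
      have hlim : Tendsto (fun u : ℝ => 2 * M * u) (𝓝[Ici 0] 0) (𝓝 (2 * M * 0)) :=
        (Continuous.tendsto (by fun_prop) 0).mono_left nhdsWithin_le_nhds
      rw [mul_zero] at hlim
      refine squeeze_zero_norm' ?_ hlim
      filter_upwards [self_mem_nhdsWithin] with u hu
      rcases lt_or_eq_of_le (show 0 ≤ u from hu) with hu' | hu'
      · refine (norm_add_le _ _).trans ?_
        rw [norm_div, norm_div, Real.norm_eq_abs, Real.norm_eq_abs, Real.norm_eq_abs,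
          Real.norm_eq_abs, abs_of_pos hu', abs_of_pos (by positivity : 0 < u ^ 2)]
        have e1 : |deriv f u| / u ≤ M * u := by
          rw [div_le_iff₀ hu']; nlinarith [b1 u hu'.le]
        have e2 : |f u| / u ^ 2 ≤ M * u := by
          rw [div_le_iff₀ (by positivity)]; nlinarith [b0 u hu'.le]
        linarith
      · rw [← hu']; simp
    · intro u hu
      have hu' : u ≠ 0 := (show (0 : ℝ) < u from hu).ne'
      have d1 := (c1.differentiable two_ne_zero u).hasDerivAt.div (hasDerivAt_id u) hu'
      have d0 := (hf.differentiable three_ne_zero u).hasDerivAt.div (hasDerivAt_pow 2 u)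
        (pow_ne_zero 2 hu')
      refine (d1.add d0).congr_deriv ?_
      simp only [id]
      field_simp
      ring
    · refine tendsto_const_nhds.congr' ?_
      filter_upwards [eventually_gt_atTop (max |R| |R'|)] with u hu
      have h1 := (max_lt_iff.1 hu).1
      have h2 := (max_lt_iff.1 hu).2
      have h3 := le_abs_self u
      have h4 := le_abs_self R
      have h5 := le_abs_self R'
      rw [hR u (by linarith), hR' u (by linarith)]
      simp
  rw [integral_sub i2' (i0.const_mul 2), integral_const_mul, sub_zero, sub_eq_zero] at key
  have e3 : ∫ u in Ioi (0 : ℝ), -(2 * deriv (deriv f) u / u)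
      = -2 * ∫ u in Ioi (0 : ℝ), deriv (deriv f) u / u := by
    rw [← integral_const_mul]
    congr 1
    funext u
    ring
  rw [e2, e3, key]
  ring

end CompactSupport

/-! ### The contribution of a function vanishing near the origin. -/

section VanishingNearZero

variable {f g : ℝ → ℝ} {ρ : ℝ}

theorem exists_dist_of_abs_lt (hf0 : ∀ u, |u| < ρ → f u = 0) {z : ℂ} (y : ℝ)
    (hy : f y ≠ 0) : ρ - ‖z‖ ≤ ‖z - y‖ := by
  have h1 : ρ ≤ |y| := le_of_not_gt fun h => hy (hf0 y h)
  have h2 := norm_sub_norm_le (y : ℂ) z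
  rw [Complex.norm_real, Real.norm_eq_abs, norm_sub_rev] at h2
  linarith

/-- In a gap of the support the Cauchy integral is holomorphic across the real line, so its boundary
values are its values. In particular `H(f)` is smooth there. -/
theorem H1Pair.boundary_eq_cauchy (h : H1Pair f g) (hf0 : ∀ u, |u| < ρ → f u = 0) {x : ℝ}
    (hx : |x| < ρ) : boundary f x = cauchy f x := by
  have hx' : ‖(x : ℂ)‖ < ρ := by simpa using hx
  have hd := differentiableAt_cauchy h.memLp (z := x) (sub_pos.2 hx')
    (exists_dist_of_abs_lt hf0)
  refine h.boundary_eq (G := cauchy f) (fun _ _ => rfl) ?_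
  have h1 : Tendsto (fun η : ℝ => (x : ℂ) + η * Complex.I) (𝓝[>] 0)
      (𝓝 ((x : ℂ) + (0 : ℝ) * Complex.I)) :=
    (Continuous.tendsto (by fun_prop) (0 : ℝ)).mono_left nhdsWithin_le_nhds
  rw [Complex.ofReal_zero, zero_mul, add_zero] at h1
  exact hd.continuousAt.tendsto.comp h1

theorem H1Pair.contDiffAt_hilbert_of_zero (h : H1Pair f g) (hρ : 0 < ρ)
    (hf0 : ∀ u, |u| < ρ → f u = 0) (m : ℕ) : ContDiffAt ℝ m (hilbertTransform f) 0 := by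
  have hd : DifferentiableOn ℂ (cauchy f) (Metric.ball 0 ρ) := by
    intro z hz
    have hz' : ‖z‖ < ρ := by simpa using hz
    exact (differentiableAt_cauchy h.memLp (sub_pos.2 hz')
      (exists_dist_of_abs_lt hf0)).differentiableWithinAt
  have hc : ContDiffAt ℂ m (cauchy f) ((0 : ℝ) : ℂ) := by
    rw [Complex.ofReal_zero]
    exact (hd.contDiffOn Metric.isOpen_ball).contDiffAt (Metric.ball_mem_nhds 0 hρ)
  have hr : ContDiffAt ℝ m (fun x : ℝ => (cauchy f x).re) 0 :=
    Complex.reCLM.contDiff.contDiffAt.comp (0 : ℝ)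
      ((hc.restrict_scalars ℝ).comp (0 : ℝ) Complex.ofRealCLM.contDiff.contDiffAt)
  refine hr.congr_of_eventuallyEq ?_
  filter_upwards [Metric.ball_mem_nhds (0 : ℝ) hρ] with x hx
  rw [← h.boundary_eq_cauchy hf0 (by simpa using hx)]
  rfl

/-- Folded, the integrand is `2u(-f(u))/(u² - x²)`, supported in `u ≥ ρ > |x|` and increasing in
`x²`. -/
theorem H1Pair.hilbert_ge_of_zero (h : H1Pair f g) (hodd : Function.Odd f)
    (hneg : ∀ u > 0, f u ≤ 0) (hf0 : ∀ u, |u| < ρ → f u = 0) {x : ℝ} (hx : |x| < ρ) :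
    hilbertTransform f 0 ≤ hilbertTransform f x := by
  have hρ : 0 < ρ := (abs_nonneg x).trans_lt hx
  have key : ∀ y : ℝ, |y| < ρ → IntegrableOn (fun u => 2 * u * f u / (y ^ 2 - u ^ 2)) (Ioi 0) ∧
      hilbertTransform f y = (1 / Real.pi) * ∫ u in Ioi (0 : ℝ), 2 * u * f u / (y ^ 2 - u ^ 2) := by
    intro y hy
    have hy' : ‖(y : ℂ)‖ < ρ := by simpa using hy
    have hi := integrable_div h.memLp (z := y) (sub_pos.2 hy') (exists_dist_of_abs_lt hf0)
    have hr : Integrable fun u : ℝ => f u / (y - u) := by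
      refine (hi.re).congr (Eventually.of_forall fun u => ?_)
      simp only [RCLike.re_to_complex]
      norm_cast
    obtain ⟨i1, i2, e⟩ := integral_fold hr 0
    have e1 : ∀ u ∈ Ioi (0 : ℝ), f (0 - u) / (y - (0 - u)) + f (0 + u) / (y - (0 + u))
        = 2 * u * f u / (y ^ 2 - u ^ 2) := by
      intro u hu
      have hu' : (0 : ℝ) < u := hu
      rw [zero_sub, zero_add, hodd, sub_neg_eq_add]
      by_cases hfu : f u = 0
      · simp [hfu]
      have h1 : ρ ≤ u := by
        by_contra hlt
        exact hfu (hf0 u (by rw [abs_of_pos hu']; linarith))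
      have h2 := _root_.abs_lt.1 hy
      have h3 : y + u ≠ 0 := by linarith
      have h4 : y - u ≠ 0 := by linarith
      rw [sq_sub_sq]
      field_simp
      ring
    refine ⟨(i1.add i2).congr_fun e1 measurableSet_Ioi, ?_⟩
    rw [← setIntegral_congr_fun measurableSet_Ioi e1, ← e, ← boundary_re,
      h.boundary_eq_cauchy hf0 hy, cauchy, Complex.re_ofReal_mul]
    congr 1
    rw [← RCLike.re_to_complex, ← integral_re hi]
    congr 1
    funext u
    rw [RCLike.re_to_complex]
    norm_cast
  obtain ⟨i0, e0⟩ := key 0 (by simpa using hρ)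
  obtain ⟨ix, ex⟩ := key x hx
  rw [e0, ex]
  refine mul_le_mul_of_nonneg_left ?_ (by positivity)
  refine setIntegral_mono_on i0 ix measurableSet_Ioi fun u hu => ?_
  have hu' : (0 : ℝ) < u := hu
  by_cases hfu : f u = 0
  · simp [hfu]
  have h1 : ρ ≤ u := by
    by_contra hlt
    exact hfu (hf0 u (by rw [abs_of_pos hu']; linarith))
  have h2 : x ^ 2 < u ^ 2 := sq_lt_sq.2 (by rw [abs_of_pos hu']; linarith)
  have h3 : 0 ≤ 2 * u * (-f u) := by
    have := hneg u hu'
    have : 0 ≤ -f u := by linarith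
    positivity
  have e2 : ∀ y : ℝ, 2 * u * f u / (y ^ 2 - u ^ 2) = 2 * u * (-f u) / (u ^ 2 - y ^ 2) := by
    intro y
    rw [← neg_sub (u ^ 2), div_neg]; ring
  rw [e2, e2]
  refine div_le_div_of_nonneg_left h3 (by linarith) ?_
  nlinarith [sq_nonneg x]

/-- A negative second derivative would make the point a local maximum too; then `F` would be locally
constant, with second derivative zero. -/
theorem deriv_deriv_nonneg_of_isLocalMin {F : ℝ → ℝ} {x : ℝ} (hF : ContinuousAt F x)
    (hmin : IsLocalMin F x) : 0 ≤ deriv (deriv F) x := by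
  by_contra hlt
  have hmax := isLocalMax_of_deriv_deriv_neg (not_le.1 hlt) hmin.deriv_eq_zero hF
  have hconst : F =ᶠ[𝓝 x] fun _ => F x := by
    filter_upwards [hmin, hmax] with y h1 h2 using le_antisymm h2 h1
  have h1 := hconst.deriv.deriv_eq
  simp at h1
  linarith

end VanishingNearZero

/-! ### Regularity and convexity of `H(ω₀)` at the origin. -/

section LocalRegularity

variable {f g : ℝ → ℝ} {δ : ℝ}

/-- Splitting off the part of a function near the origin. -/
theorem exists_cutoff (hodd : Function.Odd f) (hneg : ∀ u > 0, f u < 0) (hδ : 0 < δ) {m : ℕ}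
    (hf : ContDiffOn ℝ m f (Ioo (-δ) δ)) :
    ∃ f₁ : ℝ → ℝ, ContDiff ℝ m f₁ ∧ HasCompactSupport f₁ ∧ Function.Odd f₁ ∧
      (∀ u > 0, f₁ u ≤ 0) ∧ (∀ u > 0, f u ≤ f₁ u) ∧ ∃ ρ > 0, ∀ u, |u| < ρ → f₁ u = f u := by
  let χ : ContDiffBump (0 : ℝ) := ⟨δ / 4, δ / 2, by positivity, by linarith⟩
  refine ⟨fun x => χ x * f x, ?_, ?_, ?_, ?_, ?_, δ / 4, by positivity, ?_⟩
  · refine contDiff_iff_contDiffAt.2 fun x => ?_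
    by_cases hx : x ∈ tsupport fun x => χ x * f x
    swap
    · exact contDiffAt_const.congr_of_eventuallyEq (notMem_tsupport_iff_eventuallyEq.1 hx)
    have hx1 : x ∈ tsupport χ := closure_mono (Function.support_mul_subset_left _ _) hx
    rw [χ.tsupport_eq, mem_closedBall_zero_iff, Real.norm_eq_abs] at hx1
    have hx2 : |x| < δ := hx1.trans_lt (by change δ / 2 < δ; linarith)
    exact χ.contDiff.contDiffAt.mul
      (hf.contDiffAt (isOpen_Ioo.mem_nhds (_root_.abs_lt.1 hx2)))
  · exact χ.hasCompactSupport.mul_right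
  · intro x
    simp only [χ.neg, hodd x]
    ring
  · intro u hu
    nlinarith [χ.nonneg (x := u), hneg u hu]
  · intro u hu
    nlinarith [χ.le_one (x := u), hneg u hu]
  · intro u hu
    have : χ u = 1 := χ.one_of_mem_closedBall (by
      rw [mem_closedBall_zero_iff, Real.norm_eq_abs]; exact hu.le)
    simp only [this, one_mul]

/-- Regularity of the Hilbert transform near the origin, and convexity there. -/
theorem hilbert_regular (h : H1Pair f g) (hodd : Function.Odd f) (hneg : ∀ u > 0, f u < 0)
    (hδ : 0 < δ) (hf : ContDiffOn ℝ 5 f (Ioo (-δ) δ)) (h0 : f 0 = 0) (h1 : deriv f 0 = 0)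
    (h2 : deriv (deriv f) 0 = 0) :
    ContDiffAt ℝ 4 (hilbertTransform f) 0 ∧ 0 < deriv (deriv (hilbertTransform f)) 0 := by
  -- The near part `f₁` contributes `-(4/π) ∫ f₁/u³ > 0` to the second derivative. The far part `f -
  -- f₁` is still nonpositive on the right, so its transform has a local minimum at `0` and
  -- contributes a nonnegative amount.
  obtain ⟨f₁, c1, hc, hodd1, hneg1, hle, ρ, hρ, heq⟩ := exists_cutoff (m := 5) hodd hneg hδ hf
  have p1 := H1Pair.of_contDiff (c1.of_le (by norm_num)) hc
  have p2 := h.sub p1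
  set f₂ : ℝ → ℝ := fun y => f y - f₁ y with hf₂
  have hodd2 : Function.Odd f₂ := fun x => by simp only [hf₂, hodd x, hodd1 x]; ring
  have hz2 : ∀ u, |u| < ρ → f₂ u = 0 := fun u hu => by simp only [hf₂, heq u hu, sub_self]
  have hneg2 : ∀ u > 0, f₂ u ≤ 0 := fun u hu => sub_nonpos.2 (hle u hu)
  have hsum : hilbertTransform f = fun x => hilbertTransform f₁ x + hilbertTransform f₂ x := by
    funext x
    rw [hf₂, hilbertTransform_sub h p1]
    ring
  have r1 : ContDiff ℝ 4 (hilbertTransform f₁) := contDiff_hilbertTransform 4 c1 hc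
  have r2 : ContDiffAt ℝ 4 (hilbertTransform f₂) 0 := p2.contDiffAt_hilbert_of_zero hρ hz2 4
  refine ⟨hsum ▸ r1.contDiffAt.add r2, ?_⟩
  have hev : f₁ =ᶠ[𝓝 0] f := by
    filter_upwards [Metric.ball_mem_nhds (0 : ℝ) hρ] with x hx
    exact heq x (by simpa using hx)
  have v1 : deriv f₁ 0 = 0 := hev.deriv_eq.trans h1
  have v2 : deriv (deriv f₁) 0 = 0 := hev.deriv.deriv_eq.trans h2
  obtain ⟨i3, e3⟩ := integral_deriv_deriv_div (c1.of_le (by norm_num)) hc hodd1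
    ((heq 0 (by simpa using hρ)).trans h0) v1 v2
  have dd1 : deriv (deriv (hilbertTransform f₁)) 0 = hilbertTransform (deriv (deriv f₁)) 0 := by
    rw [funext fun x => (hasDerivAt_hilbertTransform (c1.of_le (by norm_num)) hc x).deriv]
    have c2 : ContDiff ℝ 4 (deriv f₁) := contDiff_deriv (m := 4) c1
    exact (hasDerivAt_hilbertTransform (c2.of_le (by norm_num)) hc.deriv 0).deriv
  have pos1 : 0 < hilbertTransform (deriv (deriv f₁)) 0 := by
    rw [e3, neg_mul, ← mul_neg, ← integral_neg]
    refine mul_pos (by positivity) ?_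
    refine (setIntegral_pos_iff_support_of_nonneg_ae ?_ i3.neg).2 ?_
    rotate_left
    · refine lt_of_lt_of_le ?_ (measure_mono (s := Ioo 0 ρ) fun u hu => ⟨?_, hu.1⟩)
      · simp [hρ]
      · have h3 := hneg u hu.1
        rw [← heq u (by rw [abs_of_pos hu.1]; exact hu.2)] at h3
        exact neg_ne_zero.2 (div_ne_zero h3.ne (pow_ne_zero 3 hu.1.ne'))
    · refine (ae_restrict_iff' measurableSet_Ioi).2 (Eventually.of_forall fun u hu => ?_)
      have hu' : (0 : ℝ) < u := hu
      exact neg_nonneg.2 (div_nonpos_of_nonpos_of_nonneg (hneg1 u hu') (by positivity))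
  have nonneg2 : 0 ≤ deriv (deriv (hilbertTransform f₂)) 0 := by
    refine deriv_deriv_nonneg_of_isLocalMin r2.continuousAt ?_
    filter_upwards [Metric.ball_mem_nhds (0 : ℝ) hρ] with x hx
    exact p2.hilbert_ge_of_zero hodd2 hneg2 hz2 (by simpa using hx)
  have dsum : deriv (hilbertTransform f) =ᶠ[𝓝 0]
      fun x => deriv (hilbertTransform f₁) x + deriv (hilbertTransform f₂) x := by
    filter_upwards [r2.eventually (by simp)] with x hx
    rw [hsum]
    exact deriv_fun_add (r1.differentiable (by norm_num) x) (hx.differentiableAt (by norm_num))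
  rw [dsum.deriv_eq, deriv_fun_add, dd1]
  · linarith
  · exact (contDiff_deriv (m := 3) r1).differentiable (by norm_num) 0
  · exact (contDiffAt_deriv (m := 3) r2).differentiableAt (by norm_num)

end LocalRegularity

/-! ### The curve on which `t H(ω₀) = 2`. -/

section Radius

open Asymptotics

theorem isLittleO_sub_taylor {f : ℝ → ℝ} {m : ℕ} (hf : ContDiffAt ℝ m f 0) :
    (fun x => f x - ∑ k ∈ Finset.range (m + 1), iteratedDeriv k f 0 / k.factorial * x ^ k)
      =o[𝓝 0] fun x => x ^ m := by
  obtain ⟨u, hu, hfu⟩ := hf.contDiffOn le_rfl (by simp)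
  obtain ⟨ε, hε, hball⟩ := Metric.mem_nhds_iff.1 hu
  have h1 := taylor_isLittleO (convex_ball (0 : ℝ) ε) (Metric.mem_ball_self hε) (hfu.mono hball)
  rw [Metric.isOpen_ball.nhdsWithin_eq (Metric.mem_ball_self hε)] at h1
  refine h1.congr (fun x => ?_) (fun x => by rw [sub_zero])
  rw [taylor_within_apply]
  congr 1
  refine Finset.sum_congr rfl fun k _ => ?_
  rw [iteratedDerivWithin_of_isOpen Metric.isOpen_ball (Metric.mem_ball_self hε), sub_zero,
    smul_eq_mul]
  ring

theorem iteratedDeriv_eq_zero_of_even {f : ℝ → ℝ} (hf : Function.Even f) {k : ℕ} (hk : Odd k) :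
    iteratedDeriv k f 0 = 0 := by
  have h1 := iteratedDeriv_comp_neg k f 0
  rw [show (fun x => f (-x)) = f from funext hf, neg_zero, hk.neg_one_pow, neg_one_smul] at h1
  linarith

/-- Expansions of an even function and of its derivative. -/
theorem even_expansion {h : ℝ → ℝ} (hc : ContDiffAt ℝ 4 h 0) (heven : Function.Even h) :
    ∃ γ : ℝ, (fun x => h x - (h 0 + iteratedDeriv 2 h 0 / 2 * x ^ 2 + γ * x ^ 4))
        =o[𝓝 0] (fun x => x ^ 4) ∧
      (fun x => deriv h x - (iteratedDeriv 2 h 0 * x + 4 * γ * x ^ 3)) =o[𝓝 0] fun x => x ^ 3 := by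
  have h1 := iteratedDeriv_eq_zero_of_even heven (k := 1) (by decide)
  have h3 := iteratedDeriv_eq_zero_of_even heven (k := 3) (by decide)
  refine ⟨iteratedDeriv 4 h 0 / 24, ?_, ?_⟩
  · refine (isLittleO_sub_taylor (m := 4) hc).congr_left fun x => ?_
    simp only [Finset.sum_range_succ, Finset.sum_range_zero, h1, h3, iteratedDeriv_zero,
      Nat.factorial]
    push_cast
    ring
  · refine (isLittleO_sub_taylor (m := 3) (contDiffAt_deriv (m := 3) hc)).congr_left fun x => ?_
    simp only [Finset.sum_range_succ, Finset.sum_range_zero, ← iteratedDeriv_succ', h1, h3,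
      zero_add, Nat.reduceAdd, Nat.factorial]
    push_cast
    ring

variable {h : ℝ → ℝ} {a b γ : ℝ}

/-- The time scale `√(T - t)` as a function of the position where `h = 2 / t`. -/
noncomputable def timeScale (h : ℝ → ℝ) (a x : ℝ) : ℝ := √((h x - 2 * a) / (a * h x))

/-- These limits determine `r` and `r'` at the final time. In the last one the terms `4abx²` cancel,
which is why an expansion to fourth order is needed. -/
theorem expansion_limits (ha : 0 < a) (hc : ContDiffAt ℝ 4 h 0) (h0 : h 0 = 2 * a)
    (e0 : (fun x => h x - (2 * a + 2 * b * x ^ 2 + γ * x ^ 4)) =o[𝓝 0] fun x => x ^ 4)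
    (e1 : (fun x => deriv h x - (4 * b * x + 4 * γ * x ^ 3)) =o[𝓝 0] fun x => x ^ 3) :
    Tendsto (fun x => deriv h x / x) (𝓝[>] 0) (𝓝 (4 * b)) ∧
    Tendsto (fun x => timeScale h a x / x) (𝓝[>] 0) (𝓝 (√b / a)) ∧
    Tendsto (fun x => (a * x * deriv h x - h x * (h x - 2 * a)) / x ^ 4) (𝓝[>] 0)
      (𝓝 (2 * a * γ - 4 * b ^ 2)) := by
  have r0 := (e0.mono nhdsWithin_le_nhds).tendsto_div_nhds_zero (l := 𝓝[>] 0)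
  have r1 := (e1.mono nhdsWithin_le_nhds).tendsto_div_nhds_zero (l := 𝓝[>] 0)
  have hid : Tendsto (fun x : ℝ => x) (𝓝[>] 0) (𝓝 0) := nhdsWithin_le_nhds
  have hh : Tendsto h (𝓝[>] 0) (𝓝 (2 * a)) := h0 ▸ hc.continuousAt.tendsto.mono_left nhdsWithin_le_nhds
  have g2 : Tendsto (fun x => (h x - 2 * a) / x ^ 2) (𝓝[>] 0) (𝓝 (2 * b)) := by
    have := ((r0.mul (hid.pow 2)).add ((hid.pow 2).const_mul γ)).const_add (2 * b)
    simp only [ne_eq, OfNat.ofNat_ne_zero, not_false_eq_true, zero_pow, mul_zero, add_zero] at this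
    refine this.congr' ?_
    filter_upwards [self_mem_nhdsWithin] with x hx
    have : x ≠ 0 := (show (0 : ℝ) < x from hx).ne'
    field_simp
    ring
  refine ⟨?_, ?_, ?_⟩
  · have := ((r1.mul (hid.pow 2)).add ((hid.pow 2).const_mul (4 * γ))).const_add (4 * b)
    simp only [ne_eq, OfNat.ofNat_ne_zero, not_false_eq_true, zero_pow, mul_zero, add_zero] at this
    refine this.congr' ?_
    filter_upwards [self_mem_nhdsWithin] with x hx
    have : x ≠ 0 := (show (0 : ℝ) < x from hx).ne'
    field_simp
    ring
  · have h1 := (g2.div (hh.const_mul a) (by positivity)).sqrt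
    have e : √(2 * b / (a * (2 * a))) = √b / a := by
      rw [show 2 * b / (a * (2 * a)) = b / a ^ 2 by field_simp, Real.sqrt_div' _ (by positivity),
        Real.sqrt_sq ha.le]
    rw [e] at h1
    refine h1.congr' ?_
    filter_upwards [self_mem_nhdsWithin] with x hx
    have hx' : (0 : ℝ) < x := hx
    rw [timeScale, Pi.div_apply, div_right_comm, Real.sqrt_div' _ (by positivity), Real.sqrt_sq hx'.le]
  · have := (((r1.const_mul a).sub (r0.const_mul (2 * a))).sub (g2.pow 2)).add_const (2 * a * γ)
    have e : a * 0 - 2 * a * 0 - (2 * b) ^ 2 + 2 * a * γ = 2 * a * γ - 4 * b ^ 2 := by ring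
    rw [e] at this
    refine this.congr' ?_
    filter_upwards [self_mem_nhdsWithin] with x hx
    have : x ≠ 0 := (show (0 : ℝ) < x from hx).ne'
    field_simp
    ring

theorem exists_strictMonoOn (hb : 0 < b) (hc : ContDiffAt ℝ 4 h 0)
    (hlim : Tendsto (fun x => deriv h x / x) (𝓝[>] 0) (𝓝 (4 * b))) :
    ∃ d > 0, (∀ x ∈ Icc 0 d, HasDerivAt h (deriv h x) x ∧ ContinuousAt (deriv h) x) ∧
      (∀ x ∈ Ioc 0 d, 0 < deriv h x) ∧ StrictMonoOn h (Icc 0 d) := by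
  have p1 : ∀ᶠ x in 𝓝 (0 : ℝ), HasDerivAt h (deriv h x) x ∧ ContinuousAt (deriv h) x := by
    filter_upwards [hc.eventually (by simp)] with x hx
    exact ⟨(hx.differentiableAt (by norm_num)).hasDerivAt,
      (contDiffAt_deriv (m := 3) hx).continuousAt⟩
  have p2 : ∀ᶠ x in 𝓝 (0 : ℝ), x ∈ Ioi 0 → 0 < deriv h x := by
    refine eventually_nhdsWithin_iff.1 ?_
    filter_upwards [hlim.eventually (lt_mem_nhds (by positivity : 0 < 4 * b)),
      self_mem_nhdsWithin] with x hx hx0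
    exact (div_pos_iff_of_pos_right hx0).1 hx
  obtain ⟨ε, hε, hball⟩ := Metric.eventually_nhds_iff.1 (p1.and p2)
  have hin : ∀ x ∈ Icc 0 (ε / 2), dist x 0 < ε := fun x hx => by
    rw [Real.dist_eq, sub_zero, abs_of_nonneg hx.1]
    linarith [hx.2]
  refine ⟨ε / 2, by positivity, fun x hx => (hball (hin x hx)).1,
    fun x hx => (hball (hin x ⟨hx.1.le, hx.2⟩)).2 hx.1, ?_⟩
  refine strictMonoOn_of_deriv_pos (convex_Icc _ _)
    (fun x hx => (hball (hin x hx)).1.1.continuousAt.continuousWithinAt) fun x hx => ?_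
  rw [interior_Icc] at hx
  exact (hball (hin x ⟨hx.1.le, hx.2.le⟩)).2 hx.1

/-- A local inverse of a function which is strictly increasing to the right of the origin. -/
theorem exists_right_inverse {d : ℝ} (hd : 0 < d) (hder : ∀ x ∈ Icc 0 d, HasDerivAt h (deriv h x) x)
    (hpos : ∀ x ∈ Ioc 0 d, 0 < deriv h x) (hmono : StrictMonoOn h (Icc 0 d)) :
    ∃ Y : ℝ → ℝ, (∀ y ∈ Ioo (h 0) (h d), Y y ∈ Ioo 0 d ∧ h (Y y) = y ∧
      HasDerivAt Y (deriv h (Y y))⁻¹ y) ∧ Tendsto Y (𝓝[>] (h 0)) (𝓝[>] 0) := by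
  have hcont : ContinuousOn h (Icc 0 d) := fun x hx => (hder x hx).continuousAt.continuousWithinAt
  have hex : ∀ y ∈ Ioo (h 0) (h d), ∃ x ∈ Ioo 0 d, h x = y := fun y hy =>
    intermediate_value_Ioo hd.le hcont hy
  choose! Y hY using hex
  have h0d : h 0 < h d := hmono (left_mem_Icc.2 hd.le) (right_mem_Icc.2 hd.le) hd
  have hlt : ∀ y ∈ Ioo (h 0) (h d), ∀ x ∈ Icc 0 d, (x < Y y ↔ h x < y) ∧ (Y y < x ↔ y < h x) := by
    intro y hy x hx
    obtain ⟨h1, h2⟩ := hY y hy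
    have h3 := hmono.lt_iff_lt hx ⟨h1.1.le, h1.2.le⟩
    have h4 := hmono.lt_iff_lt ⟨h1.1.le, h1.2.le⟩ hx
    rw [h2] at h3 h4
    exact ⟨h3.symm, h4.symm⟩
  have hYc : ∀ y ∈ Ioo (h 0) (h d), ContinuousAt Y y := by
    intro y hy
    have hYy := (hY y hy).1
    refine tendsto_order.2 ⟨fun l hl => ?_, fun l hl => ?_⟩
    · obtain ⟨x, hx1, hx2⟩ := exists_between (max_lt hl hYy.1)
      have hx : x ∈ Icc 0 d := ⟨(le_max_right _ _).trans hx1.le, (hx2.trans hYy.2).le⟩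
      filter_upwards [Ioo_mem_nhds hy.1 hy.2,
        lt_mem_nhds (((hlt y hy x hx).1).1 hx2)] with w hw hw2
      exact (le_max_left _ _).trans_lt (hx1.trans (((hlt w hw x hx).1).2 hw2))
    · obtain ⟨x, hx1, hx2⟩ := exists_between (lt_min hl hYy.2)
      have hx : x ∈ Icc 0 d := ⟨(hYy.1.trans hx1).le, hx2.le.trans (min_le_right _ _)⟩
      filter_upwards [Ioo_mem_nhds hy.1 hy.2,
        gt_mem_nhds (((hlt y hy x hx).2).1 hx1)] with w hw hw2
      exact (((hlt w hw x hx).2).2 hw2).trans (hx2.trans_le (min_le_left _ _))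
  refine ⟨Y, fun y hy => ⟨(hY y hy).1, (hY y hy).2, ?_⟩, ?_⟩
  · have hYy := (hY y hy).1
    refine HasDerivAt.of_local_left_inverse (hYc y hy) (hder _ ⟨hYy.1.le, hYy.2.le⟩)
      (hpos _ ⟨hYy.1, hYy.2.le⟩).ne' ?_
    filter_upwards [Ioo_mem_nhds hy.1 hy.2] with w hw using (hY w hw).2
  · refine tendsto_nhdsWithin_iff.2 ⟨tendsto_order.2 ⟨fun l hl => ?_, fun l hl => ?_⟩, ?_⟩
    · filter_upwards [Ioo_mem_nhdsGT h0d] with w hw using hl.trans (hY w hw).1.1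
    · obtain ⟨x, hx1, hx2⟩ := exists_between (lt_min hl hd)
      have hx : x ∈ Icc 0 d := ⟨hx1.le, hx2.le.trans (min_le_right _ _)⟩
      have h0x : h 0 < h x := hmono (left_mem_Icc.2 hd.le) hx hx1
      filter_upwards [Ioo_mem_nhdsGT h0d, Ioo_mem_nhdsGT h0x] with w hw hw2
      exact (((hlt w hw x hx).2).2 hw2.2).trans (hx2.trans_le (min_le_left _ _))
    · filter_upwards [Ioo_mem_nhdsGT h0d] with w hw using (hY w hw).1.1

/-- The curve `x = r(t) √(T - t)` on which `h = 2 / t`. -/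
theorem exists_radius (ha : 0 < a) (hb : 0 < b) (hc : ContDiffAt ℝ 4 h 0) (h0 : h 0 = 2 * a)
    (e0 : (fun x => h x - (2 * a + 2 * b * x ^ 2 + γ * x ^ 4)) =o[𝓝 0] fun x => x ^ 4)
    (e1 : (fun x => deriv h x - (4 * b * x + 4 * γ * x ^ 3)) =o[𝓝 0] fun x => x ^ 3) :
    ∃ t₀ ∈ Ioo 0 (1 / a), ∃ r : ℝ → ℝ, ContDiffOn ℝ 1 r (Icc t₀ (1 / a)) ∧ r (1 / a) = a / √b ∧
      ∀ t ∈ Ico t₀ (1 / a), h (r t * √(1 / a - t)) = 2 / t := by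
  obtain ⟨l1, l2, l3⟩ := expansion_limits ha hc h0 e0 e1
  obtain ⟨d, hd, hder, hpos, hmono⟩ := exists_strictMonoOn hb hc l1
  obtain ⟨Y, hY, hY0⟩ := exists_right_inverse hd (fun x hx => (hder x hx).1) hpos hmono
  set T := 1 / a with hT
  have hT0 : 0 < T := by positivity
  have hd2 : d / 2 ∈ Icc 0 d := ⟨by positivity, by linarith⟩
  have hlt1 : h 0 < h (d / 2) := hmono (left_mem_Icc.2 hd.le) hd2 (by positivity)
  have hlt2 : h (d / 2) < h d := hmono hd2 (right_mem_Icc.2 hd.le) (by linarith)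
  rw [h0] at hlt1 hY hY0
  have hmem : ∀ t, 2 / h d < t → t < T → 2 / t ∈ Ioo (2 * a) (h d) := by
    intro t h1 h2
    have hhd : 0 < h d := by linarith
    have ht : 0 < t := lt_trans (by positivity) h1
    constructor
    · rw [lt_div_iff₀ ht]
      rw [hT, lt_div_iff₀ ha] at h2
      linarith
    · rw [div_lt_iff₀ ht]
      rw [div_lt_iff₀ hhd] at h1
      linarith
  -- The curve itself. Since `h(X) = 2/t`, solving for `t` gives `T - t = (h(X) - 2a)/(a h(X))`;
  -- hence `√(T - t)` is a function of the position, and limits in `t` become limits in `x`.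
  set X : ℝ → ℝ := fun t => Y (2 / t) with hX
  have hscale : ∀ t, 2 / h d < t → t < T → √(T - t) = timeScale h a (X t) := by
    intro t h1 h2
    have ht : 0 < t := lt_trans (by have : 0 < h d := by linarith
                                    positivity) h1
    rw [timeScale, hX]
    simp only [(hY _ (hmem t h1 h2)).2.1, hT]
    congr 1
    field_simp
  set r : ℝ → ℝ := fun t => if t < T then X t / √(T - t) else a / √b with hr
  set X' : ℝ → ℝ := fun t => (deriv h (X t))⁻¹ * (-2 / t ^ 2) with hX'
  set r' : ℝ → ℝ := fun t => (X' t * √(T - t) - X t * (-1 / (2 * √(T - t)))) / √(T - t) ^ 2 with hr'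
  have hXd : ∀ t, 2 / h d < t → t < T → HasDerivAt X (X' t) t := by
    intro t h1 h2
    have ht : 0 < t := lt_trans (by have : 0 < h d := by linarith
                                    positivity) h1
    have d1 : HasDerivAt (fun s : ℝ => 2 / s) (-2 / t ^ 2) t := by
      refine ((hasDerivAt_const t (2 : ℝ)).div (hasDerivAt_id t) ht.ne').congr_deriv ?_
      simp
    exact (hY _ (hmem t h1 h2)).2.2.comp t d1
  have hrd : ∀ t, 2 / h d < t → t < T → HasDerivAt r (r' t) t := by
    intro t h1 h2
    have d2 : HasDerivAt (fun s : ℝ => √(T - s)) (-1 / (2 * √(T - t))) t :=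
      ((hasDerivAt_id t).const_sub T).sqrt (sub_pos.2 h2).ne'
    refine ((hXd t h1 h2).div d2 (Real.sqrt_pos.2 (sub_pos.2 h2)).ne').congr_of_eventuallyEq ?_
    filter_upwards [gt_mem_nhds h2] with s hs
    exact if_pos hs
  have hr'c : ∀ t, 2 / h d < t → t < T → ContinuousAt r' t := by
    intro t h1 h2
    have ht : 0 < t := lt_trans (by have : 0 < h d := by linarith
                                    positivity) h1
    have hYm := (hY _ (hmem t h1 h2)).1
    have cX := (hXd t h1 h2).continuousAt
    have cd : ContinuousAt (fun t => deriv h (X t)) t :=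
      ContinuousAt.comp (f := X) (g := deriv h) (hder _ ⟨hYm.1.le, hYm.2.le⟩).2 cX
    have hsq : √(T - t) ≠ 0 := (Real.sqrt_pos.2 (sub_pos.2 h2)).ne'
    have cs : ContinuousAt (fun t => √(T - t)) t := by fun_prop
    have cX' : ContinuousAt X' t :=
      (cd.inv₀ (hpos _ ⟨hYm.1, hYm.2.le⟩).ne').mul
        (continuousAt_const.div (by fun_prop) (pow_ne_zero 2 ht.ne'))
    exact ((cX'.mul cs).sub (cX.mul (continuousAt_const.div (cs.const_mul 2)
      (mul_ne_zero two_ne_zero hsq)))).div (cs.pow 2) (pow_ne_zero 2 hsq)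
  have hXlim : Tendsto X (𝓝[<] T) (𝓝[>] 0) := by
    refine hY0.comp (tendsto_nhdsWithin_iff.2 ⟨?_, ?_⟩)
    · have h1 : Tendsto (fun t : ℝ => 2 / t) (𝓝[<] T) (𝓝 (2 / T)) :=
        (tendsto_const_nhds.div tendsto_id hT0.ne').mono_left nhdsWithin_le_nhds
      rwa [hT, div_div_eq_mul_div, div_one] at h1
    · filter_upwards [Ioo_mem_nhdsLT hT0] with t ht
      have h2 := ht.2
      rw [hT, lt_div_iff₀ ha] at h2
      rw [mem_Ioi, lt_div_iff₀ ht.1]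
      linarith
  have hdT : 2 / h d < T := by
    rw [hT, div_lt_div_iff₀ (by linarith) ha]; linarith
  have hev : ∀ᶠ t in 𝓝[<] T, 2 / h d < t ∧ t < T := Ioo_mem_nhdsLT hdT
  have hrlim : Tendsto r (𝓝[<] T) (𝓝 (a / √b)) := by
    have h1 := (l2.comp hXlim).inv₀ (div_pos (Real.sqrt_pos.2 hb) ha).ne'
    rw [inv_div] at h1
    refine h1.congr' ?_
    filter_upwards [hev] with t ht
    rw [hr]
    simp only [Function.comp, if_pos ht.2, hscale t ht.1 ht.2, inv_div]
  set L := (2 * a * γ - 4 * b ^ 2) / (2 * a * (4 * b) * (√b / a) ^ 3) with hL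
  have hr'lim : Tendsto r' (𝓝[<] T) (𝓝 L) := by
    have h1 := (l3.div ((l1.const_mul (2 * a)).mul (l2.pow 3)) (by
      have := Real.sqrt_pos.2 hb
      positivity)).comp hXlim
    refine h1.congr' ?_
    filter_upwards [hev] with t ht
    obtain ⟨⟨y1, y2⟩, y3, -⟩ := hY _ (hmem t ht.1 ht.2)
    have ht0 : 0 < t := lt_trans (by have : 0 < h d := by linarith
                                     positivity) ht.1
    have hs : 0 < √(T - t) := Real.sqrt_pos.2 (sub_pos.2 ht.2)
    have hs2 : √(T - t) ^ 2 = T - t := Real.sq_sqrt (sub_pos.2 ht.2).le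
    have hd' := hpos _ ⟨y1, y2.le⟩
    have hx0 : 0 < X t := y1
    have hd0 : 0 < deriv h (X t) := hd'
    have hh : h (X t) = 2 / t := y3
    simp only [Function.comp, Pi.div_apply, hr', hX', ← hscale t ht.1 ht.2, hh]
    set s := √(T - t)
    set x := X t
    set D := deriv h x
    have hta : a * t = 1 - a * s ^ 2 := by
      rw [hs2, hT]; field_simp; ring
    -- Identifies the numerator of the third limit of `expansion_limits` with that of `r'`, after
    -- eliminating `a` through `a t = 1 - a s²`.
    have e : a * x * D - 2 / t * (2 / t - 2 * a) = a * (x * D - 4 * s ^ 2 / t ^ 2) := by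
      field_simp
      linear_combination (4 : ℝ) * hta
    rw [e]
    field_simp
    ring
  have hdiff : ∀ t ∈ Icc (2 / h (d / 2)) T, HasDerivWithinAt r (if t < T then r' t else L)
      (Icc (2 / h (d / 2)) T) t := by
    intro t ht
    have hdd : 2 / h d < 2 / h (d / 2) := by
      rw [div_lt_div_iff₀ (by linarith) (by linarith)]; linarith
    rcases lt_or_eq_of_le ht.2 with h1 | h1
    · rw [if_pos h1]
      exact (hrd t (hdd.trans_le ht.1) h1).hasDerivWithinAt
    · rw [h1, if_neg (lt_irrefl T)]
      -- At the endpoint differentiability follows from continuity of `r` together with convergence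
      -- of `r'`.
      refine (hasDerivWithinAt_Iic_of_tendsto_deriv (s := Ioo (2 / h d) T)
        (fun t ht => (hrd t ht.1 ht.2).differentiableAt.differentiableWithinAt) ?_
        (Ioo_mem_nhdsLT hdT) ?_).mono Icc_subset_Iic_self
      · rw [ContinuousWithinAt, show r T = a / √b from if_neg (lt_irrefl T)]
        exact hrlim.mono_left (nhdsWithin_mono _ fun t ht => ht.2)
      · refine hr'lim.congr' ?_
        filter_upwards [hev] with t ht using (hrd t ht.1 ht.2).deriv.symm
  have ht0 : 2 / h (d / 2) < T := by
    rw [hT, div_lt_div_iff₀ (by linarith) ha]; linarith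
  -- Using `d / 2` instead of `d` leaves a margin, so that the closed interval up to `T` starts
  -- inside the range where the inverse is differentiable.
  refine ⟨2 / h (d / 2), ⟨div_pos two_pos (by linarith), ht0⟩, r, ?_, if_neg (lt_irrefl T), ?_⟩
  · have huniq := uniqueDiffOn_Icc ht0
    refine (contDiffOn_one_iff_derivWithin huniq).2
      ⟨fun t ht => (hdiff t ht).differentiableWithinAt, ?_⟩
    have hc' : ContinuousOn (fun t => if t < T then r' t else L) (Icc (2 / h (d / 2)) T) := by
      intro t ht
      have hdd : 2 / h d < 2 / h (d / 2) := by
        rw [div_lt_div_iff₀ (by linarith) (by linarith)]; linarith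
      rcases lt_or_eq_of_le ht.2 with h1 | h1
      · refine ((hr'c t (hdd.trans_le ht.1) h1).congr ?_).continuousWithinAt
        filter_upwards [gt_mem_nhds h1] with s hs
        exact (if_pos hs).symm
      · rw [h1]
        have : ContinuousWithinAt (fun t => if t < T then r' t else L) (Iio T) T := by
          rw [ContinuousWithinAt, if_neg (lt_irrefl T)]
          refine hr'lim.congr' ?_
          filter_upwards [self_mem_nhdsWithin] with s hs
          exact (if_pos hs).symm
        exact (continuousWithinAt_Iio_iff_Iic.1 this).mono Icc_subset_Iic_self
    exact hc'.congr fun t ht => (hdiff t ht).derivWithin (huniq t ht)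
  · intro t ht
    have hdd : 2 / h d < 2 / h (d / 2) := by
      rw [div_lt_div_iff₀ (by linarith) (by linarith)]; linarith
    have hs : 0 < √(T - t) := Real.sqrt_pos.2 (sub_pos.2 ht.2)
    rw [hr]
    simp only [if_pos ht.2, div_mul_cancel₀ _ hs.ne']
    exact (hY _ (hmem t (hdd.trans_le ht.1) ht.2)).2.1

end Radius

/-! ### Asymptotics of the rescaled formula. -/

section Asymptotics

open Asymptotics

variable {α : Type*} {l : Filter α} {s : α → ℝ}

theorem isBigO_div_pow {f : α → ℝ} {m k : ℕ} (hs0 : ∀ᶠ p in l, 0 < s p)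
    (hf : f =O[l] fun p => s p ^ (m + k)) : (fun p => f p / s p ^ m) =O[l] fun p => s p ^ k := by
  refine (hf.mul (isBigO_refl (fun p => (s p ^ m)⁻¹) l)).congr' (Eventually.of_forall fun p => ?_) ?_
  · exact (div_eq_mul_inv _ _).symm
  · filter_upwards [hs0] with p hp
    rw [pow_add]
    field_simp

/-- Writes the difference as `(p - q)/D - (D - E) q/(D E)`; the lower bound on `E` passes to `D`
with half the constant, since `D - E → 0`. -/
theorem isBigO_div_sub_div {p q D E : α → ℝ} (hs : Tendsto s l (𝓝 0))
    (hpq : (fun x => p x - q x) =O[l] s) (hDE : (fun x => D x - E x) =O[l] s)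
    (hq : q =O[l] fun _ => (1 : ℝ)) {m : ℝ} (hm : 0 < m) (hE : ∀ᶠ x in l, m ≤ E x) :
    (fun x => p x / D x - q x / E x) =O[l] s := by
  have hD : ∀ᶠ x in l, m / 2 ≤ D x := by
    have h0 : Tendsto (fun x => D x - E x) l (𝓝 0) := hDE.trans_tendsto hs
    filter_upwards [hE, h0.eventually (lt_mem_nhds (by linarith : -(m / 2) < 0))] with x h1 h2
    linarith
  have hDi : (fun x => (D x)⁻¹) =O[l] fun _ => (1 : ℝ) := by
    refine IsBigO.of_bound (m / 2)⁻¹ ?_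
    filter_upwards [hD] with x hx
    rw [norm_one, mul_one, norm_inv, Real.norm_of_nonneg (by linarith)]
    exact inv_anti₀ (by positivity) hx
  have hEi : (fun x => (E x)⁻¹) =O[l] fun _ => (1 : ℝ) := by
    refine IsBigO.of_bound m⁻¹ ?_
    filter_upwards [hE] with x hx
    rw [norm_one, mul_one, norm_inv, Real.norm_of_nonneg (by linarith)]
    exact inv_anti₀ hm hx
  have key := (hpq.mul hDi).sub ((((hDE.mul hq).mul hDi).mul hEi).congr_right
    fun x => by rw [mul_one, mul_one])
  simp only [mul_one] at key
  refine key.congr' ?_ EventuallyEq.rfl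
  filter_upwards [hE, hD] with x h1 h2
  have h3 : E x ≠ 0 := by linarith
  have h4 : D x ≠ 0 := by linarith
  field_simp
  ring

theorem isBigO_pow_sub_pow {y : α → ℝ} {ρ : ℝ} (hs : Tendsto s l (𝓝 0))
    (hy : (fun p => y p - ρ) =O[l] s) (m : ℕ) : (fun p => y p ^ m - ρ ^ m) =O[l] s := by
  have hlim : Tendsto y l (𝓝 ρ) := tendsto_sub_nhds_zero_iff.1 (hy.trans_tendsto hs)
  exact ((hasDerivAt_pow m ρ).isBigO_sub.comp_tendsto hlim).trans hy

variable {F h : ℝ → ℝ} {a b c γ : ℝ}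

/-- Second order remainder estimate for differences. -/
theorem exists_remainder_bound (hc : ContDiffAt ℝ 4 h 0)
    (e1 : (fun x => deriv h x - (4 * b * x + 4 * γ * x ^ 3)) =o[𝓝 0] fun x => x ^ 3) :
    ∃ C, ∃ δ > 0, ∀ x y, |x| < δ → |y| < δ →
      |(h x - 2 * b * x ^ 2) - (h y - 2 * b * y ^ 2)| ≤ C * (|x| + |y|) ^ 2 * |x - y| := by
  have h3 : (fun x : ℝ => x ^ 3) =O[𝓝 0] fun x => x ^ 2 :=
    (isLittleO_pow_pow (by norm_num : 2 < 3)).isBigO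
  have hO : (fun x => deriv h x - 4 * b * x) =O[𝓝 0] fun x => x ^ 2 := by
    refine ((e1.isBigO.trans h3).add (h3.const_mul_left (4 * γ))).congr_left fun x => ?_
    ring
  obtain ⟨C, hC0, hC⟩ := hO.exists_nonneg
  rw [IsBigOWith] at hC
  have hd : ∀ᶠ x in 𝓝 (0 : ℝ), DifferentiableAt ℝ h x := by
    filter_upwards [hc.eventually (by simp)] with x hx using hx.differentiableAt (by norm_num)
  obtain ⟨δ, hδ, hball⟩ := Metric.eventually_nhds_iff.1 (hC.and hd)
  refine ⟨C, δ, hδ, fun x y hx hy => ?_⟩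
  set M := max |x| |y|
  have hM : M < δ := max_lt hx hy
  have key := (convex_Icc (-M) M).norm_image_sub_le_of_norm_hasDerivWithin_le
    (f := fun x => h x - 2 * b * x ^ 2) (f' := fun x => deriv h x - 4 * b * x)
    (C := C * (|x| + |y|) ^ 2) (x := y) (y := x) ?_ ?_ ?_ ?_
  · simpa using key
  · intro w hw
    have hw' : dist w 0 < δ := by
      rw [Real.dist_eq, sub_zero]; exact (_root_.abs_le.2 hw).trans_lt hM
    refine (((hball hw').2.hasDerivAt.sub ((hasDerivAt_pow 2 w).const_mul (2 * b))).congr_deriv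
      ?_).hasDerivWithinAt
    push_cast; ring
  · intro w hw
    have hw1 := _root_.abs_le.2 hw
    have hw' : dist w 0 < δ := by rw [Real.dist_eq, sub_zero]; exact hw1.trans_lt hM
    refine (hball hw').1.trans ?_
    rw [norm_pow, Real.norm_eq_abs]
    have : |w| ≤ |x| + |y| := hw1.trans (max_le_add_of_nonneg (abs_nonneg x) (abs_nonneg y))
    gcongr
  · exact _root_.abs_le.1 (le_max_right _ _)
  · exact _root_.abs_le.1 (le_max_left _ _)

/-- The rescaled solution converges to the rescaled profile. -/
theorem rescaled_isBigO {n : ℕ} (hn : 1 ≤ n) (ha : 0 < a) (hb : 0 < b) (hc0 : 0 < c)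
    (hF : (fun x => F x + 4 * c * x ^ (2 * n + 1)) =O[𝓝 0] fun x => x ^ (2 * n + 2))
    (hc : ContDiffAt ℝ 4 h 0) (h0 : h 0 = 2 * a)
    (e1 : (fun x => deriv h x - (4 * b * x + 4 * γ * x ^ 3)) =o[𝓝 0] fun x => x ^ 3)
    {t x X : α → ℝ} (hs : Tendsto s l (𝓝 0)) (hs0 : ∀ᶠ p in l, 0 < s p)
    (ht : ∀ᶠ p in l, t p = 1 / a - s p ^ 2)
    (hX : (fun p => X p - a / √b * s p) =O[l] fun p => s p ^ 2)
    (hx : (fun p => x p - X p) =O[l] fun p => s p ^ (2 * n))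
    (hhX : ∀ᶠ p in l, t p * h (X p) = 2) :
    ((fun p => s p ^ (2 * n + 1) *
        (4 * F (x p) / ((2 - t p * h (x p)) ^ 2 + t p ^ 2 * F (x p) ^ 2))
      - 4 * (-4 * c * (a / √b) ^ (2 * n + 1)) /
        (16 * b * ((x p - X p) / s p ^ (2 * n)) ^ 2
          + (4 * c * (a / √b) ^ (2 * n + 1)) ^ 2 / a ^ 2)) =O[l] s) ∧
    ((fun p => s p ^ (2 * n + 1) *
        (2 * (h (x p) * (2 - t p * h (x p)) - t p * F (x p) ^ 2)
          / ((2 - t p * h (x p)) ^ 2 + t p ^ 2 * F (x p) ^ 2))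
      - 4 * a * (-4 * √b * ((x p - X p) / s p ^ (2 * n))) /
        (16 * b * ((x p - X p) / s p ^ (2 * n)) ^ 2
          + (4 * c * (a / √b) ^ (2 * n + 1)) ^ 2 / a ^ 2)) =O[l] s) := by
  have hsb : 0 < √b := Real.sqrt_pos.2 hb
  have hsb2 : √b ^ 2 = b := Real.sq_sqrt hb.le
  set ρ := a / √b with hρ
  have hρ0 : 0 < ρ := div_pos ha hsb
  have s1 : s =O[l] fun _ => (1 : ℝ) := hs.isBigO_one ℝ
  have spow : ∀ {i j : ℕ}, i ≤ j → (fun p => s p ^ j) =O[l] fun p => s p ^ i := by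
    intro i j hij
    have := (isBigO_refl (fun p => s p ^ i) l).mul (s1.pow (j - i))
    simp only [← pow_add, Nat.add_sub_cancel' hij, one_pow, mul_one] at this
    exact this
  have s2 : (fun p => s p ^ 2) =O[l] s := by simpa using spow (i := 1) (j := 2) (by norm_num)
  have hx2 : (fun p => x p - X p) =O[l] fun p => s p ^ 2 := hx.trans (spow (by omega))
  have hxρ : (fun p => x p - ρ * s p) =O[l] fun p => s p ^ 2 :=
    (hx2.add hX).congr_left fun p => by ring
  have sρ : (fun p => ρ * s p) =O[l] s := (isBigO_refl s l).const_mul_left ρ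
  have hXs : X =O[l] s := ((hX.trans s2).add sρ).congr_left fun p => by ring
  have hxs : x =O[l] s := ((hxρ.trans s2).add sρ).congr_left fun p => by ring
  have hx0 : Tendsto x l (𝓝 0) := hxs.trans_tendsto hs
  have hX0 : Tendsto X l (𝓝 0) := hXs.trans_tendsto hs
  have htO : (fun p => t p - 1 / a) =O[l] fun p => s p ^ 2 :=
    (isBigO_refl (fun p => s p ^ 2) l).neg_left.congr' (ht.mono fun p hp => by
      simp only [hp]; ring) EventuallyEq.rfl
  have t1 : t =O[l] fun _ => (1 : ℝ) := by
    have q := (s1.pow 2).congr_right fun _ => one_pow 2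
    exact ((htO.trans q).add (isBigO_const_const (1 / a) one_ne_zero l)).congr_left fun p => by ring
  have hz : (fun p => (x p - X p) / s p ^ (2 * n)) =O[l] fun _ => (1 : ℝ) := by
    have := isBigO_div_pow (k := 0) hs0 (by simpa using hx)
    simpa using this
  have hhx : (fun p => h (x p) - 2 * a) =O[l] s := by
    have := ((hc.differentiableAt (by norm_num)).hasDerivAt.isBigO_sub.comp_tendsto hx0)
    rw [h0] at this
    exact (this.congr_right fun p => sub_zero _).trans hxs
  set z := fun p => (x p - X p) / s p ^ (2 * n) with hzdef
  -- Both squares in the denominator have natural size `s^(2(2n+1))`; `u` and `v` are the rescaled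
  -- quantities, with leading terms `-4√b z` and `-4cρ^(2n+1)`.
  set u := fun p => (2 - t p * h (x p)) / s p ^ (2 * n + 1) with hu
  set v := fun p => F (x p) / s p ^ (2 * n + 1) with hv
  have hu0 : (fun p => u p - (-4 * √b * z p)) =O[l] s := by
    obtain ⟨C, δ, hδ, hC⟩ := exists_remainder_bound hc e1
    -- As `t h(X) = 2`, the quantity `2 - t h(x)` is `t (h(X) - h(x))`. Beyond the quadratic term
    -- the difference is `O(s² · s^(2n))`, one power of `s` better than the scale.
    have k1 : (fun p => (h (x p) - 2 * b * x p ^ 2) - (h (X p) - 2 * b * X p ^ 2))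
        =O[l] fun p => s p ^ (2 * n + 1 + 1) := by
      have q1 : (fun p => (h (x p) - 2 * b * x p ^ 2) - (h (X p) - 2 * b * X p ^ 2))
          =O[l] fun p => (|x p| + |X p|) ^ 2 * |x p - X p| := by
        refine IsBigO.of_bound C ?_
        have hxδ := hx0.abs.eventually (gt_mem_nhds (by simpa using hδ))
        have hXδ := hX0.abs.eventually (gt_mem_nhds (by simpa using hδ))
        filter_upwards [hxδ, hXδ] with p h1 h2
        rw [Real.norm_eq_abs, Real.norm_of_nonneg (by positivity), ← mul_assoc]
        exact hC _ _ h1 h2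
      refine q1.trans ((((hxs.abs_left.add hXs.abs_left).pow 2).mul hx.abs_left).congr_right
        fun p => ?_)
      rw [← pow_add]
      congr 1
      omega
    -- The quadratic term factors as `-2bt(x - X)(x + X)`; here `t(x + X)` is replaced by `2ρs/a` up
    -- to `O(s²)`, and `bρ/a = √b`.
    have k2 : (fun p => -2 * b * t p * (x p + X p - 2 * (ρ * s p))
        - 4 * b * ρ * (s p * (t p - 1 / a))) =O[l] fun p => s p ^ (1 + 1) := by
      have q1 := (t1.const_mul_left (-2 * b)).mul (hxρ.add hX)
      have q2 := ((s1.mul htO).const_mul_left (4 * b * ρ))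
      refine (q1.sub (q2.congr_right fun p => by simp)).congr (fun p => by ring) fun p => by simp
    have k3 := hz.mul (isBigO_div_pow (m := 1) (k := 1) hs0 k2)
    have k4 := t1.mul (isBigO_div_pow (m := 2 * n + 1) (k := 1) hs0 k1)
    simp only [one_mul, pow_one] at k3 k4
    refine (k3.sub k4).congr' ?_ EventuallyEq.rfl
    filter_upwards [hs0, hhX] with p hp hpX
    have hpos : (0 : ℝ) < s p ^ (2 * n) := by positivity
    have e2 : b * ρ / a = √b := by
      rw [hρ]
      field_simp
      exact hsb2.symm
    simp only [hu, hzdef]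
    have e3 : (2 : ℝ) - t p * h (x p) = t p * h (X p) - t p * h (x p) := by rw [hpX]
    rw [e3, pow_succ, ← e2]
    field_simp
    ring
  have hv0 : (fun p => v p - -4 * c * ρ ^ (2 * n + 1)) =O[l] s := by
    have q1 : (fun p => F (x p) + 4 * c * x p ^ (2 * n + 1)) =O[l]
        fun p => s p ^ (2 * n + 1 + 1) := (hF.comp_tendsto hx0).trans (hxs.pow (2 * n + 2))
    have q2 := isBigO_div_pow (m := 2 * n + 1) (k := 1) hs0 q1
    have q3 : (fun p => (x p - ρ * s p) / s p ^ 1) =O[l] fun p => s p ^ 1 :=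
      isBigO_div_pow (m := 1) (k := 1) hs0 hxρ
    simp only [pow_one] at q2 q3
    have q4 : (fun p => x p / s p - ρ) =O[l] s := by
      refine q3.congr' ?_ EventuallyEq.rfl
      filter_upwards [hs0] with p hp
      field_simp
    have q5 := (isBigO_pow_sub_pow hs q4 (2 * n + 1)).const_mul_left (4 * c)
    refine (q2.sub q5).congr_left fun p => ?_
    simp only [hv]
    rw [div_pow]
    ring
  set v₀ := -4 * c * ρ ^ (2 * n + 1) with hv₀
  have hv₀0 : v₀ ≠ 0 := by rw [hv₀]; have := pow_pos hρ0 (2 * n + 1); nlinarith [mul_pos hc0 this]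
  have hE : ∀ p, 16 * b * z p ^ 2 + (4 * c * ρ ^ (2 * n + 1)) ^ 2 / a ^ 2
      = (-4 * √b * z p) ^ 2 + (1 / a) ^ 2 * v₀ ^ 2 := by
    intro p
    rw [hv₀]
    linear_combination (-16 * z p ^ 2) * hsb2
  have hm : 0 < (1 / a) ^ 2 * v₀ ^ 2 := by positivity
  have hEm : ∀ᶠ p in l, (1 / a) ^ 2 * v₀ ^ 2 ≤ (-4 * √b * z p) ^ 2 + (1 / a) ^ 2 * v₀ ^ 2 :=
    Eventually.of_forall fun p => by nlinarith [sq_nonneg (-4 * √b * z p)]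
  have z1 : (fun p => -4 * √b * z p) =O[l] fun _ => (1 : ℝ) := hz.const_mul_left _
  have one1 : ∀ r : ℝ, (fun _ : α => r) =O[l] fun _ => (1 : ℝ) := fun r =>
    isBigO_const_const r one_ne_zero l
  have u1 : u =O[l] fun _ => (1 : ℝ) := ((hu0.trans s1).add z1).congr_left fun p => by ring
  have v1 : v =O[l] fun _ => (1 : ℝ) := ((hv0.trans s1).add (one1 v₀)).congr_left fun p => by ring
  have htO1 := htO.trans s2
  have hD : (fun p => (u p ^ 2 + t p ^ 2 * v p ^ 2)
      - ((-4 * √b * z p) ^ 2 + (1 / a) ^ 2 * v₀ ^ 2)) =O[l] s := by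
    have d1 := hu0.mul (u1.add z1)
    have d2 := (htO1.mul (t1.add (one1 (1 / a)))).mul (v1.mul v1)
    have d3 := (hv0.mul (v1.add (one1 v₀))).const_mul_left ((1 / a) ^ 2)
    simp only [mul_one] at d1 d2 d3
    exact ((d1.add d2).add d3).congr_left fun p => by ring
  have hDeq : ∀ p, 0 < s p → (2 - t p * h (x p)) ^ 2 + t p ^ 2 * F (x p) ^ 2
      = (s p ^ (2 * n + 1)) ^ 2 * (u p ^ 2 + t p ^ 2 * v p ^ 2) := by
    intro p hp
    simp only [hu, hv]
    field_simp
  constructor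
  · have hp := hv0.const_mul_left 4
    have := isBigO_div_sub_div (p := fun p => 4 * v p) (q := fun _ => 4 * v₀) hs
      (hp.congr_left fun p => by ring) hD (one1 _) hm hEm
    refine this.congr' ?_ EventuallyEq.rfl
    filter_upwards [hs0] with p hp
    rw [hE, hDeq p hp]
    congr 1
    simp only [hv]
    field_simp
  · have n1 := (hhx.mul u1).const_mul_left 2
    have n2 := hu0.const_mul_left (4 * a)
    have n3 := ((t1.mul ((spow (i := 1) (j := 2 * n + 1) (by omega)))).mul (v1.mul v1)).const_mul_left 2
    simp only [mul_one, one_mul, pow_one] at n1 n2 n3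
    -- The term with `v²` carries an extra `s^(2n+1)`, so only `h u`, with `h` close to `2a`,
    -- survives in the limit.
    have hnum : (fun p => (2 * (h (x p) * u p - t p * s p ^ (2 * n + 1) * v p ^ 2))
        - 4 * a * (-4 * √b * z p)) =O[l] s :=
      ((n1.add n2).sub n3).congr_left fun p => by ring
    have := isBigO_div_sub_div (q := fun p => 4 * a * (-4 * √b * z p)) hs hnum hD
      (z1.const_mul_left (4 * a)) hm hEm
    refine this.congr' ?_ EventuallyEq.rfl
    filter_upwards [hs0] with p hp
    rw [hE, hDeq p hp]
    congr 1
    simp only [hu, hv]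
    field_simp

end Asymptotics

/-! ### The Lorentzian profile and its Hilbert transform. -/

section Profile

variable {κ : ℝ}

theorem h1Pair_lorentzian (hκ : 0 < κ) :
    H1Pair (fun x => κ / (κ ^ 2 + x ^ 2)) (fun x => -(2 * κ * x) / (κ ^ 2 + x ^ 2) ^ 2) := by
  have hpos : ∀ x : ℝ, 0 < κ ^ 2 + x ^ 2 := fun x => by positivity
  have hi : Integrable fun x : ℝ => (κ ^ 2 + x ^ 2)⁻¹ := by
    simpa [add_comm] using (integrable_sq_kernel 0 hκ).1
  have hk : MemLp (fun x : ℝ => (κ ^ 2 + x ^ 2)⁻¹) 2 := by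
    have hm : Continuous fun x : ℝ => (κ ^ 2 + x ^ 2)⁻¹ :=
      Continuous.inv₀ (by fun_prop) fun x => (hpos x).ne'
    refine (memLp_two_iff_integrable_sq hm.aestronglyMeasurable).2 ?_
    refine (hi.const_mul (κ ^ 2)⁻¹).mono' (hm.pow 2).aestronglyMeasurable
      (Eventually.of_forall fun x => ?_)
    rw [Real.norm_of_nonneg (by positivity), pow_two]
    have := hpos x
    gcongr
    nlinarith [sq_nonneg x]
  have hcd : Continuous fun x : ℝ => -(2 * κ * x) / (κ ^ 2 + x ^ 2) ^ 2 :=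
    Continuous.div (by fun_prop) (by fun_prop) fun x => pow_ne_zero 2 (hpos x).ne'
  refine ⟨by simpa only [div_eq_mul_inv] using hk.const_mul κ,
    hk.of_le hcd.aestronglyMeasurable (Eventually.of_forall fun x => ?_), fun x y => ?_⟩
  · have h1 := hpos x
    rw [Real.norm_eq_abs, abs_div, abs_neg, Real.norm_of_nonneg (by positivity),
      abs_of_pos (pow_pos h1 2), div_le_iff₀ (pow_pos h1 2), pow_two (κ ^ 2 + x ^ 2), inv_mul_cancel_left₀ h1.ne']
    rw [_root_.abs_le]
    constructor <;> nlinarith [sq_nonneg (κ - x), sq_nonneg (κ + x)]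
  · refine (intervalIntegral.integral_eq_sub_of_hasDerivAt
      (f := fun x : ℝ => κ / (κ ^ 2 + x ^ 2)) (fun t _ => ?_)
      (hcd.intervalIntegrable _ _)).symm
    refine ((hasDerivAt_const t κ).div ((hasDerivAt_pow 2 t).const_add (κ ^ 2))
      (hpos t).ne').congr_deriv ?_
    push_cast
    ring

/-- The function `C/(z + iκ)` has its pole in the lower half-plane and imaginary part `-Cκ/(κ² +
x²)` on the real line, so it is the Cauchy integral of the Lorentzian. -/
theorem boundary_lorentzian (hκ : 0 < κ) (C x : ℝ) :
    boundary (fun x => C * (κ / (κ ^ 2 + x ^ 2))) x = C / (x + κ * Complex.I) := by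
  have hw := (h1Pair_lorentzian hκ).const_mul C
  have hlow : ∀ z : ℂ, 0 ≤ z.im → κ ≤ ‖z + κ * Complex.I‖ := by
    intro z hz
    have h1 := (le_abs_self _).trans (Complex.abs_im_le_norm (z + κ * Complex.I))
    simp at h1
    linarith
  have hne : ∀ z : ℂ, 0 ≤ z.im → z + κ * Complex.I ≠ 0 := fun z hz =>
    norm_pos_iff.1 (hκ.trans_le (hlow z hz))
  refine hw.boundary_eq (G := fun z : ℂ => C / (z + κ * Complex.I)) (fun z hz => ?_) ?_
  · refine eq_cauchy_of_im_boundary (G := fun z : ℂ => C / (z + κ * Complex.I)) hw (M := |C| / κ) ?_ ?_ ?_ ?_ hz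
    · intro z hz
      have hd : DifferentiableAt ℂ (fun z : ℂ => z + κ * Complex.I) z := by fun_prop
      exact ((differentiableAt_const (C : ℂ)).div hd (hne z (le_of_lt hz))).differentiableWithinAt
    · intro z hz
      rw [norm_div, Complex.norm_real, Real.norm_eq_abs]
      have := hlow z hz.le
      gcongr
    · have h1 : Tendsto (fun η : ℝ => |C| / η) atTop (𝓝 0) :=
        Tendsto.const_div_atTop tendsto_id _
      refine squeeze_zero_norm' ?_ h1
      filter_upwards [eventually_gt_atTop 0] with η hη
      rw [norm_div, Complex.norm_real, Real.norm_eq_abs]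
      have h2 : η ≤ ‖(η * Complex.I + κ * Complex.I : ℂ)‖ := by
        have h1 := (le_abs_self _).trans (Complex.abs_im_le_norm (η * Complex.I + κ * Complex.I))
        simp at h1
        linarith
      gcongr
    · intro ε hε
      have hlim : Tendsto (fun η : ℝ => |C| * η / (κ * κ)) (𝓝[>] 0) (𝓝 (|C| * 0 / (κ * κ))) :=
        (Continuous.tendsto (by fun_prop) 0).mono_left nhdsWithin_le_nhds
      rw [mul_zero, zero_div] at hlim
      filter_upwards [hlim.eventually (ge_mem_nhds hε), self_mem_nhdsWithin] with η h2 h3 x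
      have h3' : (0 : ℝ) < η := h3
      have hx0 : ((x : ℂ) + κ * Complex.I) ≠ 0 := hne x (by simp)
      have hxη : ((x : ℂ) + η * Complex.I + κ * Complex.I) ≠ 0 := hne _ (by simpa using h3'.le)
      have him : C * (κ / (κ ^ 2 + x ^ 2)) = -((C : ℂ) / (x + κ * Complex.I)).im := by
        rw [Complex.div_im, Complex.normSq_apply]
        simp
        ring
      rw [him, ← sub_eq_add_neg, ← Complex.sub_im]
      refine (Complex.abs_im_le_norm _).trans (le_trans ?_ h2)
      have e : (C : ℂ) / (x + η * Complex.I + κ * Complex.I) - C / (x + κ * Complex.I)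
          = -(C * (η * Complex.I))
            / ((x + η * Complex.I + κ * Complex.I) * (x + κ * Complex.I)) := by
        rw [div_sub_div _ _ hxη hx0]
        congr 1
        ring
      rw [e, norm_div, norm_neg, norm_mul, norm_mul, norm_mul, Complex.norm_real, Complex.norm_real,
        Complex.norm_I, mul_one, Real.norm_eq_abs, Real.norm_of_nonneg h3'.le]
      have h5 := hlow (x + η * Complex.I) (by simpa using h3'.le)
      have h6 := hlow x (by simp)
      gcongr
  · have h1 : ContinuousAt (fun η : ℝ => (C : ℂ) / (x + η * Complex.I + κ * Complex.I)) 0 :=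
      continuousAt_const.div (by fun_prop) (hne _ (by simp))
    have h2 := h1.tendsto.mono_left (nhdsWithin_le_nhds (s := Ioi 0))
    simpa using h2

theorem hasHilbertTransformAt_lorentzian (hκ : 0 < κ) (C x : ℝ) :
    HasHilbertTransformAt (fun x => C * (κ / (κ ^ 2 + x ^ 2))) x (C * (x / (κ ^ 2 + x ^ 2))) := by
  have h1 := ((h1Pair_lorentzian hκ).const_mul C).hasHilbertTransformAt x
  rw [← boundary_re, boundary_lorentzian hκ, Complex.div_re, Complex.normSq_apply] at h1
  convert h1 using 1
  simp
  ring

variable {a b c : ℝ}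

theorem profile_eq (hb : 0 < b) (n : ℕ) (a c z : ℝ) : profile n a b c z
    = -(a ^ (2 * n + 1) * √b ^ (2 * n + 1) * c) / (a ^ (4 * n) * c ^ 2 + b ^ (2 * n + 2) * z ^ 2) := by
  rw [profile, Real.rpow_div_two_eq_sqrt _ hb.le,
    show (2 * (n : ℝ) + 1) = ((2 * n + 1 : ℕ) : ℝ) by push_cast; ring, Real.rpow_natCast]

theorem profileH_eq (hb : 0 < b) (n : ℕ) (a c z : ℝ) : profileH n a b c z
    = -(a * √b ^ (4 * n + 3) * z) / (a ^ (4 * n) * c ^ 2 + b ^ (2 * n + 2) * z ^ 2) := by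
  rw [profileH, Real.rpow_div_two_eq_sqrt _ hb.le,
    show (4 * (n : ℝ) + 3) = ((4 * n + 3 : ℕ) : ℝ) by push_cast; ring, Real.rpow_natCast]

theorem hasHilbertTransformAt_profile (ha : 0 < a) (hb : 0 < b) (hc : 0 < c) (n : ℕ) (z : ℝ) :
    HasHilbertTransformAt (profile n a b c) z (profileH n a b c z) := by
  have hq : 0 < √b := Real.sqrt_pos.2 hb
  -- The width of the profile as a Lorentzian, `a^(2n) c/b^(n+1)`; its amplitude factor is `-a/√b`.
  have hκ : 0 < a ^ (2 * n) * c / √b ^ (2 * n + 2) := by positivity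
  have key := hasHilbertTransformAt_lorentzian hκ (-a / √b) z
  have hq2 : b = √b ^ 2 := (Real.sq_sqrt hb.le).symm
  convert key using 1
  · funext x
    rw [profile_eq hb]
    nth_rewrite 2 [hq2]
    generalize √b = q at *
    field_simp
    ring
  · rw [profileH_eq hb]
    nth_rewrite 2 [hq2]
    generalize √b = q at *
    field_simp
    ring

/-- The limit of the rescaled solution is the profile. -/
theorem profile_eq_limit (ha : 0 < a) (hb : 0 < b) (hc : 0 < c) (n : ℕ) (z : ℝ) :
    profile n a b c z = 4 * (-4 * c * (a / √b) ^ (2 * n + 1)) /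
        (16 * b * z ^ 2 + (4 * c * (a / √b) ^ (2 * n + 1)) ^ 2 / a ^ 2) := by
  have hq : 0 < √b := Real.sqrt_pos.2 hb
  have hq2 : b = √b ^ 2 := (Real.sq_sqrt hb.le).symm
  rw [profile_eq hb]
  nth_rewrite 2 [hq2]
  nth_rewrite 4 [hq2]
  generalize √b = q at *
  rw [div_pow, div_eq_div_iff (by positivity) (by positivity)]
  field_simp
  ring

theorem profileH_eq_limit (ha : 0 < a) (hb : 0 < b) (hc : 0 < c) (n : ℕ) (z : ℝ) :
    profileH n a b c z = 4 * a * (-4 * √b * z) /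
        (16 * b * z ^ 2 + (4 * c * (a / √b) ^ (2 * n + 1)) ^ 2 / a ^ 2) := by
  have hq : 0 < √b := Real.sqrt_pos.2 hb
  have hq2 : b = √b ^ 2 := (Real.sq_sqrt hb.le).symm
  rw [profileH_eq hb]
  nth_rewrite 2 [hq2]
  nth_rewrite 4 [hq2]
  generalize √b = q at *
  rw [div_pow, div_eq_div_iff (by positivity) (by positivity)]
  field_simp
  ring

end Profile

/-! ### The real form of the explicit solution. -/

section Solution

variable {f g : ℝ → ℝ} {T t : ℝ} {ω : ℝ → ℝ → ℝ}

/-- The explicit formula for every solution. -/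
theorem IsSolution.eq_formula (h : H1Pair f g) (hN : Nonvanishing f T) (hs : IsSolution f T ω)
    (ht : t ∈ Ico 0 T) (x : ℝ) :
    (2 - t * hilbertTransform f x) ^ 2 + t ^ 2 * f x ^ 2 ≠ 0 ∧
    ω t x = 4 * f x / ((2 - t * hilbertTransform f x) ^ 2 + t ^ 2 * f x ^ 2) ∧
    hilbertTransform (ω t) x
      = 2 * (hilbertTransform f x * (2 - t * hilbertTransform f x) - t * f x ^ 2)
        / ((2 - t * hilbertTransform f x) ^ 2 + t ^ 2 * f x ^ 2) := by
  have hmul := hs.boundary_mul h ht x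
  obtain ⟨κ, hκ, hb⟩ := hN t ht
  have hne : 1 - t * boundary f x / 2 ≠ 0 :=
    norm_pos_iff.1 (hκ.trans_le ((hb t (right_mem_Icc.2 ht.1)).2 x))
  have e : (t * boundary f x / 2 : ℂ) = ((t / 2 : ℝ) : ℂ) * boundary f x := by push_cast; ring
  rw [e] at hmul hne
  have hre := congrArg Complex.re hmul
  have him := congrArg Complex.im hmul
  simp only [Complex.mul_re, Complex.mul_im, Complex.sub_re, Complex.sub_im, Complex.one_re,
    Complex.one_im, Complex.ofReal_re, Complex.ofReal_im, boundary_re, boundary_im, zero_mul,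
    sub_zero, add_zero, zero_sub] at hre him
  have hD : (2 - t * hilbertTransform f x) ^ 2 + t ^ 2 * f x ^ 2 ≠ 0 := by
    intro h0
    have h1 : 2 - t * hilbertTransform f x = 0 := by nlinarith [sq_nonneg (t * f x)]
    have h2 : t * f x = 0 := by nlinarith [sq_nonneg (2 - t * hilbertTransform f x)]
    refine hne (Complex.ext ?_ ?_)
    · simp only [Complex.sub_re, Complex.one_re, Complex.re_ofReal_mul, boundary_re, Complex.zero_re]
      linarith
    · simp only [Complex.sub_im, Complex.one_im, Complex.im_ofReal_mul, boundary_im, Complex.zero_im]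
      linarith
  refine ⟨hD, ?_, ?_⟩
  · rw [eq_div_iff hD]
    linear_combination 2 * t * f x * hre - 2 * (2 - t * hilbertTransform f x) * him
  · rw [eq_div_iff hD]
    linear_combination 2 * (2 - t * hilbertTransform f x) * hre + 2 * t * f x * him

/-- For continuous `φ` the set where the essential bound holds is closed and of full measure, hence
dense, hence everything. -/
theorem enorm_le_eLpNorm_top {φ : ℝ → ℝ} (hφ : Continuous φ) (x : ℝ) :
    ‖φ x‖ₑ ≤ eLpNorm φ ⊤ volume := by
  rw [eLpNorm_exponent_top]
  have hae : ∀ᵐ y, ‖φ y‖ₑ ≤ eLpNormEssSup φ volume := ae_le_eLpNormEssSup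
  have hcl : IsClosed {y | ‖φ y‖ₑ ≤ eLpNormEssSup φ volume} :=
    isClosed_le hφ.enorm continuous_const
  have huniv := (Measure.dense_of_ae hae).closure_eq
  rw [hcl.closure_eq] at huniv
  have hx : x ∈ {y | ‖φ y‖ₑ ≤ eLpNormEssSup φ volume} := by rw [huniv]; exact mem_univ x
  exact hx

end Solution

/-! ### Blowup, two-scale asymptotics and assembly. -/

section Final

open Asymptotics

theorem isBigO_of_vanishing {f : ℝ → ℝ} {n : ℕ} {c : ℝ} (hf : ContDiffAt ℝ (2 * n + 2 : ℕ) f 0)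
    (hvanish : ∀ k ≤ 2 * n, iteratedDeriv k f 0 = 0)
    (hc : iteratedDeriv (2 * n + 1) f 0 = -4 * c * ((2 * n + 1).factorial : ℝ)) :
    (fun x => f x + 4 * c * x ^ (2 * n + 1)) =O[𝓝 0] fun x => x ^ (2 * n + 2) := by
  have h1 := (isLittleO_sub_taylor hf).isBigO
  have h2 := (isBigO_refl (fun x : ℝ => x ^ (2 * n + 2)) (𝓝 0)).const_mul_left
    (iteratedDeriv (2 * n + 2) f 0 / (2 * n + 2).factorial)
  refine (h1.add h2).congr_left fun x => ?_
  rw [Finset.sum_range_succ, Finset.sum_range_succ, Finset.sum_eq_zero fun k hk => by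
    rw [hvanish k (by have := Finset.mem_range.1 hk; omega), zero_div, zero_mul], hc]
  have : ((2 * n + 1).factorial : ℝ) ≠ 0 := by positivity
  rw [mul_div_cancel_right₀ _ this]
  ring

variable {f g r : ℝ → ℝ} {a b T t₀ : ℝ}

theorem isBigO_radius_sub (ht₀ : t₀ ∈ Ioo 0 T) (hr : ContDiffOn ℝ 1 r (Icc t₀ T)) :
    (fun t => r t - r T) =O[𝓝[<] T] fun t => T - t := by
  have hd : DifferentiableWithinAt ℝ r (Icc t₀ T) T :=
    hr.differentiableOn one_ne_zero T (right_mem_Icc.2 ht₀.2.le)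
  have hle : 𝓝[<] T ≤ 𝓝[Icc t₀ T] T := by
    rw [← nhdsWithin_Ioo_eq_nhdsLT ht₀.2]
    exact nhdsWithin_mono _ Ioo_subset_Icc_self
  refine ((hd.isBigO_sub.mono hle).neg_right).congr_right fun t => by ring

theorem tendsto_sqrt_sub (T : ℝ) : Tendsto (fun t : ℝ => √(T - t)) (𝓝[<] T) (𝓝 0) := by
  have h1 : Tendsto (fun t : ℝ => √(T - t)) (𝓝 T) (𝓝 √(T - T)) :=
    Continuous.tendsto (by fun_prop) T
  rw [sub_self, Real.sqrt_zero] at h1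
  exact h1.mono_left nhdsWithin_le_nhds

theorem tendsto_curve (ht₀ : t₀ ∈ Ioo 0 T) (hr : ContDiffOn ℝ 1 r (Icc t₀ T)) :
    Tendsto (fun t => r t * √(T - t)) (𝓝[<] T) (𝓝 0) := by
  have h0 : Tendsto (fun t : ℝ => T - t) (𝓝[<] T) (𝓝 0) := by
    have h1 : Tendsto (fun t : ℝ => T - t) (𝓝 T) (𝓝 (T - T)) := Continuous.tendsto (by fun_prop) T
    rw [sub_self] at h1
    exact h1.mono_left nhdsWithin_le_nhds
  have h1 := tendsto_sub_nhds_zero_iff.1 ((isBigO_radius_sub ht₀ hr).trans_tendsto h0)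
  simpa using h1.mul (tendsto_sqrt_sub T)

/-- Blowup along the curve where `h = 2 / t`. -/
theorem IsSolution.tendsto_eLpNorm (h : H1Pair f g) (hN : Nonvanishing f T) (hf0 : f 0 = 0)
    {ω : ℝ → ℝ → ℝ} (hs : IsSolution f T ω) (ht₀ : t₀ ∈ Ioo 0 T)
    (hr : ContDiffOn ℝ 1 r (Icc t₀ T))
    (hX : ∀ t ∈ Ico t₀ T, hilbertTransform f (r t * √(T - t)) = 2 / t) :
    Tendsto (fun t => eLpNorm (ω t) ⊤ volume) (𝓝[<] T) (𝓝 ⊤) := by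
  have hev : ∀ᶠ t in 𝓝[<] T, t ∈ Ico t₀ T := Ico_mem_nhdsLT ht₀.2
  -- On the curve the first square of the denominator vanishes and the formula reduces to `4/(t²
  -- f)`, while `f → 0` along the curve.
  have hval : ∀ t ∈ Ico t₀ T, f (r t * √(T - t)) ≠ 0 ∧
      |ω t (r t * √(T - t))| = 4 * |t ^ 2 * f (r t * √(T - t))|⁻¹ := by
    intro t ht
    have ht0 : 0 < t := ht₀.1.trans_le ht.1
    obtain ⟨hD, hω, -⟩ := hs.eq_formula h hN ⟨ht0.le, ht.2⟩ (r t * √(T - t))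
    rw [hX t ht, mul_div_cancel₀ _ ht0.ne', sub_self] at hD hω
    have hne : f (r t * √(T - t)) ≠ 0 := fun h0 => hD (by rw [h0]; ring)
    refine ⟨hne, ?_⟩
    rw [hω, ← abs_inv, ← abs_of_pos (four_pos : (0 : ℝ) < 4), ← abs_mul,
      abs_of_pos (four_pos : (0 : ℝ) < 4)]
    congr 1
    field_simp
    ring
  have hlim : Tendsto (fun t => |t ^ 2 * f (r t * √(T - t))|) (𝓝[<] T) (𝓝[>] 0) := by
    refine tendsto_nhdsWithin_iff.2 ⟨?_, ?_⟩
    · have h1 : Tendsto (fun t => f (r t * √(T - t))) (𝓝[<] T) (𝓝 0) :=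
        hf0 ▸ (h.continuous.tendsto 0).comp (tendsto_curve ht₀ hr)
      have h2 : Tendsto (fun t : ℝ => t ^ 2) (𝓝[<] T) (𝓝 (T ^ 2)) :=
        (Continuous.tendsto (by fun_prop) T).mono_left nhdsWithin_le_nhds
      simpa using (h2.mul h1).abs
    · filter_upwards [hev] with t ht
      exact abs_pos.2 (mul_ne_zero (pow_ne_zero 2 (ht₀.1.trans_le ht.1).ne') (hval t ht).1)
  have hbig : Tendsto (fun t => |ω t (r t * √(T - t))|) (𝓝[<] T) atTop := by
    refine ((tendsto_inv_nhdsGT_zero.comp hlim).const_mul_atTop (four_pos : (0 : ℝ) < 4)).congr' ?_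
    filter_upwards [hev] with t ht using (hval t ht).2.symm
  refine tendsto_of_tendsto_of_tendsto_of_le_of_le' (ENNReal.tendsto_ofReal_nhds_top.2 hbig)
    tendsto_const_nhds ?_ (Eventually.of_forall fun _ => le_top)
  filter_upwards [hev] with t ht
  have hc := (hs.continuousInto.1 t ⟨ht₀.1.le.trans ht.1, ht.2⟩).1
  have := enorm_le_eLpNorm_top hc (r t * √(T - t))
  rwa [Real.enorm_eq_ofReal_abs] at this

/-- The two-scale asymptotics. -/
theorem IsSolution.asymptotics (h : H1Pair f g) {n : ℕ} (hn : 1 ≤ n) (ha : 0 < a) (hb : 0 < b)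
    {c γ : ℝ} (hc0 : 0 < c) (hT : T = 1 / a) (hN : Nonvanishing f T)
    (hF : (fun x => f x + 4 * c * x ^ (2 * n + 1)) =O[𝓝 0] fun x => x ^ (2 * n + 2))
    (hc : ContDiffAt ℝ 4 (hilbertTransform f) 0) (h0 : hilbertTransform f 0 = 2 * a)
    (e1 : (fun x => deriv (hilbertTransform f) x - (4 * b * x + 4 * γ * x ^ 3))
      =o[𝓝 0] fun x => x ^ 3)
    {ω : ℝ → ℝ → ℝ} (hs : IsSolution f T ω) (ht₀ : t₀ ∈ Ioo 0 T)
    (hr : ContDiffOn ℝ 1 r (Icc t₀ T)) (hrT : r T = a / √b)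
    (hX : ∀ t ∈ Ico t₀ T, hilbertTransform f (r t * √(T - t)) = 2 / t) (K : ℝ) :
    ∃ C : ℝ, ∃ t₁ ∈ Ico t₀ T, ∀ t ∈ Ico t₁ T, ∀ x : ℝ,
      |x - r t * √(T - t)| ≤ K * (T - t) ^ n →
        |√(T - t) ^ (2 * n + 1) * ω t x
          - profile n a b c ((x - r t * √(T - t)) / (T - t) ^ n)| ≤ C * √(T - t) ∧
        |√(T - t) ^ (2 * n + 1) * hilbertTransform (ω t) x
          - profileH n a b c ((x - r t * √(T - t)) / (T - t) ^ n)| ≤ C * √(T - t) := by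
  -- Pairs `(t, x)` with `t → T⁻` and `x` in the window of constant `K`. An `O` along this filter is
  -- an estimate uniform in `x`.
  set l : Filter (ℝ × ℝ) := comap Prod.fst (𝓝[<] T) ⊓
    𝓟 {p | |p.2 - r p.1 * √(T - p.1)| ≤ K * (T - p.1) ^ n} with hl
  have hfst : Tendsto Prod.fst l (𝓝[<] T) := tendsto_comap.mono_left inf_le_left
  have hev : ∀ᶠ p in l, p.1 ∈ Ico t₀ T := hfst.eventually (Ico_mem_nhdsLT ht₀.2)
  have hsq : ∀ t ∈ Ico t₀ T, √(T - t) ^ 2 = T - t := fun t ht => Real.sq_sqrt (sub_pos.2 ht.2).le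
  have key := rescaled_isBigO (l := l) (s := fun p => √(T - p.1)) (t := fun p => p.1)
    (x := fun p => p.2) (X := fun p => r p.1 * √(T - p.1)) hn ha hb hc0 hF hc h0 e1
    ((tendsto_sqrt_sub T).comp hfst) ?_ ?_ ?_ ?_ ?_
  · obtain ⟨C₁, hC₁⟩ := key.1.bound
    obtain ⟨C₂, hC₂⟩ := key.2.bound
    have hall := (hC₁.and hC₂).and hev
    rw [hl, eventually_inf_principal, eventually_comap] at hall
    obtain ⟨t₁, ht₁, hsub⟩ := mem_nhdsLT_iff_exists_Ico_subset.1 hall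
    refine ⟨max C₁ C₂, max t₀ t₁, ⟨le_max_left _ _, max_lt ht₀.2 ht₁⟩, fun t ht x hx => ?_⟩
    obtain ⟨⟨b1, b2⟩, ht'⟩ := hsub ⟨(le_max_right _ _).trans ht.1, ht.2⟩ (t, x) rfl hx
    obtain ⟨-, hω, hH⟩ := hs.eq_formula h hN ⟨ht₀.1.le.trans ht'.1, ht'.2⟩ x
    have hpow : √(T - t) ^ (2 * n) = (T - t) ^ n := by rw [pow_mul, hsq t ht']
    simp only [hpow, ← profile_eq_limit ha hb hc0, ← profileH_eq_limit ha hb hc0, ← hω, ← hH,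
      Real.norm_eq_abs, abs_of_nonneg (Real.sqrt_nonneg _)] at b1 b2
    exact ⟨b1.trans (mul_le_mul_of_nonneg_right (le_max_left _ _) (Real.sqrt_nonneg _)),
      b2.trans (mul_le_mul_of_nonneg_right (le_max_right _ _) (Real.sqrt_nonneg _))⟩
  · filter_upwards [hev] with p hp using Real.sqrt_pos.2 (sub_pos.2 hp.2)
  · filter_upwards [hev] with p hp
    rw [hsq _ hp, ← hT]
    ring
  · have q1 := ((isBigO_radius_sub ht₀ hr).comp_tendsto hfst).mul
      (((tendsto_sqrt_sub T).comp hfst).isBigO_one ℝ)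
    refine q1.congr' (Eventually.of_forall fun p => ?_) ?_
    · simp only [Function.comp, hrT]
      ring
    · filter_upwards [hev] with p hp
      simp only [Function.comp, mul_one, hsq _ hp]
  · refine IsBigO.of_bound K ?_
    have hmem : ∀ᶠ p in l, |p.2 - r p.1 * √(T - p.1)| ≤ K * (T - p.1) ^ n :=
      (eventually_principal.2 fun p hp => hp).filter_mono inf_le_right
    filter_upwards [hev, hmem] with p hp hpK
    rw [Real.norm_eq_abs, pow_mul, hsq _ hp, Real.norm_of_nonneg
      (pow_nonneg (sub_pos.2 hp.2).le n)]
    exact hpK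
  · filter_upwards [hev] with p hp
    rw [hX _ hp, mul_div_cancel₀ _ (ht₀.1.trans_le hp.1).ne']

theorem abs_sub_scaled_le {σ w P E : ℝ} (hσ : 0 < σ) (hE : |σ * w - P| ≤ E) :
    |w - 1 / σ * P| ≤ 1 / σ * E := by
  have e : w - 1 / σ * P = 1 / σ * (σ * w - P) := by field_simp
  rw [e, abs_mul, abs_of_pos (by positivity : 0 < 1 / σ)]
  gcongr

end Final

end CLM

theorem theorem2p3 (ω₀ : ℝ → ℝ) (n : ℕ) (δ : ℝ)
    (hH1 : CLM.MemH1 ω₀)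
    (hodd : Function.Odd ω₀)
    (hzero : ∀ x, ω₀ x = 0 ↔ x = 0)
    (hsign : ∀ x, Real.sign (ω₀ x) = -Real.sign x)
    (hn : 1 ≤ n) (hδ : 0 < δ)
    (hsmooth : ContDiffOn ℝ (2 * n + 3 : ℕ) ω₀ (Ioo (-δ) δ))
    (hvanish : ∀ k ≤ 2 * n, iteratedDeriv k ω₀ 0 = 0)
    (hneg : iteratedDeriv (2 * n + 1) ω₀ 0 < 0) :
    -- `H(ω₀)` is defined everywhere and is twice differentiable at the origin, with
    -- `H(ω₀)(0) > 0` and `H(ω₀)''(0) > 0`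
    (∀ x, CLM.HasHilbertTransformAt ω₀ x (CLM.hilbertTransform ω₀ x)) ∧
    ContDiffAt ℝ 2 (CLM.hilbertTransform ω₀) 0 ∧
    0 < CLM.hilbertTransform ω₀ 0 ∧
    0 < iteratedDeriv 2 (CLM.hilbertTransform ω₀) 0 ∧
    ∀ a b c T : ℝ, 0 < a → 0 < b → 0 < c →
      CLM.hilbertTransform ω₀ 0 = 2 * a →
      iteratedDeriv 2 (CLM.hilbertTransform ω₀) 0 = 4 * b →
      iteratedDeriv (2 * n + 1) ω₀ 0 = -4 * c * ((2 * n + 1).factorial : ℝ) →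
      T = 1 / a →
      -- the second profile is the Hilbert transform of the first
      (∀ z, CLM.HasHilbertTransformAt (CLM.profile n a b c) z (CLM.profileH n a b c z)) ∧
      -- there is a solution on `[0, T)`
      (∃ ω, CLM.IsSolution ω₀ T ω) ∧
      -- every solution on `[0, T)` blows up at time `T`
      (∀ ω, CLM.IsSolution ω₀ T ω →
        Tendsto (fun t => eLpNorm (ω t) ⊤ volume) (𝓝[<] T) (𝓝 ⊤)) ∧
      -- and it does so in the two-scale self-similar way
      ∃ t₀ ∈ Ioo 0 T, ∃ r : ℝ → ℝ,
        ContDiffOn ℝ 1 r (Icc t₀ T) ∧ r T = a / b ^ (1 / 2 : ℝ) ∧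
        ∀ ω, CLM.IsSolution ω₀ T ω → ∀ K : ℝ, ∃ C : ℝ, ∃ t₁ ∈ Ico t₀ T,
          ∀ t ∈ Ico t₁ T, ∀ x : ℝ, |x - r t * (T - t) ^ (1 / 2 : ℝ)| ≤ K * (T - t) ^ n →
            |ω t x - 1 / (T - t) ^ ((2 * (n : ℝ) + 1) / 2) *
                CLM.profile n a b c ((x - r t * (T - t) ^ (1 / 2 : ℝ)) / (T - t) ^ n)|
              ≤ 1 / (T - t) ^ ((2 * (n : ℝ) + 1) / 2) * (C * (T - t) ^ (1 / 2 : ℝ)) ∧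
            |CLM.hilbertTransform (ω t) x - 1 / (T - t) ^ ((2 * (n : ℝ) + 1) / 2) *
                CLM.profileH n a b c ((x - r t * (T - t) ^ (1 / 2 : ℝ)) / (T - t) ^ n)|
              ≤ 1 / (T - t) ^ ((2 * (n : ℝ) + 1) / 2) * (C * (T - t) ^ (1 / 2 : ℝ)) := by
  obtain ⟨hcont, hL2, g, hg, hw⟩ := hH1
  have h := CLM.H1Pair.of_hasWeakDeriv hcont hL2 hg hw
  have hneg' : ∀ u > 0, ω₀ u < 0 := fun u hu => CLM.neg_of_sign hsign hu
  have d1 : deriv ω₀ 0 = 0 := by simpa using hvanish 1 (by omega)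
  have d2 : deriv (deriv ω₀) 0 = 0 := by
    simpa [iteratedDeriv_succ] using hvanish 2 (by omega)
  have hω₀ : ω₀ 0 = 0 := (hzero 0).2 rfl
  -- Since `n ≥ 1`, the data have the five derivatives near the origin needed for `H(ω₀)` to be `C⁴`
  -- there.
  obtain ⟨hreg, hpos⟩ := CLM.hilbert_regular h hodd hneg' hδ
    (hsmooth.of_le (by exact_mod_cast (by omega : 5 ≤ 2 * n + 3))) hω₀ d1 d2
  have hdd : iteratedDeriv 2 (CLM.hilbertTransform ω₀) 0
      = deriv (deriv (CLM.hilbertTransform ω₀)) 0 := by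
    rw [iteratedDeriv_succ, iteratedDeriv_one]
  refine ⟨h.hasHilbertTransformAt, hreg.of_le (by norm_num),
    CLM.hilbertTransform_zero_pos h hodd hneg', hdd ▸ hpos, ?_⟩
  intro a b c T ha hb hc hHa hHb hωc hT
  obtain ⟨γ, e0, e1⟩ := CLM.even_expansion hreg (CLM.hilbertTransform_even h hodd)
  rw [hHb] at e0 e1
  rw [hHa, show 4 * b / 2 = 2 * b by ring] at e0
  have hN : CLM.Nonvanishing ω₀ T := hT ▸ CLM.nonvanishing_of_odd h hodd hneg' ha hHa
  obtain ⟨t₀, ht₀, r, hr, hrT, hX⟩ := CLM.exists_radius ha hb hreg hHa e0 e1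
  rw [← hT] at ht₀ hr hrT hX
  have hF := CLM.isBigO_of_vanishing ((hsmooth.of_le (by norm_cast; omega)).contDiffAt
    (Ioo_mem_nhds (by linarith) hδ)) hvanish hωc
  refine ⟨CLM.hasHilbertTransformAt_profile ha hb hc n, ⟨_, h.isSolution hN⟩,
    fun ω hs => hs.tendsto_eLpNorm h hN hω₀ ht₀ hr hX, t₀, ht₀, r, hr, ?_, ?_⟩
  · rw [hrT, Real.sqrt_eq_rpow]
  · intro ω hs K
    obtain ⟨C, t₁, ht₁, hC⟩ := hs.asymptotics h hn ha hb hc hT hN hF hreg hHa e1 ht₀ hr hrT hX K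
    refine ⟨C, t₁, ht₁, fun t ht x hx => ?_⟩
    have hTt : 0 < T - t := sub_pos.2 ht.2
    have e2 : (T - t) ^ ((2 * (n : ℝ) + 1) / 2) = √(T - t) ^ (2 * n + 1) := by
      rw [Real.rpow_div_two_eq_sqrt _ hTt.le,
        show (2 * (n : ℝ) + 1) = ((2 * n + 1 : ℕ) : ℝ) by push_cast; ring, Real.rpow_natCast]
    rw [← Real.sqrt_eq_rpow] at hx ⊢
    rw [e2]
    obtain ⟨c1, c2⟩ := hC t ht x hx
    have hσ : 0 < √(T - t) ^ (2 * n + 1) := pow_pos (Real.sqrt_pos.2 hTt) _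
    exact ⟨CLM.abs_sub_scaled_le hσ c1, CLM.abs_sub_scaled_le hσ c2⟩
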